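/- Let $k$ be a field, and let $H$ be a bialgebra over $k$; $\otimes$ means $\otimes_k$. A left $H$-module coalgebra is a coalgebra $C$ over $k$ that is also a left $H$-module such that $\Delta(hc) = h_{(1)}c_{(1)} \otimes h_{(2)}c_{(2)}$ and $\varepsilon(hc) = \varepsilon(h)\varepsilon(c)$ for all $h \in H$, $c \in C$. Let $C$, $D$ be two left $H$-module coalgebras. *Categories.* $\mathfrak{M}^C$ and ${}^C\mathfrak{M}$ are the categories of right, respectively left, $C$-comodules (of arbitrary dimension), with coactions written $m \mapsto m_{(0)} \otimes m_{(1)}$ and $m \mapsto m_{(-1)} \otimes m_{(0)}$; ${}_H\mathfrak{M}$ is the category of left $H$-modules. ${}_H\mathfrak{M}^C$ is the category of left $H$-modules $M$ with a right $C$-comodule structure such that $(hm)_{(0)} \otimes (hm)_{(1)} = h_{(1)}m_{(0)} \otimes h_{(2)}m_{(1)}$; ${}^C_H\mathfrak{M}$ is the category of left $H$-modules $M$ with a left $C$-comodule structure such that $(hm)_{(-1)} \otimes (hm)_{(0)} = h_{(1)}m_{(-1)} \otimes h_{(2)}m_{(0)}$; ${}^C_H\mathfrak{M}^D$ is the category of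 left $H$-modules that are $C$-$D$-bicomodules satisfying both compatibilities. Morphisms are the $k$-linear maps preserving all the structures. With its multiplication as action and its comultiplication as coactions, $C$ is an object of ${}^C_H\mathfrak{M}^C$. *Monoidal structures and actions.* $\mathfrak{M}^H$, ${}^H\mathfrak{M}$ and ${}_H\mathfrak{M}$ are monoidal categories with tensor product $\otimes$ and unit $k$, with coaction $x_{(0)} \otimes y_{(0)} \otimes x_{(1)}y_{(1)}$, coaction $x_{(-1)}y_{(-1)} \otimes x_{(0)} \otimes y_{(0)}$ and diagonal action $h(x\otimes y) = h_{(1)}x \otimes h_{(2)}y$, respectively. They act as follows. - $\mathfrak{M}^C$ is a left $\mathfrak{M}^H$-module category by $(X, M) \mapsto X \otimes M$ with coaction $x \otimes m \mapsto x_{(0)} \otimes m_{(0)} \otimes x_{(1)} m_{(1)}$. - ${}^C\mathfrak{M}$ is a left ${}^H\mathfrak{M}$-module category by $(X, M) \mapsto X \otimes M$ with coaction $x \otimes m \mapsto x_{(-1)} m_{(-1)} \otimes x_{(0)} \otimes m_{(0)}$. - ${}_H\mathfrak{M}^C$ is a left ${}_H\mathfrak{M}$-module category by $(X, M) \mapsto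 X \otimes M$ with the diagonal action of $H$ and the coaction $x \otimes m \mapsto x \otimes m_{(0)} \otimes m_{(1)}$. - ${}^C_H\mathfrak{M}$ is a right ${}_H\mathfrak{M}$-module category by $(M, X) \mapsto M \otimes X$ with the diagonal action of $H$ and the coaction $m \otimes x \mapsto m_{(-1)} \otimes m_{(0)} \otimes x$. All associativity and unit isomorphisms are those of vector spaces. Two (left or right) module categories $\mathcal{A}$, $\mathcal{B}$ over a monoidal category are equivalent if there are lax module functors $F\colon \mathcal{A} \to \mathcal{B}$ and $G\colon \mathcal{B} \to \mathcal{A}$ such that $GF \cong \mathrm{id}_{\mathcal{A}}$ and $FG \cong \mathrm{id}_{\mathcal{B}}$ as lax module functors. *Cotensor product.* For $M \in {}^C_H\mathfrak{M}^D$ and $N \in {}^D_H\mathfrak{M}^C$, the cotensor product is $$M \mathbin{\square}_D N = \Bigl\{ \textstyle\sum m \otimes n \in M \otimes N : \sum m_{(0)} \otimes m_{(1)} \otimes n = \sum m \otimes n_{(-1)} \otimes n_{(0)} \Bigr\},$$ an object of ${}^C_H\mathfrak{M}^C$ by the diagonal action of $H$, the left coaction of $M$ and the right coaction of $N$; similarly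 $N \mathbin{\square}_C M \in {}^D_H\mathfrak{M}^D$. **Theorem.** The following are equivalent: 1. $\mathfrak{M}^C$ and $\mathfrak{M}^D$ are equivalent as left $\mathfrak{M}^H$-module categories. 2. ${}^C\mathfrak{M}$ and ${}^D\mathfrak{M}$ are equivalent as left ${}^H\mathfrak{M}$-module categories. 3. ${}_H\mathfrak{M}^C$ and ${}_H\mathfrak{M}^D$ are equivalent as left ${}_H\mathfrak{M}$-module categories. 4. ${}^C_H\mathfrak{M}$ and ${}^D_H\mathfrak{M}$ are equivalent as right ${}_H\mathfrak{M}$-module categories. 5. There are objects $M \in {}^C_H\mathfrak{M}^D$ and $N \in {}^D_H\mathfrak{M}^C$ such that $M \mathbin{\square}_D N \cong C$ in ${}^C_H\mathfrak{M}^C$ and $N \mathbin{\square}_C M \cong D$ in ${}^D_H\mathfrak{M}^D$. -/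

import Mathlib

open CategoryTheory MonoidalCategory
open scoped TensorProduct
open TensorProduct (tensorTensorTensorComm assoc lid rid add_tmul tmul_add smul_tmul ext_threefold
  ext_fourfold)
open CoalgebraStruct (comul)
open LinearMap (comp_assoc)

universe u

namespace EqMT

@[elab_as_elim]
theorem indOn {k A B : Type u} [Field k] [AddCommGroup A] [Module k A] [AddCommGroup B]
    [Module k B] {p : A ⊗[k] B → Prop} (t : A ⊗[k] B) (zero : p 0) (tmul : ∀ a b, p (a ⊗ₜ b))
    (add : ∀ x y, p x → p y → p (x + y)) : p t :=
  TensorProduct.induction_on t zero tmul add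

section Algebra

variable {k : Type u} [Field k]

/-- The action map `H ⊗ V → V`, `h ⊗ v ↦ h v`, of a representation of the algebra `H` on `V`. -/
def actMap {H : Type u} [Ring H] [Algebra k H] {V : Type u} [AddCommGroup V] [Module k V]
    (φ : H →ₐ[k] Module.End k V) : H ⊗[k] V →ₗ[k] V :=
  TensorProduct.lift φ.toLinearMap

@[simp]
theorem actMap_tmul {H : Type u} [Ring H] [Algebra k H] {V : Type u} [AddCommGroup V]
    [Module k V] (φ : H →ₐ[k] Module.End k V) (h : H) (v : V) : actMap φ (h ⊗ₜ v) = φ h v := rfl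

/-- The diagonal action `h (v ⊗ w) = h₍₁₎ v ⊗ h₍₂₎ w` of a bialgebra `H` on `V ⊗ W`. -/
def diagAct {H : Type u} [Ring H] [Bialgebra k H]
    {V W : Type u} [AddCommGroup V] [Module k V] [AddCommGroup W] [Module k W]
    (φ : H →ₐ[k] Module.End k V) (ψ : H →ₐ[k] Module.End k W) :
    H →ₐ[k] Module.End k (V ⊗[k] W) :=
  (Module.endTensorEndAlgHom (R := k) (S := k) (A := k) (M := V) (N := W)).comp
    ((Algebra.TensorProduct.map φ ψ).comp (Bialgebra.comulAlgHom k H))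

/-- The trivial action `h r = ε(h) r` of a bialgebra `H` on the ground field. -/
def trivAct (k : Type u) [Field k] (H : Type u) [Ring H] [Bialgebra k H] :
    H →ₐ[k] Module.End k k :=
  (Algebra.lsmul k k k).comp (Bialgebra.counitAlgHom k H)

/-- The map `(v ⊗ h) ⊗ (w ⊗ c) ↦ (v ⊗ w) ⊗ h c`. -/
def mulCoact (k H C : Type u) [Field k] [Ring H] [Algebra k H] [AddCommGroup C] [Module k C]
    [Module H C] [IsScalarTower k H C] (V W : Type u) [AddCommGroup V] [Module k V]
    [AddCommGroup W] [Module k W] : (V ⊗[k] H) ⊗[k] (W ⊗[k] C) →ₗ[k] (V ⊗[k] W) ⊗[k] C :=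
  (actMap (Algebra.lsmul k k C)).lTensor (V ⊗[k] W) ∘ₗ
    (tensorTensorTensorComm k V H W C).toLinearMap

@[simp]
theorem mulCoact_tmul {H C : Type u} [Ring H] [Algebra k H] [AddCommGroup C] [Module k C]
    [Module H C] [IsScalarTower k H C] {V W : Type u} [AddCommGroup V] [Module k V]
    [AddCommGroup W] [Module k W] (v : V) (h : H) (w : W) (c : C) :
    mulCoact k H C V W ((v ⊗ₜ h) ⊗ₜ (w ⊗ₜ c)) = (v ⊗ₜ w) ⊗ₜ (h • c) := rfl

/-- The map `(h ⊗ v) ⊗ (c ⊗ w) ↦ h c ⊗ (v ⊗ w)`. -/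
def mulCoactL (k H C : Type u) [Field k] [Ring H] [Algebra k H] [AddCommGroup C] [Module k C]
    [Module H C] [IsScalarTower k H C] (V W : Type u) [AddCommGroup V] [Module k V]
    [AddCommGroup W] [Module k W] : (H ⊗[k] V) ⊗[k] (C ⊗[k] W) →ₗ[k] C ⊗[k] (V ⊗[k] W) :=
  (actMap (Algebra.lsmul k k C)).rTensor (V ⊗[k] W) ∘ₗ
    (tensorTensorTensorComm k H V C W).toLinearMap

@[simp]
theorem mulCoactL_tmul {H C : Type u} [Ring H] [Algebra k H] [AddCommGroup C] [Module k C]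
    [Module H C] [IsScalarTower k H C] {V W : Type u} [AddCommGroup V] [Module k V]
    [AddCommGroup W] [Module k W] (h : H) (v : V) (c : C) (w : W) :
    mulCoactL k H C V W ((h ⊗ₜ v) ⊗ₜ (c ⊗ₜ w)) = (h • c) ⊗ₜ (v ⊗ₜ w) := rfl

end Algebra

/-- `C` is a left `H`-module coalgebra: a coalgebra and a left `H`-module such that
`Δ(h c) = h₍₁₎ c₍₁₎ ⊗ h₍₂₎ c₍₂₎` and `ε(h c) = ε(h) ε(c)`. -/
class ModuleCoalgebra (k H C : Type u) [Field k] [Ring H] [Bialgebra k H]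
    [AddCommGroup C] [Module k C] [Coalgebra k C] [Module H C] [IsScalarTower k H C] : Prop where
  comul_smul (h : H) (c : C) : comul (R := k) (h • c) =
    TensorProduct.map (actMap (Algebra.lsmul k k C)) (actMap (Algebra.lsmul k k C))
      (tensorTensorTensorComm k H H C C
        (comul (R := k) h ⊗ₜ[k] comul (R := k) c))
  counit_smul (h : H) (c : C) : CoalgebraStruct.counit (R := k) (h • c) =
    CoalgebraStruct.counit (R := k) h * CoalgebraStruct.counit (R := k) c

instance (k H : Type u) [Field k] [Ring H] [Bialgebra k H] : ModuleCoalgebra k H H where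
  comul_smul h c := by
    rw [smul_eq_mul, Bialgebra.comul_mul]
    generalize (comul (R := k) h) = s
    generalize (comul (R := k) c) = t
    refine indOn s (by simp) (fun a b => ?_)
      (fun _ _ hx hy => by simp only [add_mul, hx, hy, add_tmul, map_add])
    refine indOn t (by simp) (fun c d => ?_)
      (fun _ _ hx hy => by simp only [mul_add, hx, hy, tmul_add, map_add])
    simp [actMap]
  counit_smul h c := by simp

/-- A right comodule over the coalgebra `C`. -/
structure RComod (k C : Type u) [Field k] [AddCommGroup C] [Module k C] [Coalgebra k C] where
  carrier : Type u
  [addCommGroup : AddCommGroup carrier]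
  [module : Module k carrier]
  coact : carrier →ₗ[k] carrier ⊗[k] C
  coassoc : (assoc k carrier C C).toLinearMap ∘ₗ coact.rTensor C ∘ₗ coact =
    (comul (R := k) (A := C)).lTensor carrier ∘ₗ coact
  counit : (rid k carrier).toLinearMap ∘ₗ
    (CoalgebraStruct.counit (R := k) (A := C)).lTensor carrier ∘ₗ coact = LinearMap.id

attribute [instance] RComod.addCommGroup RComod.module

namespace RComod

section Cat

variable {k C : Type u} [Field k] [AddCommGroup C] [Module k C] [Coalgebra k C]

/-- A morphism of right comodules: a colinear map. -/
@[ext]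
structure Hom (M N : RComod k C) where
  lin : M.carrier →ₗ[k] N.carrier
  comm : N.coact ∘ₗ lin = lin.rTensor C ∘ₗ M.coact

instance : Category (RComod k C) where
  Hom := Hom
  id M := ⟨LinearMap.id, by simp⟩
  comp f g := ⟨g.lin ∘ₗ f.lin, by
    rw [← comp_assoc, g.comm, comp_assoc, f.comm, ← comp_assoc,
      LinearMap.rTensor_comp]⟩

theorem hom_ext {M N : RComod k C} {f g : M ⟶ N} (h : ∀ x, f.lin x = g.lin x) : f = g :=
  Hom.ext (LinearMap.ext h)

/-- The colinear isomorphism given by a colinear linear isomorphism. -/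
def mkIso {M N : RComod k C} (e : M.carrier ≃ₗ[k] N.carrier)
    (h : N.coact ∘ₗ e.toLinearMap = e.toLinearMap.rTensor C ∘ₗ M.coact) : M ≅ N where
  hom := ⟨e.toLinearMap, h⟩
  inv := ⟨e.symm.toLinearMap, by
    apply LinearMap.ext
    intro x
    obtain ⟨y, rfl⟩ := e.surjective x
    have hy := LinearMap.congr_fun h y
    simp only [LinearMap.comp_apply, LinearEquiv.coe_coe] at hy ⊢
    rw [hy, ← LinearMap.comp_apply, ← LinearMap.rTensor_comp]
    simp⟩
  hom_inv_id := hom_ext fun x => e.symm_apply_apply x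
  inv_hom_id := hom_ext fun x => e.apply_symm_apply x

end Cat

section Tens

variable {k H C : Type u} [Field k] [Ring H] [Bialgebra k H]
  [AddCommGroup C] [Module k C] [Coalgebra k C] [Module H C] [IsScalarTower k H C]

variable [ModuleCoalgebra k H C]

/-- The tensor product `X ⊗ M` of a right `H`-comodule `X` and a right `C`-comodule `M`, with
coaction `x ⊗ m ↦ x₍₀₎ ⊗ m₍₀₎ ⊗ x₍₁₎ m₍₁₎`. -/
def tens (X : RComod k H) (M : RComod k C) : RComod k C where
  carrier := X.carrier ⊗[k] M.carrier
  coact := mulCoact k H C X.carrier M.carrier ∘ₗ TensorProduct.map X.coact M.coact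
  coassoc := by
    let Ψ := (TensorProduct.map (actMap (Algebra.lsmul k k C)) (actMap (Algebra.lsmul k k C)) ∘ₗ
      (tensorTensorTensorComm k H H C C).toLinearMap).lTensor
        (X.carrier ⊗[k] M.carrier) ∘ₗ
      (tensorTensorTensorComm k X.carrier (H ⊗[k] H) M.carrier
        (C ⊗[k] C)).toLinearMap
    have hL : ∀ (t : X.carrier ⊗[k] H) (s : M.carrier ⊗[k] C),
        assoc k (X.carrier ⊗[k] M.carrier) C C ((mulCoact k H C X.carrier M.carrier ∘ₗ
          TensorProduct.map X.coact M.coact).rTensor C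
          (mulCoact k H C X.carrier M.carrier (t ⊗ₜ s))) =
        Ψ (assoc k _ _ _ (X.coact.rTensor H t) ⊗ₜ
          assoc k _ _ _ (M.coact.rTensor C s)) := by
      intro t s
      refine indOn t (by simp) (fun x h => ?_)
        (fun _ _ hx hy => by simp only [add_tmul, map_add, hx, hy])
      refine indOn s (by simp) (fun m c => ?_)
        (fun _ _ hx hy => by simp only [tmul_add, map_add, hx, hy])
      simp only [mulCoact_tmul, LinearMap.rTensor_tmul, LinearMap.comp_apply,
        TensorProduct.map_tmul]
      generalize X.coact x = t
      generalize M.coact m = s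
      refine indOn t (by simp) (fun x h => ?_)
        (fun _ _ hx hy => by simp only [add_tmul, map_add, hx, hy])
      refine indOn s (by simp) (fun m c => ?_)
        (fun _ _ hx hy => by simp only [add_tmul, tmul_add, map_add, hx, hy])
      simp [Ψ]
    have hR : ∀ (t : X.carrier ⊗[k] H) (s : M.carrier ⊗[k] C),
        (comul (R := k) (A := C)).lTensor (X.carrier ⊗[k] M.carrier)
          (mulCoact k H C X.carrier M.carrier (t ⊗ₜ s)) =
        Ψ ((comul (R := k) (A := H)).lTensor _ t ⊗ₜ
          (comul (R := k) (A := C)).lTensor _ s) := by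
      intro t s
      refine indOn t (by simp) (fun x h => ?_)
        (fun _ _ hx hy => by simp only [add_tmul, map_add, hx, hy])
      refine indOn s (by simp) (fun m c => ?_)
        (fun _ _ hx hy => by simp only [tmul_add, map_add, hx, hy])
      simp [Ψ, ModuleCoalgebra.comul_smul]
    refine TensorProduct.ext' fun x m => ?_
    have hx := LinearMap.congr_fun X.coassoc x
    have hm := LinearMap.congr_fun M.coassoc m
    simp only [LinearMap.comp_apply, LinearEquiv.coe_coe] at hx hm
    refine (hL (X.coact x) (M.coact m)).trans (Eq.trans ?_ (hR (X.coact x) (M.coact m)).symm)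
    rw [hx, hm]
  counit := by
    have hR : ∀ (t : X.carrier ⊗[k] H) (s : M.carrier ⊗[k] C),
        rid k _ ((CoalgebraStruct.counit (R := k) (A := C)).lTensor
          (X.carrier ⊗[k] M.carrier) (mulCoact k H C X.carrier M.carrier (t ⊗ₜ s))) =
        rid k _ ((CoalgebraStruct.counit (R := k) (A := H)).lTensor _ t) ⊗ₜ
          rid k _ ((CoalgebraStruct.counit (R := k) (A := C)).lTensor _ s) := by
      intro t s
      refine indOn t (by simp) (fun x h => ?_)
        (fun _ _ hx hy => by simp only [add_tmul, map_add, hx, hy])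
      refine indOn s (by simp) (fun m c => ?_)
        (fun _ _ hx hy => by simp only [tmul_add, map_add, hx, hy])
      simp only [mulCoact_tmul, LinearMap.lTensor_tmul, TensorProduct.rid_tmul,
        ModuleCoalgebra.counit_smul, TensorProduct.smul_tmul_smul]
    refine TensorProduct.ext' fun x m => ?_
    have hx := LinearMap.congr_fun X.counit x
    have hm := LinearMap.congr_fun M.counit m
    simp only [LinearMap.comp_apply, LinearEquiv.coe_coe] at hx hm
    refine (hR (X.coact x) (M.coact m)).trans ?_
    rw [hx, hm]
    rfl

/-- The tensor product of two morphisms. -/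
def tensMap {X X' : RComod k H} {M M' : RComod k C} (f : X ⟶ X') (g : M ⟶ M') :
    tens X M ⟶ tens X' M' where
  lin := TensorProduct.map f.lin g.lin
  comm := by
    have h : ∀ (t : X.carrier ⊗[k] H) (s : M.carrier ⊗[k] C),
        mulCoact k H C X'.carrier M'.carrier
          (f.lin.rTensor H t ⊗ₜ g.lin.rTensor C s) =
        (TensorProduct.map f.lin g.lin).rTensor C (mulCoact k H C X.carrier M.carrier (t ⊗ₜ s)) := by
      intro t s
      refine indOn t (by simp) (fun x h => ?_)
        (fun _ _ hx hy => by simp only [add_tmul, map_add, hx, hy])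
      refine indOn s (by simp) (fun m c => ?_)
        (fun _ _ hx hy => by simp only [tmul_add, map_add, hx, hy])
      simp
    refine TensorProduct.ext' fun x m => ?_
    have hx := LinearMap.congr_fun f.comm x
    have hm := LinearMap.congr_fun g.comm m
    simp only [LinearMap.comp_apply] at hx hm
    refine Eq.trans ?_ (h (X.coact x) (M.coact m))
    rw [← hx, ← hm]
    rfl

variable (k H) in
/-- The ground field with the coaction `1 ↦ 1 ⊗ 1`. -/
def unit : RComod k H where
  carrier := k
  coact := (LinearMap.toSpanSingleton k (k ⊗[k] H) (1 ⊗ₜ 1))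
  coassoc := by ext; simp [Algebra.TensorProduct.one_def]
  counit := by ext; simp

/-- The associativity isomorphism `(X ⊗ Y) ⊗ M ≅ X ⊗ (Y ⊗ M)`. -/
def tensAssoc (X Y : RComod k H) (M : RComod k C) :
    tens (tens X Y) M ≅ tens X (tens Y M) :=
  mkIso (assoc k X.carrier Y.carrier M.carrier) (by
    have h : ∀ (t : X.carrier ⊗[k] H) (s : Y.carrier ⊗[k] H) (r : M.carrier ⊗[k] C),
        mulCoact k H C X.carrier (Y.carrier ⊗[k] M.carrier)
          (t ⊗ₜ mulCoact k H C Y.carrier M.carrier (s ⊗ₜ r)) =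
        (assoc k X.carrier Y.carrier M.carrier).toLinearMap.rTensor C
          (mulCoact k H C (X.carrier ⊗[k] Y.carrier) M.carrier
            (mulCoact k H H X.carrier Y.carrier (t ⊗ₜ s) ⊗ₜ r)) := by
      intro t s r
      refine indOn t (by simp) (fun x h => ?_)
        (fun _ _ hx hy => by simp only [add_tmul, map_add, hx, hy])
      refine indOn s (by simp) (fun y h => ?_)
        (fun _ _ hx hy => by simp only [add_tmul, tmul_add, map_add, hx, hy])
      refine indOn r (by simp) (fun m c => ?_)
        (fun _ _ hx hy => by simp only [tmul_add, map_add, hx, hy])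
      simp [mul_smul]
    exact ext_threefold fun x y m => h (X.coact x) (Y.coact y) (M.coact m))

/-- The left unit isomorphism `k ⊗ M ≅ M`. -/
def tensLeftUnit (M : RComod k C) : tens (unit k H) M ≅ M :=
  mkIso (lid k M.carrier) (by
    have h : ∀ (r : k) (s : M.carrier ⊗[k] C), r • s =
        (lid k M.carrier).toLinearMap.rTensor C
          (mulCoact k H C k M.carrier ((r • (1 : k) ⊗ₜ (1 : H)) ⊗ₜ s)) := by
      intro r s
      refine indOn s (by simp) (fun m c => ?_)
        (fun _ _ hx hy => by simp only [smul_add, tmul_add, map_add, hx, hy])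
      simp [TensorProduct.smul_tmul']
    exact TensorProduct.ext' fun r m => (M.coact.map_smul r m).trans (h r (M.coact m)))

/-- The right unit isomorphism `X ⊗ k ≅ X`. -/
def tensRightUnit (X : RComod k H) : tens X (unit k H) ≅ X :=
  mkIso (rid k X.carrier) (by
    have h : ∀ (r : k) (s : X.carrier ⊗[k] H), r • s =
        (rid k X.carrier).toLinearMap.rTensor H
          (mulCoact k H H X.carrier k (s ⊗ₜ (r • (1 : k) ⊗ₜ (1 : H)))) := by
      intro r s
      refine indOn s (by simp) (fun m c => ?_)
        (fun _ _ hx hy => by simp only [smul_add, add_tmul, map_add, hx, hy])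
      simp [TensorProduct.smul_tmul']
    exact TensorProduct.ext' fun x r => (X.coact.map_smul r x).trans (h r (X.coact x)))

end Tens

section Instances

variable {k H C : Type u} [Field k] [Ring H] [Bialgebra k H]
  [AddCommGroup C] [Module k C] [Coalgebra k C] [Module H C] [IsScalarTower k H C]
  [ModuleCoalgebra k H C]

/-- The monoidal category of right `H`-comodules. -/
instance : MonoidalCategory (RComod k H) where
  tensorObj := tens
  whiskerLeft X _ _ f := tensMap (𝟙 X) f
  whiskerRight f Y := tensMap f (𝟙 Y)
  tensorHom := tensMap
  tensorUnit := unit k H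
  associator := tensAssoc
  leftUnitor := tensLeftUnit
  rightUnitor := tensRightUnit
  tensorHom_def _ _ := Hom.ext (TensorProduct.ext' fun _ _ => rfl)
  id_tensorHom_id _ _ := Hom.ext (TensorProduct.ext' fun _ _ => rfl)
  tensorHom_comp_tensorHom _ _ _ _ := Hom.ext (TensorProduct.ext' fun _ _ => rfl)
  whiskerLeft_id _ _ := Hom.ext (TensorProduct.ext' fun _ _ => rfl)
  id_whiskerRight _ _ := Hom.ext (TensorProduct.ext' fun _ _ => rfl)
  associator_naturality _ _ _ := Hom.ext (ext_threefold fun _ _ _ => rfl)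
  leftUnitor_naturality f := Hom.ext (TensorProduct.ext' fun r x => (f.lin.map_smul r x).symm)
  rightUnitor_naturality f := Hom.ext (TensorProduct.ext' fun x r => (f.lin.map_smul r x).symm)
  pentagon _ _ _ _ := Hom.ext (ext_fourfold fun _ _ _ _ => rfl)
  triangle _ _ := Hom.ext (ext_threefold fun x (r : k) y =>
    (smul_tmul r x y).symm)

/-- The category of right `C`-comodules as a left module category over the category of
right `H`-comodules. -/
instance : MonoidalLeftAction (RComod k H) (RComod k C) where
  actionObj := tens
  actionHomLeft f M := tensMap f (𝟙 M)
  actionHomRight X _ _ f := tensMap (𝟙 X) f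
  actionHom := tensMap
  actionAssocIso := tensAssoc
  actionUnitIso := tensLeftUnit
  actionHom_def _ _ := Hom.ext (TensorProduct.ext' fun _ _ => rfl)
  actionHomRight_id _ _ := Hom.ext (TensorProduct.ext' fun _ _ => rfl)
  id_actionHomLeft _ _ := Hom.ext (TensorProduct.ext' fun _ _ => rfl)
  actionHom_comp _ _ _ _ := Hom.ext (TensorProduct.ext' fun _ _ => rfl)
  actionAssocIso_hom_naturality _ _ _ := Hom.ext (ext_threefold fun _ _ _ => rfl)
  actionUnitIso_hom_naturality f :=
    Hom.ext (TensorProduct.ext' fun r x => f.lin.map_smul r x)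
  whiskerLeft_actionHomLeft _ _ _ _ _ := Hom.ext (ext_threefold fun _ _ _ => rfl)
  whiskerRight_actionHomLeft _ _ _ := Hom.ext (ext_threefold fun _ _ _ => rfl)
  associator_actionHom _ _ _ _ := Hom.ext (ext_fourfold fun _ _ _ _ => rfl)
  leftUnitor_actionHom _ _ := Hom.ext (ext_threefold fun (r : k) x m =>
    (TensorProduct.smul_tmul' r x m).symm)
  rightUnitor_actionHom _ _ := Hom.ext (ext_threefold fun x (r : k) m =>
    smul_tmul r x m)

end Instances

end RComod
/-- A left comodule over the coalgebra `C`. -/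
structure LComod (k C : Type u) [Field k] [AddCommGroup C] [Module k C] [Coalgebra k C] where
  carrier : Type u
  [addCommGroup : AddCommGroup carrier]
  [module : Module k carrier]
  coact : carrier →ₗ[k] C ⊗[k] carrier
  coassoc : (assoc k C C carrier).toLinearMap ∘ₗ
    (comul (R := k) (A := C)).rTensor carrier ∘ₗ coact = coact.lTensor C ∘ₗ coact
  counit : (lid k carrier).toLinearMap ∘ₗ
    (CoalgebraStruct.counit (R := k) (A := C)).rTensor carrier ∘ₗ coact = LinearMap.id

attribute [instance] LComod.addCommGroup LComod.module

namespace LComod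

section Cat

variable {k C : Type u} [Field k] [AddCommGroup C] [Module k C] [Coalgebra k C]

/-- A morphism of left comodules: a colinear map. -/
@[ext]
structure Hom (M N : LComod k C) where
  lin : M.carrier →ₗ[k] N.carrier
  comm : N.coact ∘ₗ lin = lin.lTensor C ∘ₗ M.coact

instance : Category (LComod k C) where
  Hom := Hom
  id M := ⟨LinearMap.id, by simp⟩
  comp f g := ⟨g.lin ∘ₗ f.lin, by
    rw [← comp_assoc, g.comm, comp_assoc, f.comm, ← comp_assoc,
      LinearMap.lTensor_comp]⟩

theorem hom_ext {M N : LComod k C} {f g : M ⟶ N} (h : ∀ x, f.lin x = g.lin x) : f = g :=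
  Hom.ext (LinearMap.ext h)

/-- The colinear isomorphism given by a colinear linear isomorphism. -/
def mkIso {M N : LComod k C} (e : M.carrier ≃ₗ[k] N.carrier)
    (h : N.coact ∘ₗ e.toLinearMap = e.toLinearMap.lTensor C ∘ₗ M.coact) : M ≅ N where
  hom := ⟨e.toLinearMap, h⟩
  inv := ⟨e.symm.toLinearMap, by
    apply LinearMap.ext
    intro x
    obtain ⟨y, rfl⟩ := e.surjective x
    have hy := LinearMap.congr_fun h y
    simp only [LinearMap.comp_apply, LinearEquiv.coe_coe] at hy ⊢
    rw [hy, ← LinearMap.comp_apply, ← LinearMap.lTensor_comp]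
    simp⟩
  hom_inv_id := hom_ext fun x => e.symm_apply_apply x
  inv_hom_id := hom_ext fun x => e.apply_symm_apply x

end Cat

section Tens

variable {k H C : Type u} [Field k] [Ring H] [Bialgebra k H]
  [AddCommGroup C] [Module k C] [Coalgebra k C] [Module H C] [IsScalarTower k H C]

variable [ModuleCoalgebra k H C]

/-- The tensor product `X ⊗ M` of a left `H`-comodule `X` and a left `C`-comodule `M`, with
coaction `x ⊗ m ↦ x₍₋₁₎ m₍₋₁₎ ⊗ x₍₀₎ ⊗ m₍₀₎`. -/
def tens (X : LComod k H) (M : LComod k C) : LComod k C where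
  carrier := X.carrier ⊗[k] M.carrier
  coact := mulCoactL k H C X.carrier M.carrier ∘ₗ TensorProduct.map X.coact M.coact
  coassoc := by
    let Ψ := (assoc k C C (X.carrier ⊗[k] M.carrier)).toLinearMap ∘ₗ
      (TensorProduct.map (actMap (Algebra.lsmul k k C)) (actMap (Algebra.lsmul k k C)) ∘ₗ
        (tensorTensorTensorComm k H H C C).toLinearMap).rTensor
          (X.carrier ⊗[k] M.carrier) ∘ₗ
      (tensorTensorTensorComm k (H ⊗[k] H) X.carrier
        (C ⊗[k] C) M.carrier).toLinearMap
    have hL : ∀ (t : H ⊗[k] X.carrier) (s : C ⊗[k] M.carrier),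
        (mulCoactL k H C X.carrier M.carrier ∘ₗ TensorProduct.map X.coact M.coact).lTensor C
          (mulCoactL k H C X.carrier M.carrier (t ⊗ₜ s)) =
        Ψ ((assoc k _ _ _).symm (X.coact.lTensor H t) ⊗ₜ
          (assoc k _ _ _).symm (M.coact.lTensor C s)) := by
      intro t s
      refine indOn t (by simp) (fun h x => ?_)
        (fun _ _ hx hy => by simp only [add_tmul, map_add, hx, hy])
      refine indOn s (by simp) (fun c m => ?_)
        (fun _ _ hx hy => by simp only [tmul_add, map_add, hx, hy])
      simp only [mulCoactL_tmul, LinearMap.lTensor_tmul, LinearMap.comp_apply,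
        TensorProduct.map_tmul]
      generalize X.coact x = t
      generalize M.coact m = s
      refine indOn t (by simp) (fun h x => ?_)
        (fun _ _ hx hy => by simp only [tmul_add, add_tmul, map_add, hx, hy])
      refine indOn s (by simp) (fun c m => ?_)
        (fun _ _ hx hy => by simp only [tmul_add, map_add, hx, hy])
      simp [Ψ]
    have hR : ∀ (t : H ⊗[k] X.carrier) (s : C ⊗[k] M.carrier),
        assoc k C C (X.carrier ⊗[k] M.carrier)
          ((comul (R := k) (A := C)).rTensor (X.carrier ⊗[k] M.carrier)
            (mulCoactL k H C X.carrier M.carrier (t ⊗ₜ s))) =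
        Ψ ((comul (R := k) (A := H)).rTensor _ t ⊗ₜ
          (comul (R := k) (A := C)).rTensor _ s) := by
      intro t s
      refine indOn t (by simp) (fun h x => ?_)
        (fun _ _ hx hy => by simp only [add_tmul, map_add, hx, hy])
      refine indOn s (by simp) (fun c m => ?_)
        (fun _ _ hx hy => by simp only [tmul_add, map_add, hx, hy])
      simp [Ψ, ModuleCoalgebra.comul_smul]
    refine TensorProduct.ext' fun x m => ?_
    have hx := LinearMap.congr_fun X.coassoc x
    have hm := LinearMap.congr_fun M.coassoc m
    simp only [LinearMap.comp_apply, LinearEquiv.coe_coe] at hx hm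
    refine (hR (X.coact x) (M.coact m)).trans (Eq.trans ?_ (hL (X.coact x) (M.coact m)).symm)
    rw [← hx, ← hm, LinearEquiv.symm_apply_apply, LinearEquiv.symm_apply_apply]
  counit := by
    have hR : ∀ (t : H ⊗[k] X.carrier) (s : C ⊗[k] M.carrier),
        lid k _ ((CoalgebraStruct.counit (R := k) (A := C)).rTensor
          (X.carrier ⊗[k] M.carrier) (mulCoactL k H C X.carrier M.carrier (t ⊗ₜ s))) =
        lid k _ ((CoalgebraStruct.counit (R := k) (A := H)).rTensor _ t) ⊗ₜ
          lid k _ ((CoalgebraStruct.counit (R := k) (A := C)).rTensor _ s) := by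
      intro t s
      refine indOn t (by simp) (fun h x => ?_)
        (fun _ _ hx hy => by simp only [add_tmul, map_add, hx, hy])
      refine indOn s (by simp) (fun c m => ?_)
        (fun _ _ hx hy => by simp only [tmul_add, map_add, hx, hy])
      simp only [mulCoactL_tmul, LinearMap.rTensor_tmul, TensorProduct.lid_tmul,
        ModuleCoalgebra.counit_smul, TensorProduct.smul_tmul_smul]
    refine TensorProduct.ext' fun x m => ?_
    have hx := LinearMap.congr_fun X.counit x
    have hm := LinearMap.congr_fun M.counit m
    simp only [LinearMap.comp_apply, LinearEquiv.coe_coe] at hx hm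
    refine (hR (X.coact x) (M.coact m)).trans ?_
    rw [hx, hm]
    rfl

/-- The tensor product of two morphisms. -/
def tensMap {X X' : LComod k H} {M M' : LComod k C} (f : X ⟶ X') (g : M ⟶ M') :
    tens X M ⟶ tens X' M' where
  lin := TensorProduct.map f.lin g.lin
  comm := by
    have h : ∀ (t : H ⊗[k] X.carrier) (s : C ⊗[k] M.carrier),
        mulCoactL k H C X'.carrier M'.carrier
          (f.lin.lTensor H t ⊗ₜ g.lin.lTensor C s) =
        (TensorProduct.map f.lin g.lin).lTensor C (mulCoactL k H C X.carrier M.carrier (t ⊗ₜ s)) := by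
      intro t s
      refine indOn t (by simp) (fun h x => ?_)
        (fun _ _ hx hy => by simp only [add_tmul, map_add, hx, hy])
      refine indOn s (by simp) (fun c m => ?_)
        (fun _ _ hx hy => by simp only [tmul_add, map_add, hx, hy])
      simp
    refine TensorProduct.ext' fun x m => ?_
    have hx := LinearMap.congr_fun f.comm x
    have hm := LinearMap.congr_fun g.comm m
    simp only [LinearMap.comp_apply] at hx hm
    refine Eq.trans ?_ (h (X.coact x) (M.coact m))
    rw [← hx, ← hm]
    rfl

variable (k H) in
/-- The ground field with the coaction `1 ↦ 1 ⊗ 1`. -/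
def unit : LComod k H where
  carrier := k
  coact := (LinearMap.toSpanSingleton k (H ⊗[k] k) (1 ⊗ₜ 1))
  coassoc := by ext; simp [Algebra.TensorProduct.one_def]
  counit := by ext; simp

/-- The associativity isomorphism `(X ⊗ Y) ⊗ M ≅ X ⊗ (Y ⊗ M)`. -/
def tensAssoc (X Y : LComod k H) (M : LComod k C) :
    tens (tens X Y) M ≅ tens X (tens Y M) :=
  mkIso (assoc k X.carrier Y.carrier M.carrier) (by
    have h : ∀ (t : H ⊗[k] X.carrier) (s : H ⊗[k] Y.carrier) (r : C ⊗[k] M.carrier),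
        mulCoactL k H C X.carrier (Y.carrier ⊗[k] M.carrier)
          (t ⊗ₜ mulCoactL k H C Y.carrier M.carrier (s ⊗ₜ r)) =
        (assoc k X.carrier Y.carrier M.carrier).toLinearMap.lTensor C
          (mulCoactL k H C (X.carrier ⊗[k] Y.carrier) M.carrier
            (mulCoactL k H H X.carrier Y.carrier (t ⊗ₜ s) ⊗ₜ r)) := by
      intro t s r
      refine indOn t (by simp) (fun h x => ?_)
        (fun _ _ hx hy => by simp only [add_tmul, map_add, hx, hy])
      refine indOn s (by simp) (fun g y => ?_)
        (fun _ _ hx hy => by simp only [add_tmul, tmul_add, map_add, hx, hy])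
      refine indOn r (by simp) (fun c m => ?_)
        (fun _ _ hx hy => by simp only [tmul_add, map_add, hx, hy])
      simp [mul_smul]
    exact ext_threefold fun x y m => h (X.coact x) (Y.coact y) (M.coact m))

/-- The left unit isomorphism `k ⊗ M ≅ M`. -/
def tensLeftUnit (M : LComod k C) : tens (unit k H) M ≅ M :=
  mkIso (lid k M.carrier) (by
    have h : ∀ (r : k) (s : C ⊗[k] M.carrier), r • s =
        (lid k M.carrier).toLinearMap.lTensor C
          (mulCoactL k H C k M.carrier ((r • (1 : H) ⊗ₜ (1 : k)) ⊗ₜ s)) := by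
      intro r s
      refine indOn s (by simp) (fun c m => ?_)
        (fun _ _ hx hy => by simp only [smul_add, tmul_add, map_add, hx, hy])
      simp [TensorProduct.smul_tmul']
    exact TensorProduct.ext' fun r m => (M.coact.map_smul r m).trans (h r (M.coact m)))

/-- The right unit isomorphism `X ⊗ k ≅ X`. -/
def tensRightUnit (X : LComod k H) : tens X (unit k H) ≅ X :=
  mkIso (rid k X.carrier) (by
    have h : ∀ (r : k) (s : H ⊗[k] X.carrier), r • s =
        (rid k X.carrier).toLinearMap.lTensor H
          (mulCoactL k H H X.carrier k (s ⊗ₜ (r • (1 : H) ⊗ₜ (1 : k)))) := by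
      intro r s
      refine indOn s (by simp) (fun c m => ?_)
        (fun _ _ hx hy => by simp only [smul_add, add_tmul, map_add, hx, hy])
      simp [TensorProduct.smul_tmul']
    exact TensorProduct.ext' fun x r => (X.coact.map_smul r x).trans (h r (X.coact x)))

end Tens

section Instances

variable {k H C : Type u} [Field k] [Ring H] [Bialgebra k H]
  [AddCommGroup C] [Module k C] [Coalgebra k C] [Module H C] [IsScalarTower k H C]
  [ModuleCoalgebra k H C]

/-- The monoidal category of left `H`-comodules. -/
instance : MonoidalCategory (LComod k H) where
  tensorObj := tens
  whiskerLeft X _ _ f := tensMap (𝟙 X) f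
  whiskerRight f Y := tensMap f (𝟙 Y)
  tensorHom := tensMap
  tensorUnit := unit k H
  associator := tensAssoc
  leftUnitor := tensLeftUnit
  rightUnitor := tensRightUnit
  tensorHom_def _ _ := Hom.ext (TensorProduct.ext' fun _ _ => rfl)
  id_tensorHom_id _ _ := Hom.ext (TensorProduct.ext' fun _ _ => rfl)
  tensorHom_comp_tensorHom _ _ _ _ := Hom.ext (TensorProduct.ext' fun _ _ => rfl)
  whiskerLeft_id _ _ := Hom.ext (TensorProduct.ext' fun _ _ => rfl)
  id_whiskerRight _ _ := Hom.ext (TensorProduct.ext' fun _ _ => rfl)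
  associator_naturality _ _ _ := Hom.ext (ext_threefold fun _ _ _ => rfl)
  leftUnitor_naturality f := Hom.ext (TensorProduct.ext' fun r x => (f.lin.map_smul r x).symm)
  rightUnitor_naturality f := Hom.ext (TensorProduct.ext' fun x r => (f.lin.map_smul r x).symm)
  pentagon _ _ _ _ := Hom.ext (ext_fourfold fun _ _ _ _ => rfl)
  triangle _ _ := Hom.ext (ext_threefold fun x (r : k) y =>
    (smul_tmul r x y).symm)

/-- The category of left `C`-comodules as a left module category over the category of
left `H`-comodules. -/
instance : MonoidalLeftAction (LComod k H) (LComod k C) where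
  actionObj := tens
  actionHomLeft f M := tensMap f (𝟙 M)
  actionHomRight X _ _ f := tensMap (𝟙 X) f
  actionHom := tensMap
  actionAssocIso := tensAssoc
  actionUnitIso := tensLeftUnit
  actionHom_def _ _ := Hom.ext (TensorProduct.ext' fun _ _ => rfl)
  actionHomRight_id _ _ := Hom.ext (TensorProduct.ext' fun _ _ => rfl)
  id_actionHomLeft _ _ := Hom.ext (TensorProduct.ext' fun _ _ => rfl)
  actionHom_comp _ _ _ _ := Hom.ext (TensorProduct.ext' fun _ _ => rfl)
  actionAssocIso_hom_naturality _ _ _ := Hom.ext (ext_threefold fun _ _ _ => rfl)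
  actionUnitIso_hom_naturality f :=
    Hom.ext (TensorProduct.ext' fun r x => f.lin.map_smul r x)
  whiskerLeft_actionHomLeft _ _ _ _ _ := Hom.ext (ext_threefold fun _ _ _ => rfl)
  whiskerRight_actionHomLeft _ _ _ := Hom.ext (ext_threefold fun _ _ _ => rfl)
  associator_actionHom _ _ _ _ := Hom.ext (ext_fourfold fun _ _ _ _ => rfl)
  leftUnitor_actionHom _ _ := Hom.ext (ext_threefold fun (r : k) x m =>
    (TensorProduct.smul_tmul' r x m).symm)
  rightUnitor_actionHom _ _ := Hom.ext (ext_threefold fun x (r : k) m =>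
    smul_tmul r x m)

end Instances

end LComod
section DiagAct

variable {k H : Type u} [Field k] [Ring H] [Bialgebra k H]
  {V W U V' W' : Type u} [AddCommGroup V] [Module k V] [AddCommGroup W] [Module k W]
  [AddCommGroup U] [Module k U] [AddCommGroup V'] [Module k V'] [AddCommGroup W'] [Module k W']

theorem diagAct_tmul (φ : H →ₐ[k] Module.End k V) (ψ : H →ₐ[k] Module.End k W)
    (h : H) (v : V) (w : W) : diagAct φ ψ h (v ⊗ₜ w) =
      TensorProduct.map (φ.toLinearMap.flip v) (ψ.toLinearMap.flip w)
        (comul (R := k) h) := by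
  change Module.endTensorEndAlgHom (R := k) (S := k) (A := k) (M := V) (N := W)
    (Algebra.TensorProduct.map φ ψ (comul (R := k) h)) (v ⊗ₜ w) = _
  generalize comul (R := k) h = t
  refine indOn t (by simp) (fun a b => ?_)
    (fun _ _ hx hy => by simp only [map_add, LinearMap.add_apply, hx, hy])
  simp [Module.endTensorEndAlgHom_apply]

theorem diagAct_assoc (φ : H →ₐ[k] Module.End k V) (ψ : H →ₐ[k] Module.End k W)
    (χ : H →ₐ[k] Module.End k U) (h : H) :
    (assoc k V W U).toLinearMap ∘ₗ diagAct (diagAct φ ψ) χ h =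
      diagAct φ (diagAct ψ χ) h ∘ₗ (assoc k V W U).toLinearMap := by
  refine ext_threefold fun v w u => ?_
  have e1 : (diagAct φ ψ).toLinearMap.flip (v ⊗ₜ w) =
      TensorProduct.map (φ.toLinearMap.flip v) (ψ.toLinearMap.flip w) ∘ₗ
        comul (R := k) := LinearMap.ext fun a => diagAct_tmul φ ψ a v w
  have e2 : (diagAct ψ χ).toLinearMap.flip (w ⊗ₜ u) =
      TensorProduct.map (ψ.toLinearMap.flip w) (χ.toLinearMap.flip u) ∘ₗ
        comul (R := k) := LinearMap.ext fun a => diagAct_tmul ψ χ a w u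
  simp only [LinearMap.comp_apply, LinearEquiv.coe_coe, TensorProduct.assoc_tmul]
  rw [diagAct_tmul, diagAct_tmul, e1, e2]
  have hc := LinearMap.congr_fun (Coalgebra.coassoc (R := k) (A := H)) h
  simp only [LinearMap.comp_apply, LinearEquiv.coe_coe] at hc
  have g1 : ∀ t : H ⊗[k] H, TensorProduct.map (TensorProduct.map (φ.toLinearMap.flip v)
      (ψ.toLinearMap.flip w) ∘ₗ comul (R := k)) (χ.toLinearMap.flip u) t =
      TensorProduct.map (TensorProduct.map (φ.toLinearMap.flip v) (ψ.toLinearMap.flip w))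
        (χ.toLinearMap.flip u) ((comul (R := k)).rTensor H t) := by
    intro t
    rw [← LinearMap.comp_apply, LinearMap.map_comp_rTensor]
  have g2 : ∀ t : H ⊗[k] H, TensorProduct.map (φ.toLinearMap.flip v) (TensorProduct.map
      (ψ.toLinearMap.flip w) (χ.toLinearMap.flip u) ∘ₗ comul (R := k)) t =
      TensorProduct.map (φ.toLinearMap.flip v) (TensorProduct.map (ψ.toLinearMap.flip w)
        (χ.toLinearMap.flip u)) ((comul (R := k)).lTensor H t) := by
    intro t
    rw [← LinearMap.comp_apply, LinearMap.map_comp_lTensor]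
  rw [g1, g2, ← hc]
  exact (LinearMap.congr_fun (TensorProduct.map_map_comp_assoc_eq (φ.toLinearMap.flip v)
    (ψ.toLinearMap.flip w) (χ.toLinearMap.flip u)) _).symm

theorem diagAct_assoc_symm (φ : H →ₐ[k] Module.End k V) (ψ : H →ₐ[k] Module.End k W)
    (χ : H →ₐ[k] Module.End k U) (h : H) :
    (assoc k V W U).symm.toLinearMap ∘ₗ diagAct φ (diagAct ψ χ) h =
      diagAct (diagAct φ ψ) χ h ∘ₗ (assoc k V W U).symm.toLinearMap := by
  refine LinearMap.ext fun t => ?_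
  obtain ⟨s, rfl⟩ := (assoc k V W U).surjective t
  have := LinearMap.congr_fun (diagAct_assoc φ ψ χ h) s
  simp only [LinearMap.comp_apply, LinearEquiv.coe_coe] at this ⊢
  rw [← this, LinearEquiv.symm_apply_apply, LinearEquiv.symm_apply_apply]

theorem diagAct_map {φ : H →ₐ[k] Module.End k V} {ψ : H →ₐ[k] Module.End k W}
    {φ' : H →ₐ[k] Module.End k V'} {ψ' : H →ₐ[k] Module.End k W'}
    {f : V →ₗ[k] V'} {g : W →ₗ[k] W'} (hf : ∀ h, f ∘ₗ φ h = φ' h ∘ₗ f)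
    (hg : ∀ h, g ∘ₗ ψ h = ψ' h ∘ₗ g) (h : H) :
    TensorProduct.map f g ∘ₗ diagAct φ ψ h = diagAct φ' ψ' h ∘ₗ TensorProduct.map f g := by
  refine TensorProduct.ext' fun v w => ?_
  have e1 : f ∘ₗ φ.toLinearMap.flip v = φ'.toLinearMap.flip (f v) :=
    LinearMap.ext fun a => LinearMap.congr_fun (hf a) v
  have e2 : g ∘ₗ ψ.toLinearMap.flip w = ψ'.toLinearMap.flip (g w) :=
    LinearMap.ext fun a => LinearMap.congr_fun (hg a) w
  simp only [LinearMap.comp_apply, TensorProduct.map_tmul]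
  rw [diagAct_tmul, diagAct_tmul, ← LinearMap.comp_apply, ← TensorProduct.map_comp, e1, e2]

theorem diagAct_lid (φ : H →ₐ[k] Module.End k V) (h : H) :
    (lid k V).toLinearMap ∘ₗ diagAct (trivAct k H) φ h =
      φ h ∘ₗ (lid k V).toLinearMap := by
  refine TensorProduct.ext' fun r v => ?_
  simp only [LinearMap.comp_apply, LinearEquiv.coe_coe, TensorProduct.lid_tmul]
  have hc := Coalgebra.rTensor_counit_comul (R := k) h
  have g : ∀ t : H ⊗[k] H, lid k V (TensorProduct.map
      ((trivAct k H).toLinearMap.flip r) (φ.toLinearMap.flip v) t) =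
      r • φ.toLinearMap.flip v (lid k H
        ((CoalgebraStruct.counit (R := k)).rTensor H t)) := by
    intro t
    refine indOn t (by simp) (fun a b => ?_)
      (fun _ _ hx hy => by simp only [map_add, smul_add, hx, hy])
    simp [trivAct, mul_smul, smul_comm r]
  rw [diagAct_tmul, g, hc]
  simp

theorem diagAct_rid (φ : H →ₐ[k] Module.End k V) (h : H) :
    (rid k V).toLinearMap ∘ₗ diagAct φ (trivAct k H) h =
      φ h ∘ₗ (rid k V).toLinearMap := by
  refine TensorProduct.ext' fun v r => ?_
  simp only [LinearMap.comp_apply, LinearEquiv.coe_coe, TensorProduct.rid_tmul]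
  have hc := Coalgebra.lTensor_counit_comul (R := k) h
  have g : ∀ t : H ⊗[k] H, rid k V (TensorProduct.map
      (φ.toLinearMap.flip v) ((trivAct k H).toLinearMap.flip r) t) =
      r • φ.toLinearMap.flip v (rid k H
        ((CoalgebraStruct.counit (R := k)).lTensor H t)) := by
    intro t
    refine indOn t (by simp) (fun a b => ?_)
      (fun _ _ hx hy => by simp only [map_add, smul_add, hx, hy])
    simp [trivAct, mul_smul, smul_comm r]
  rw [diagAct_tmul, g, hc]
  simp

/-- The comultiplication of a module coalgebra is equivariant for the diagonal action. -/
theorem comul_equivariant (C : Type u) [AddCommGroup C] [Module k C] [Coalgebra k C] [Module H C]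
    [IsScalarTower k H C] [ModuleCoalgebra k H C] (h : H) :
    (comul (R := k) (A := C)) ∘ₗ Algebra.lsmul k k C h =
      diagAct (Algebra.lsmul k k C) (Algebra.lsmul k k C) h ∘ₗ comul := by
  refine LinearMap.ext fun c => ?_
  refine (ModuleCoalgebra.comul_smul h c).trans ?_
  rw [LinearMap.comp_apply]
  generalize comul (R := k) c = s
  refine indOn s (by simp) (fun c d => ?_)
    (fun _ _ hx hy => by simp only [tmul_add, map_add, hx, hy])
  rw [diagAct_tmul]
  generalize comul (R := k) h = t
  refine indOn t (by simp) (fun a b => ?_)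
    (fun _ _ hx hy => by simp only [add_tmul, map_add, hx, hy])
  simp

end DiagAct

/-- A left module over the `k`-algebra `H`: a `k`-vector space with an algebra map from `H` to its
endomorphism algebra. -/
structure HMod (k H : Type u) [Field k] [Ring H] [Algebra k H] where
  carrier : Type u
  [addCommGroup : AddCommGroup carrier]
  [module : Module k carrier]
  act : H →ₐ[k] Module.End k carrier

attribute [instance] HMod.addCommGroup HMod.module

namespace HMod

section Cat

variable {k H : Type u} [Field k] [Ring H] [Algebra k H]

/-- A morphism of left `H`-modules. -/
@[ext]
structure Hom (M N : HMod k H) where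
  lin : M.carrier →ₗ[k] N.carrier
  comm : ∀ h, lin ∘ₗ M.act h = N.act h ∘ₗ lin

instance : Category (HMod k H) where
  Hom := Hom
  id M := ⟨LinearMap.id, fun _ => rfl⟩
  comp f g := ⟨g.lin ∘ₗ f.lin, fun h => by
    rw [comp_assoc, f.comm, ← comp_assoc, g.comm, comp_assoc]⟩

theorem hom_ext {M N : HMod k H} {f g : M ⟶ N} (h : ∀ x, f.lin x = g.lin x) : f = g :=
  Hom.ext (LinearMap.ext h)

/-- The isomorphism given by an `H`-linear bijection. -/
def mkIso {M N : HMod k H} (e : M.carrier ≃ₗ[k] N.carrier)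
    (h : ∀ a, e.toLinearMap ∘ₗ M.act a = N.act a ∘ₗ e.toLinearMap) : M ≅ N where
  hom := ⟨e.toLinearMap, h⟩
  inv := ⟨e.symm.toLinearMap, fun a => by
    apply LinearMap.ext
    intro x
    obtain ⟨y, rfl⟩ := e.surjective x
    have hy := LinearMap.congr_fun (h a) y
    simp only [LinearMap.comp_apply, LinearEquiv.coe_coe] at hy ⊢
    rw [← hy, e.symm_apply_apply, e.symm_apply_apply]⟩
  hom_inv_id := hom_ext fun x => e.symm_apply_apply x
  inv_hom_id := hom_ext fun x => e.apply_symm_apply x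

end Cat

variable {k H : Type u} [Field k] [Ring H] [Bialgebra k H]

/-- The tensor product of two modules, with the diagonal action. -/
def tens (X Y : HMod k H) : HMod k H where
  carrier := X.carrier ⊗[k] Y.carrier
  act := diagAct X.act Y.act

/-- The tensor product of two morphisms. -/
def tensMap {X X' Y Y' : HMod k H} (f : X ⟶ X') (g : Y ⟶ Y') : tens X Y ⟶ tens X' Y' where
  lin := TensorProduct.map f.lin g.lin
  comm := diagAct_map f.comm g.comm

variable (k H) in
/-- The trivial module. -/
def unit : HMod k H where
  carrier := k
  act := trivAct k H

/-- The monoidal category of left `H`-modules. -/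
instance : MonoidalCategory (HMod k H) where
  tensorObj := tens
  whiskerLeft X _ _ f := tensMap (𝟙 X) f
  whiskerRight f Y := tensMap f (𝟙 Y)
  tensorHom := tensMap
  tensorUnit := unit k H
  associator X Y Z := mkIso (assoc k X.carrier Y.carrier Z.carrier)
    (diagAct_assoc X.act Y.act Z.act)
  leftUnitor X := mkIso (lid k X.carrier) (diagAct_lid X.act)
  rightUnitor X := mkIso (rid k X.carrier) (diagAct_rid X.act)
  tensorHom_def _ _ := Hom.ext (TensorProduct.ext' fun _ _ => rfl)
  id_tensorHom_id _ _ := Hom.ext (TensorProduct.ext' fun _ _ => rfl)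
  tensorHom_comp_tensorHom _ _ _ _ := Hom.ext (TensorProduct.ext' fun _ _ => rfl)
  whiskerLeft_id _ _ := Hom.ext (TensorProduct.ext' fun _ _ => rfl)
  id_whiskerRight _ _ := Hom.ext (TensorProduct.ext' fun _ _ => rfl)
  associator_naturality _ _ _ := Hom.ext (ext_threefold fun _ _ _ => rfl)
  leftUnitor_naturality f := Hom.ext (TensorProduct.ext' fun r x => (f.lin.map_smul r x).symm)
  rightUnitor_naturality f := Hom.ext (TensorProduct.ext' fun x r => (f.lin.map_smul r x).symm)
  pentagon _ _ _ _ := Hom.ext (ext_fourfold fun _ _ _ _ => rfl)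
  triangle _ _ := Hom.ext (ext_threefold fun x (r : k) y =>
    (smul_tmul r x y).symm)

end HMod

/-- A right `C`-comodule in the category of left `H`-modules, that is, a left `H`-module and right
`C`-comodule `M` such that `ρ(h m) = h₍₁₎ m₍₀₎ ⊗ h₍₂₎ m₍₁₎`. -/
structure HRComod (k H C : Type u) [Field k] [Ring H] [Bialgebra k H]
    [AddCommGroup C] [Module k C] [Coalgebra k C] [Module H C] [IsScalarTower k H C]
    extends RComod k C where
  act : H →ₐ[k] Module.End k carrier
  equivariant : ∀ h, coact ∘ₗ act h = diagAct act (Algebra.lsmul k k C) h ∘ₗ coact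

namespace HRComod

variable {k H C : Type u} [Field k] [Ring H] [Bialgebra k H]
  [AddCommGroup C] [Module k C] [Coalgebra k C] [Module H C] [IsScalarTower k H C]

/-- A morphism: an `H`-linear and `C`-colinear map. -/
@[ext]
structure Hom (M N : HRComod k H C) where
  lin : M.carrier →ₗ[k] N.carrier
  comm : N.coact ∘ₗ lin = lin.rTensor C ∘ₗ M.coact
  comm_act : ∀ h, lin ∘ₗ M.act h = N.act h ∘ₗ lin

instance : Category (HRComod k H C) where
  Hom := Hom
  id M := ⟨LinearMap.id, by simp, fun _ => rfl⟩
  comp f g := ⟨g.lin ∘ₗ f.lin, by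
    rw [← comp_assoc, g.comm, comp_assoc, f.comm, ← comp_assoc,
      LinearMap.rTensor_comp], fun h => by
    rw [comp_assoc, f.comm_act, ← comp_assoc, g.comm_act,
      comp_assoc]⟩

theorem hom_ext {M N : HRComod k H C} {f g : M ⟶ N} (h : ∀ x, f.lin x = g.lin x) : f = g :=
  Hom.ext (LinearMap.ext h)

/-- The isomorphism given by an `H`-linear and `C`-colinear bijection. -/
def mkIso {M N : HRComod k H C} (e : M.carrier ≃ₗ[k] N.carrier)
    (h : N.coact ∘ₗ e.toLinearMap = e.toLinearMap.rTensor C ∘ₗ M.coact)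
    (h' : ∀ a, e.toLinearMap ∘ₗ M.act a = N.act a ∘ₗ e.toLinearMap) : M ≅ N where
  hom := ⟨e.toLinearMap, h, h'⟩
  inv := ⟨e.symm.toLinearMap, by
    apply LinearMap.ext
    intro x
    obtain ⟨y, rfl⟩ := e.surjective x
    have hy := LinearMap.congr_fun h y
    simp only [LinearMap.comp_apply, LinearEquiv.coe_coe] at hy ⊢
    rw [hy, ← LinearMap.comp_apply, ← LinearMap.rTensor_comp]
    simp, fun a => by
    apply LinearMap.ext
    intro x
    obtain ⟨y, rfl⟩ := e.surjective x
    have hy := LinearMap.congr_fun (h' a) y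
    simp only [LinearMap.comp_apply, LinearEquiv.coe_coe] at hy ⊢
    rw [← hy, e.symm_apply_apply, e.symm_apply_apply]⟩
  hom_inv_id := hom_ext fun x => e.symm_apply_apply x
  inv_hom_id := hom_ext fun x => e.apply_symm_apply x

/-- `X ⊗ M` for a left `H`-module `X`, with the diagonal action and the coaction
`x ⊗ m ↦ x ⊗ m₍₀₎ ⊗ m₍₁₎`. -/
def tens (X : HMod k H) (M : HRComod k H C) : HRComod k H C where
  carrier := X.carrier ⊗[k] M.carrier
  coact := (assoc k X.carrier M.carrier C).symm.toLinearMap ∘ₗ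
    M.coact.lTensor X.carrier
  coassoc := by
    have g : ∀ (x : X.carrier) (t : M.carrier ⊗[k] C),
        assoc k (X.carrier ⊗[k] M.carrier) C C
          (((assoc k X.carrier M.carrier C).symm.toLinearMap ∘ₗ
            M.coact.lTensor X.carrier).rTensor C
              ((assoc k X.carrier M.carrier C).symm (x ⊗ₜ t))) =
        (assoc k X.carrier M.carrier (C ⊗[k] C)).symm
          (x ⊗ₜ assoc k _ _ _ (M.coact.rTensor C t)) := by
      intro x t
      refine indOn t (by simp) (fun m c => ?_)
        (fun _ _ hy hz => by simp only [tmul_add, map_add, hy, hz])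
      simp only [TensorProduct.assoc_symm_tmul, LinearMap.rTensor_tmul, LinearMap.comp_apply,
        LinearMap.lTensor_tmul, LinearEquiv.coe_coe]
      generalize M.coact m = s
      refine indOn s (by simp) (fun m d => ?_)
        (fun _ _ hy hz => by simp only [tmul_add, add_tmul, map_add, hy, hz])
      simp
    have g' : ∀ (x : X.carrier) (t : M.carrier ⊗[k] C),
        (comul (R := k) (A := C)).lTensor (X.carrier ⊗[k] M.carrier)
          ((assoc k X.carrier M.carrier C).symm (x ⊗ₜ t)) =
        (assoc k X.carrier M.carrier (C ⊗[k] C)).symm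
          (x ⊗ₜ (comul (R := k) (A := C)).lTensor _ t) := by
      intro x t
      refine indOn t (by simp) (fun m c => ?_)
        (fun _ _ hy hz => by simp only [tmul_add, map_add, hy, hz])
      simp
    refine TensorProduct.ext' fun x m => ?_
    have hm := LinearMap.congr_fun M.coassoc m
    simp only [LinearMap.comp_apply, LinearEquiv.coe_coe] at hm
    refine (g x (M.coact m)).trans (Eq.trans ?_ (g' x (M.coact m)).symm)
    rw [hm]
  counit := by
    have g : ∀ (x : X.carrier) (t : M.carrier ⊗[k] C),
        rid k _ ((CoalgebraStruct.counit (R := k) (A := C)).lTensor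
          (X.carrier ⊗[k] M.carrier)
            ((assoc k X.carrier M.carrier C).symm (x ⊗ₜ t))) =
        x ⊗ₜ rid k _ ((CoalgebraStruct.counit (R := k) (A := C)).lTensor _ t) := by
      intro x t
      refine indOn t (by simp) (fun m c => ?_)
        (fun _ _ hy hz => by simp only [tmul_add, map_add, hy, hz])
      simp
    refine TensorProduct.ext' fun x m => ?_
    have hm := LinearMap.congr_fun M.counit m
    simp only [LinearMap.comp_apply, LinearEquiv.coe_coe] at hm
    refine (g x (M.coact m)).trans ?_
    rw [hm]
    rfl
  act := diagAct X.act M.act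
  equivariant h := by
    rw [comp_assoc, ← comp_assoc _ _ (diagAct (diagAct _ _) _ h),
      ← diagAct_assoc_symm, comp_assoc]
    exact congrArg _ (diagAct_map (f := LinearMap.id) (fun _ => rfl) M.equivariant h)

/-- The tensor product of two morphisms. -/
def tensMap {X X' : HMod k H} {M M' : HRComod k H C} (f : X ⟶ X') (g : M ⟶ M') :
    tens X M ⟶ tens X' M' where
  lin := TensorProduct.map f.lin g.lin
  comm := by
    have h : ∀ (x : X.carrier) (t : M.carrier ⊗[k] C),
        (assoc k X'.carrier M'.carrier C).symm (f.lin x ⊗ₜ g.lin.rTensor C t) =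
        (TensorProduct.map f.lin g.lin).rTensor C
          ((assoc k X.carrier M.carrier C).symm (x ⊗ₜ t)) := by
      intro x t
      refine indOn t (by simp) (fun m c => ?_)
        (fun _ _ hy hz => by simp only [tmul_add, map_add, hy, hz])
      simp
    refine TensorProduct.ext' fun x m => ?_
    have hm := LinearMap.congr_fun g.comm m
    simp only [LinearMap.comp_apply] at hm
    refine Eq.trans ?_ (h x (M.coact m))
    rw [← hm]
    rfl
  comm_act := diagAct_map f.comm g.comm_act

/-- The associativity isomorphism `(X ⊗ Y) ⊗ M ≅ X ⊗ (Y ⊗ M)`. -/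
def tensAssoc (X Y : HMod k H) (M : HRComod k H C) :
    tens (X ⊗ Y) M ≅ tens X (tens Y M) :=
  mkIso (assoc k X.carrier Y.carrier M.carrier) (by
    have h : ∀ (x : X.carrier) (y : Y.carrier) (t : M.carrier ⊗[k] C),
        (assoc k X.carrier (Y.carrier ⊗[k] M.carrier) C).symm
          (x ⊗ₜ (assoc k Y.carrier M.carrier C).symm (y ⊗ₜ t)) =
        (assoc k X.carrier Y.carrier M.carrier).toLinearMap.rTensor C
          ((assoc k (X.carrier ⊗[k] Y.carrier) M.carrier C).symm
            ((x ⊗ₜ y) ⊗ₜ t)) := by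
      intro x y t
      refine indOn t (by simp) (fun m c => ?_)
        (fun _ _ hy hz => by simp only [tmul_add, map_add, hy, hz])
      simp
    exact ext_threefold fun x y m => h x y (M.coact m))
    (diagAct_assoc X.act Y.act M.act)

/-- The unit isomorphism `k ⊗ M ≅ M`. -/
def tensUnit (M : HRComod k H C) : tens (𝟙_ (HMod k H)) M ≅ M :=
  mkIso (lid k M.carrier) (by
    have h : ∀ (r : k) (t : M.carrier ⊗[k] C), r • t =
        (lid k M.carrier).toLinearMap.rTensor C
          ((assoc k k M.carrier C).symm (r ⊗ₜ t)) := by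
      intro r t
      refine indOn t (by simp) (fun m c => ?_)
        (fun _ _ hy hz => by simp only [smul_add, tmul_add, map_add, hy, hz])
      simp [TensorProduct.smul_tmul']
    exact TensorProduct.ext' fun r m => (M.coact.map_smul r m).trans (h r (M.coact m)))
    (diagAct_lid M.act)

/-- The left action of the category of left `H`-modules. -/
instance : MonoidalLeftAction (HMod k H) (HRComod k H C) where
  actionObj := tens
  actionHomLeft f M := tensMap f (𝟙 M)
  actionHomRight X _ _ f := tensMap (𝟙 X) f
  actionHom := tensMap
  actionAssocIso := tensAssoc
  actionUnitIso := tensUnit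
  actionHom_def _ _ := Hom.ext (TensorProduct.ext' fun _ _ => rfl)
  actionHomRight_id _ _ := Hom.ext (TensorProduct.ext' fun _ _ => rfl)
  id_actionHomLeft _ _ := Hom.ext (TensorProduct.ext' fun _ _ => rfl)
  actionHom_comp _ _ _ _ := Hom.ext (TensorProduct.ext' fun _ _ => rfl)
  actionAssocIso_hom_naturality _ _ _ := Hom.ext (ext_threefold fun _ _ _ => rfl)
  actionUnitIso_hom_naturality f :=
    Hom.ext (TensorProduct.ext' fun r x => f.lin.map_smul r x)
  whiskerLeft_actionHomLeft _ _ _ _ _ := Hom.ext (ext_threefold fun _ _ _ => rfl)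
  whiskerRight_actionHomLeft _ _ _ := Hom.ext (ext_threefold fun _ _ _ => rfl)
  associator_actionHom _ _ _ _ := Hom.ext (ext_fourfold fun _ _ _ _ => rfl)
  leftUnitor_actionHom _ _ := Hom.ext (ext_threefold fun (r : k) x m =>
    (TensorProduct.smul_tmul' r x m).symm)
  rightUnitor_actionHom _ _ := Hom.ext (ext_threefold fun x (r : k) m =>
    smul_tmul r x m)

end HRComod

/-- A left `C`-comodule in the category of left `H`-modules, that is, a left `H`-module and left
`C`-comodule `M` such that `λ(h m) = h₍₁₎ m₍₋₁₎ ⊗ h₍₂₎ m₍₀₎`. -/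
structure HLComod (k H C : Type u) [Field k] [Ring H] [Bialgebra k H]
    [AddCommGroup C] [Module k C] [Coalgebra k C] [Module H C] [IsScalarTower k H C]
    extends LComod k C where
  act : H →ₐ[k] Module.End k carrier
  equivariant : ∀ h, coact ∘ₗ act h = diagAct (Algebra.lsmul k k C) act h ∘ₗ coact

namespace HLComod

variable {k H C : Type u} [Field k] [Ring H] [Bialgebra k H]
  [AddCommGroup C] [Module k C] [Coalgebra k C] [Module H C] [IsScalarTower k H C]

/-- A morphism: an `H`-linear and `C`-colinear map. -/
@[ext]
structure Hom (M N : HLComod k H C) where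
  lin : M.carrier →ₗ[k] N.carrier
  comm : N.coact ∘ₗ lin = lin.lTensor C ∘ₗ M.coact
  comm_act : ∀ h, lin ∘ₗ M.act h = N.act h ∘ₗ lin

instance : Category (HLComod k H C) where
  Hom := Hom
  id M := ⟨LinearMap.id, by simp, fun _ => rfl⟩
  comp f g := ⟨g.lin ∘ₗ f.lin, by
    rw [← comp_assoc, g.comm, comp_assoc, f.comm, ← comp_assoc,
      LinearMap.lTensor_comp], fun h => by
    rw [comp_assoc, f.comm_act, ← comp_assoc, g.comm_act,
      comp_assoc]⟩

theorem hom_ext {M N : HLComod k H C} {f g : M ⟶ N} (h : ∀ x, f.lin x = g.lin x) : f = g :=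
  Hom.ext (LinearMap.ext h)

/-- The isomorphism given by an `H`-linear and `C`-colinear bijection. -/
def mkIso {M N : HLComod k H C} (e : M.carrier ≃ₗ[k] N.carrier)
    (h : N.coact ∘ₗ e.toLinearMap = e.toLinearMap.lTensor C ∘ₗ M.coact)
    (h' : ∀ a, e.toLinearMap ∘ₗ M.act a = N.act a ∘ₗ e.toLinearMap) : M ≅ N where
  hom := ⟨e.toLinearMap, h, h'⟩
  inv := ⟨e.symm.toLinearMap, by
    apply LinearMap.ext
    intro x
    obtain ⟨y, rfl⟩ := e.surjective x
    have hy := LinearMap.congr_fun h y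
    simp only [LinearMap.comp_apply, LinearEquiv.coe_coe] at hy ⊢
    rw [hy, ← LinearMap.comp_apply, ← LinearMap.lTensor_comp]
    simp, fun a => by
    apply LinearMap.ext
    intro x
    obtain ⟨y, rfl⟩ := e.surjective x
    have hy := LinearMap.congr_fun (h' a) y
    simp only [LinearMap.comp_apply, LinearEquiv.coe_coe] at hy ⊢
    rw [← hy, e.symm_apply_apply, e.symm_apply_apply]⟩
  hom_inv_id := hom_ext fun x => e.symm_apply_apply x
  inv_hom_id := hom_ext fun x => e.apply_symm_apply x

/-- `M ⊗ X` for a left `H`-module `X`, with the diagonal action and the coaction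
`m ⊗ x ↦ m₍₋₁₎ ⊗ m₍₀₎ ⊗ x`. -/
def tens (M : HLComod k H C) (X : HMod k H) : HLComod k H C where
  carrier := M.carrier ⊗[k] X.carrier
  coact := (assoc k C M.carrier X.carrier).toLinearMap ∘ₗ
    M.coact.rTensor X.carrier
  coassoc := by
    have g : ∀ (x : X.carrier) (t : C ⊗[k] M.carrier),
        ((assoc k C M.carrier X.carrier).toLinearMap ∘ₗ
            M.coact.rTensor X.carrier).lTensor C
              (assoc k C M.carrier X.carrier (t ⊗ₜ x)) =
        assoc k C C (M.carrier ⊗[k] X.carrier)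
          (assoc k (C ⊗[k] C) M.carrier X.carrier
            ((assoc k _ _ _).symm (M.coact.lTensor C t) ⊗ₜ x)) := by
      intro x t
      refine indOn t (by simp) (fun c m => ?_)
        (fun _ _ hy hz => by simp only [add_tmul, map_add, hy, hz])
      simp only [TensorProduct.assoc_tmul, LinearMap.lTensor_tmul, LinearMap.comp_apply,
        LinearMap.rTensor_tmul, LinearEquiv.coe_coe]
      generalize M.coact m = s
      refine indOn s (by simp) (fun d m => ?_)
        (fun _ _ hy hz => by simp only [tmul_add, add_tmul, map_add, hy, hz])
      simp
    have g' : ∀ (x : X.carrier) (t : C ⊗[k] M.carrier),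
        (comul (R := k) (A := C)).rTensor (M.carrier ⊗[k] X.carrier)
          (assoc k C M.carrier X.carrier (t ⊗ₜ x)) =
        assoc k (C ⊗[k] C) M.carrier X.carrier
          ((comul (R := k) (A := C)).rTensor _ t ⊗ₜ x) := by
      intro x t
      refine indOn t (by simp) (fun c m => ?_)
        (fun _ _ hy hz => by simp only [add_tmul, map_add, hy, hz])
      simp
    refine TensorProduct.ext' fun m x => ?_
    have hm := LinearMap.congr_fun M.coassoc m
    simp only [LinearMap.comp_apply, LinearEquiv.coe_coe] at hm
    refine (congrArg (assoc k C C (M.carrier ⊗[k] X.carrier))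
      (g' x (M.coact m))).trans (Eq.trans ?_ (g x (M.coact m)).symm)
    rw [← hm, LinearEquiv.symm_apply_apply]
  counit := by
    have g : ∀ (x : X.carrier) (t : C ⊗[k] M.carrier),
        lid k _ ((CoalgebraStruct.counit (R := k) (A := C)).rTensor
          (M.carrier ⊗[k] X.carrier) (assoc k C M.carrier X.carrier (t ⊗ₜ x))) =
        lid k _ ((CoalgebraStruct.counit (R := k) (A := C)).rTensor _ t) ⊗ₜ x := by
      intro x t
      refine indOn t (by simp) (fun c m => ?_)
        (fun _ _ hy hz => by simp only [add_tmul, map_add, hy, hz])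
      simp [TensorProduct.smul_tmul']
    refine TensorProduct.ext' fun m x => ?_
    have hm := LinearMap.congr_fun M.counit m
    simp only [LinearMap.comp_apply, LinearEquiv.coe_coe] at hm
    refine (g x (M.coact m)).trans ?_
    rw [hm]
    rfl
  act := diagAct M.act X.act
  equivariant h := by
    rw [comp_assoc, ← comp_assoc _ _ (diagAct _ (diagAct _ _) h),
      ← diagAct_assoc, comp_assoc]
    exact congrArg _ (diagAct_map (g := LinearMap.id) M.equivariant (fun _ => rfl) h)

/-- The tensor product of two morphisms. -/
def tensMap {X X' : HMod k H} {M M' : HLComod k H C} (g : M ⟶ M') (f : X ⟶ X') :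
    tens M X ⟶ tens M' X' where
  lin := TensorProduct.map g.lin f.lin
  comm := by
    have h : ∀ (x : X.carrier) (t : C ⊗[k] M.carrier),
        assoc k C M'.carrier X'.carrier (g.lin.lTensor C t ⊗ₜ f.lin x) =
        (TensorProduct.map g.lin f.lin).lTensor C
          (assoc k C M.carrier X.carrier (t ⊗ₜ x)) := by
      intro x t
      refine indOn t (by simp) (fun c m => ?_)
        (fun _ _ hy hz => by simp only [add_tmul, map_add, hy, hz])
      simp
    refine TensorProduct.ext' fun m x => ?_
    have hm := LinearMap.congr_fun g.comm m
    simp only [LinearMap.comp_apply] at hm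
    refine Eq.trans ?_ (h x (M.coact m))
    rw [← hm]
    rfl
  comm_act := diagAct_map g.comm_act f.comm

/-- The associativity isomorphism `M ⊗ (X ⊗ Y) ≅ (M ⊗ X) ⊗ Y`. -/
def tensAssoc (M : HLComod k H C) (X Y : HMod k H) :
    tens M (X ⊗ Y) ≅ tens (tens M X) Y :=
  mkIso (assoc k M.carrier X.carrier Y.carrier).symm (by
    have h : ∀ (x : X.carrier) (y : Y.carrier) (t : C ⊗[k] M.carrier),
        assoc k C (M.carrier ⊗[k] X.carrier) Y.carrier
          (assoc k C M.carrier X.carrier (t ⊗ₜ x) ⊗ₜ y) =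
        (assoc k M.carrier X.carrier Y.carrier).symm.toLinearMap.lTensor C
          (assoc k C M.carrier (X.carrier ⊗[k] Y.carrier)
            (t ⊗ₜ (x ⊗ₜ y))) := by
      intro x y t
      refine indOn t (by simp) (fun c m => ?_)
        (fun _ _ hy hz => by simp only [add_tmul, map_add, hy, hz])
      simp
    exact TensorProduct.ext_threefold' fun m x y => h x y (M.coact m))
    (diagAct_assoc_symm M.act X.act Y.act)

/-- The unit isomorphism `M ⊗ k ≅ M`. -/
def tensUnit (M : HLComod k H C) : tens M (𝟙_ (HMod k H)) ≅ M :=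
  mkIso (rid k M.carrier) (by
    have h : ∀ (r : k) (t : C ⊗[k] M.carrier), r • t =
        (rid k M.carrier).toLinearMap.lTensor C
          (assoc k C M.carrier k (t ⊗ₜ r)) := by
      intro r t
      refine indOn t (by simp) (fun c m => ?_)
        (fun _ _ hy hz => by simp only [smul_add, add_tmul, map_add, hy, hz])
      simp
    exact TensorProduct.ext' fun m r => (M.coact.map_smul r m).trans (h r (M.coact m)))
    (diagAct_rid M.act)

/-- The right action of the category of left `H`-modules. -/
instance : MonoidalRightAction (HMod k H) (HLComod k H C) where
  actionObj := tens
  actionHomLeft f X := tensMap f (𝟙 X)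
  actionHomRight M _ _ f := tensMap (𝟙 M) f
  actionHom := tensMap
  actionAssocIso := tensAssoc
  actionUnitIso := tensUnit
  actionHom_def _ _ := Hom.ext (TensorProduct.ext' fun _ _ => rfl)
  actionHomRight_id _ _ := Hom.ext (TensorProduct.ext' fun _ _ => rfl)
  id_actionHomLeft _ _ := Hom.ext (TensorProduct.ext' fun _ _ => rfl)
  actionHom_comp _ _ _ _ := Hom.ext (TensorProduct.ext' fun _ _ => rfl)
  actionAssocIso_hom_naturality _ _ _ := Hom.ext (TensorProduct.ext_threefold' fun _ _ _ => rfl)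
  actionUnitIso_hom_naturality f :=
    Hom.ext (TensorProduct.ext' fun x r => f.lin.map_smul r x)
  actionHomRight_whiskerRight _ _ _ := Hom.ext (TensorProduct.ext_threefold' fun _ _ _ => rfl)
  whiskerRight_actionHomLeft _ _ _ _ _ := Hom.ext (TensorProduct.ext_threefold' fun _ _ _ => rfl)
  actionHom_associator _ _ _ _ := Hom.ext (TensorProduct.ext (LinearMap.ext fun _ =>
    ext_threefold fun _ _ _ => rfl))
  actionHom_leftUnitor _ _ := Hom.ext (TensorProduct.ext_threefold' fun m (r : k) x =>
    (smul_tmul r m x).symm)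
  actionHom_rightUnitor _ _ := Hom.ext (TensorProduct.ext_threefold' fun m x (r : k) =>
    (TensorProduct.tmul_smul r m x))

end HLComod

/-- A `C`-`D`-bicomodule in the category of left `H`-modules: a left `H`-module and
`C`-`D`-bicomodule `M` such that `λ(h m) = h₍₁₎ m₍₋₁₎ ⊗ h₍₂₎ m₍₀₎` and
`ρ(h m) = h₍₁₎ m₍₀₎ ⊗ h₍₂₎ m₍₁₎`. -/
structure HBicomod (k H C D : Type u) [Field k] [Ring H] [Bialgebra k H]
    [AddCommGroup C] [Module k C] [Coalgebra k C] [Module H C] [IsScalarTower k H C]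
    [AddCommGroup D] [Module k D] [Coalgebra k D] [Module H D] [IsScalarTower k H D] where
  carrier : Type u
  [addCommGroup : AddCommGroup carrier]
  [module : Module k carrier]
  act : H →ₐ[k] Module.End k carrier
  lcoact : carrier →ₗ[k] C ⊗[k] carrier
  rcoact : carrier →ₗ[k] carrier ⊗[k] D
  lcoassoc : (assoc k C C carrier).toLinearMap ∘ₗ
    (comul (R := k) (A := C)).rTensor carrier ∘ₗ lcoact = lcoact.lTensor C ∘ₗ lcoact
  lcounit : (lid k carrier).toLinearMap ∘ₗ
    (CoalgebraStruct.counit (R := k) (A := C)).rTensor carrier ∘ₗ lcoact = LinearMap.id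
  rcoassoc : (assoc k carrier D D).toLinearMap ∘ₗ rcoact.rTensor D ∘ₗ rcoact =
    (comul (R := k) (A := D)).lTensor carrier ∘ₗ rcoact
  rcounit : (rid k carrier).toLinearMap ∘ₗ
    (CoalgebraStruct.counit (R := k) (A := D)).lTensor carrier ∘ₗ rcoact = LinearMap.id
  bicomod : (assoc k C carrier D).toLinearMap ∘ₗ lcoact.rTensor D ∘ₗ rcoact =
    rcoact.lTensor C ∘ₗ lcoact
  lequivariant : ∀ h, lcoact ∘ₗ act h = diagAct (Algebra.lsmul k k C) act h ∘ₗ lcoact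
  requivariant : ∀ h, rcoact ∘ₗ act h = diagAct act (Algebra.lsmul k k D) h ∘ₗ rcoact

attribute [instance] HBicomod.addCommGroup HBicomod.module

namespace HBicomod

variable {k H C D E : Type u} [Field k] [Ring H] [Bialgebra k H]
  [AddCommGroup C] [Module k C] [Coalgebra k C] [Module H C] [IsScalarTower k H C]
  [AddCommGroup D] [Module k D] [Coalgebra k D] [Module H D] [IsScalarTower k H D]
  [AddCommGroup E] [Module k E] [Coalgebra k E] [Module H E] [IsScalarTower k H E]

/-- A morphism: an `H`-linear map that is colinear on both sides. -/
@[ext]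
structure Hom (M N : HBicomod k H C D) where
  lin : M.carrier →ₗ[k] N.carrier
  comm_act : ∀ h, lin ∘ₗ M.act h = N.act h ∘ₗ lin
  lcomm : N.lcoact ∘ₗ lin = lin.lTensor C ∘ₗ M.lcoact
  rcomm : N.rcoact ∘ₗ lin = lin.rTensor D ∘ₗ M.rcoact

instance : Category (HBicomod k H C D) where
  Hom := Hom
  id M := ⟨LinearMap.id, fun _ => rfl, by simp, by simp⟩
  comp f g := ⟨g.lin ∘ₗ f.lin, fun h => by
    rw [comp_assoc, f.comm_act, ← comp_assoc, g.comm_act,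
      comp_assoc], by
    rw [← comp_assoc, g.lcomm, comp_assoc, f.lcomm, ← comp_assoc,
      LinearMap.lTensor_comp], by
    rw [← comp_assoc, g.rcomm, comp_assoc, f.rcomm, ← comp_assoc,
      LinearMap.rTensor_comp]⟩

/-- The underlying left comodule. -/
def left (M : HBicomod k H C D) : HLComod k H C where
  carrier := M.carrier
  coact := M.lcoact
  coassoc := M.lcoassoc
  counit := M.lcounit
  act := M.act
  equivariant := M.lequivariant

/-- The underlying right comodule. -/
def right (M : HBicomod k H C D) : HRComod k H D where
  carrier := M.carrier
  coact := M.rcoact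
  coassoc := M.rcoassoc
  counit := M.rcounit
  act := M.act
  equivariant := M.requivariant

/-- The underlying left `H`-module. -/
def toHMod (M : HBicomod k H C D) : HMod k H where
  carrier := M.carrier
  act := M.act

variable (k H C) in
/-- The coalgebra `C` as a bicomodule over itself, with both coactions given by `Δ`. -/
def regular [ModuleCoalgebra k H C] : HBicomod k H C C where
  carrier := C
  act := Algebra.lsmul k k C
  lcoact := comul
  rcoact := comul
  lcoassoc := Coalgebra.coassoc
  lcounit := by
    refine LinearMap.ext fun c => ?_
    simp
  rcoassoc := Coalgebra.coassoc
  rcounit := by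
    refine LinearMap.ext fun c => ?_
    simp
  bicomod := Coalgebra.coassoc
  lequivariant := comul_equivariant C
  requivariant := comul_equivariant C

/-- The bicomodule `M ⊗ N` over the ground field: the left coaction is that of `M`, the right
coaction is that of `N`, and `H` acts diagonally. -/
def ext (M : HBicomod k H C D) (N : HBicomod k H D E) : HBicomod k H C E where
  carrier := M.carrier ⊗[k] N.carrier
  act := diagAct M.act N.act
  lcoact := (assoc k C M.carrier N.carrier).toLinearMap ∘ₗ
    M.lcoact.rTensor N.carrier
  rcoact := (assoc k M.carrier N.carrier E).symm.toLinearMap ∘ₗ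
    N.rcoact.lTensor M.carrier
  lcoassoc := (HLComod.tens M.left N.toHMod).coassoc
  lcounit := (HLComod.tens M.left N.toHMod).counit
  lequivariant := (HLComod.tens M.left N.toHMod).equivariant
  rcoassoc := (HRComod.tens M.toHMod N.right).coassoc
  rcounit := (HRComod.tens M.toHMod N.right).counit
  requivariant := (HRComod.tens M.toHMod N.right).equivariant
  bicomod := by
    have g : ∀ (s : C ⊗[k] M.carrier) (t : N.carrier ⊗[k] E) (m : M.carrier) (n : N.carrier),
        M.lcoact m = s → N.rcoact n = t →
        assoc k C (M.carrier ⊗[k] N.carrier) E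
          (((assoc k C M.carrier N.carrier).toLinearMap ∘ₗ
            M.lcoact.rTensor N.carrier).rTensor E
              ((assoc k M.carrier N.carrier E).symm (m ⊗ₜ t))) =
        ((assoc k M.carrier N.carrier E).symm.toLinearMap ∘ₗ
          N.rcoact.lTensor M.carrier).lTensor C
            (assoc k C M.carrier N.carrier (s ⊗ₜ n)) := by
      intro s t m n hm hn
      have e1 : assoc k C (M.carrier ⊗[k] N.carrier) E
          (((assoc k C M.carrier N.carrier).toLinearMap ∘ₗ
            M.lcoact.rTensor N.carrier).rTensor E
              ((assoc k M.carrier N.carrier E).symm (m ⊗ₜ t))) =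
          ((assoc k M.carrier N.carrier E).symm.toLinearMap).lTensor C
            (assoc k C M.carrier (N.carrier ⊗[k] E) (s ⊗ₜ t)) := by
        clear hn
        refine indOn t (by simp) (fun n e => ?_)
          (fun _ _ hy hz => by simp only [tmul_add, map_add, hy, hz])
        simp only [TensorProduct.assoc_symm_tmul, LinearMap.rTensor_tmul,
          LinearMap.comp_apply, hm]
        clear hm
        refine indOn s (by simp) (fun c m => ?_)
          (fun _ _ hy hz => by simp only [add_tmul, map_add, hy, hz])
        simp
      rw [e1]
      clear e1 hm
      refine indOn s (by simp) (fun c m => ?_)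
        (fun _ _ hy hz => by simp only [add_tmul, map_add, hy, hz])
      simp [hn]
    exact TensorProduct.ext' fun m n => g _ _ m n rfl rfl

end HBicomod

section Lift

variable {k A B X : Type u} [Field k] [AddCommGroup A] [Module k A] [AddCommGroup B] [Module k B]
  [AddCommGroup X] [Module k X]

/-- The factorization of a linear map `f` through an injective linear map `g` whose range contains
that of `f`. -/
noncomputable def liftInj (g : A →ₗ[k] B) (hg : Function.Injective g) (f : X →ₗ[k] B)
    (h : ∀ x, f x ∈ LinearMap.range g) : X →ₗ[k] A :=
  (LinearEquiv.ofInjective g hg).symm.toLinearMap ∘ₗ f.codRestrict (LinearMap.range g) h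

theorem liftInj_spec (g : A →ₗ[k] B) (hg : Function.Injective g) (f : X →ₗ[k] B)
    (h : ∀ x, f x ∈ LinearMap.range g) (x : X) : g (liftInj g hg f h x) = f x := by
  have := (LinearEquiv.ofInjective g hg).apply_symm_apply
    (f.codRestrict (LinearMap.range g) h x)
  exact congrArg Subtype.val this

theorem rTensor_sub_comm {k A B E : Type u} [Field k] [AddCommGroup A] [Module k A]
    [AddCommGroup B] [Module k B] [AddCommGroup E] [Module k E] {a b : A →ₗ[k] B}
    {r : A →ₗ[k] A ⊗[k] E} {r' : B →ₗ[k] B ⊗[k] E} (ha : a.rTensor E ∘ₗ r = r' ∘ₗ a)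
    (hb : b.rTensor E ∘ₗ r = r' ∘ₗ b) : (a - b).rTensor E ∘ₗ r = r' ∘ₗ (a - b) := by
  rw [LinearMap.rTensor_sub, LinearMap.sub_comp, LinearMap.comp_sub, ha, hb]

end Lift

namespace HBicomod

variable {k H C D E : Type u} [Field k] [Ring H] [Bialgebra k H]
  [AddCommGroup C] [Module k C] [Coalgebra k C] [Module H C] [IsScalarTower k H C]
  [AddCommGroup D] [Module k D] [Coalgebra k D] [Module H D] [IsScalarTower k H D]
  [AddCommGroup E] [Module k E] [Coalgebra k E] [Module H E] [IsScalarTower k H E]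

/-- The structure of a bicomodule on a vector space `Q`, given structure maps that are compatible
with those of a bicomodule `P` along an injective linear map `ι : Q → P`. -/
def ofInjective (P : HBicomod k H C E) (Q : Type u) [AddCommGroup Q] [Module k Q]
    (ι : Q →ₗ[k] P.carrier) (hι : Function.Injective ι) (act : H →ₐ[k] Module.End k Q)
    (l : Q →ₗ[k] C ⊗[k] Q) (r : Q →ₗ[k] Q ⊗[k] E)
    (ha : ∀ h, ι ∘ₗ act h = P.act h ∘ₗ ι) (hl : ι.lTensor C ∘ₗ l = P.lcoact ∘ₗ ι)
    (hr : ι.rTensor E ∘ₗ r = P.rcoact ∘ₗ ι) : HBicomod k H C E where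
  carrier := Q
  act := act
  lcoact := l
  rcoact := r
  lcoassoc := by
    have il : Function.Injective (ι.lTensor C) :=
      Module.Flat.lTensor_preserves_injective_linearMap _ hι
    have i2 : Function.Injective ((ι.lTensor C).lTensor C) :=
      Module.Flat.lTensor_preserves_injective_linearMap _ il
    have n : ∀ t : C ⊗[k] Q, (ι.lTensor C).lTensor C (assoc k C C Q
        ((comul (R := k) (A := C)).rTensor Q t)) =
        assoc k C C P.carrier ((comul (R := k) (A := C)).rTensor _
          (ι.lTensor C t)) := by
      intro t
      refine indOn t (by simp) (fun c x => ?_)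
        (fun _ _ hy hz => by simp only [map_add, hy, hz])
      simp only [LinearMap.rTensor_tmul, LinearMap.lTensor_tmul]
      generalize comul (R := k) c = s
      refine indOn s (by simp) (fun c d => ?_)
        (fun _ _ hy hz => by simp only [add_tmul, map_add, hy, hz])
      simp
    refine LinearMap.ext fun x => i2 ?_
    have hc := LinearMap.congr_fun P.lcoassoc (ι x)
    have sl := LinearMap.congr_fun hl x
    simp only [LinearMap.comp_apply, LinearEquiv.coe_coe] at hc sl ⊢
    rw [n, sl, ← LinearMap.comp_apply (LinearMap.lTensor C _), ← LinearMap.lTensor_comp, hl,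
      LinearMap.lTensor_comp, LinearMap.comp_apply, sl]
    exact hc
  lcounit := by
    have n : ∀ t : C ⊗[k] Q, ι (lid k Q
        ((CoalgebraStruct.counit (R := k) (A := C)).rTensor Q t)) =
        lid k P.carrier ((CoalgebraStruct.counit (R := k) (A := C)).rTensor _
          (ι.lTensor C t)) := by
      intro t
      refine indOn t (by simp) (fun c x => ?_)
        (fun _ _ hy hz => by simp only [map_add, hy, hz])
      simp
    refine LinearMap.ext fun x => hι ?_
    have hc := LinearMap.congr_fun P.lcounit (ι x)
    have sl := LinearMap.congr_fun hl x
    simp only [LinearMap.comp_apply, LinearEquiv.coe_coe] at hc sl ⊢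
    rw [n, sl]
    exact hc
  rcoassoc := by
    have i2 : Function.Injective (ι.rTensor (E ⊗[k] E)) :=
      Module.Flat.rTensor_preserves_injective_linearMap _ hι
    have n : ∀ t : (Q ⊗[k] E) ⊗[k] E, ι.rTensor (E ⊗[k] E)
        (assoc k Q E E t) =
        assoc k P.carrier E E ((ι.rTensor E).rTensor E t) := by
      refine fun t => LinearMap.congr_fun (f := ι.rTensor (E ⊗[k] E) ∘ₗ
        (assoc k Q E E).toLinearMap)
        (g := (assoc k P.carrier E E).toLinearMap ∘ₗ
          (ι.rTensor E).rTensor E) ?_ t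
      exact ext_threefold fun _ _ _ => rfl
    have n' : ∀ t : Q ⊗[k] E, ι.rTensor (E ⊗[k] E)
        ((comul (R := k) (A := E)).lTensor Q t) =
        (comul (R := k) (A := E)).lTensor P.carrier (ι.rTensor E t) := by
      intro t
      rw [← LinearMap.comp_apply, ← LinearMap.comp_apply, LinearMap.rTensor_comp_lTensor,
        LinearMap.lTensor_comp_rTensor]
    refine LinearMap.ext fun x => i2 ?_
    have hc := LinearMap.congr_fun P.rcoassoc (ι x)
    have sr := LinearMap.congr_fun hr x
    simp only [LinearMap.comp_apply, LinearEquiv.coe_coe] at hc sr ⊢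
    rw [n, n', ← LinearMap.comp_apply (LinearMap.rTensor E _), ← LinearMap.rTensor_comp, hr,
      LinearMap.rTensor_comp, LinearMap.comp_apply, sr]
    exact hc
  rcounit := by
    have n : ∀ t : Q ⊗[k] E, ι (rid k Q
        ((CoalgebraStruct.counit (R := k) (A := E)).lTensor Q t)) =
        rid k P.carrier ((CoalgebraStruct.counit (R := k) (A := E)).lTensor _
          (ι.rTensor E t)) := by
      intro t
      refine indOn t (by simp) (fun c x => ?_)
        (fun _ _ hy hz => by simp only [map_add, hy, hz])
      simp
    refine LinearMap.ext fun x => hι ?_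
    have hc := LinearMap.congr_fun P.rcounit (ι x)
    have sr := LinearMap.congr_fun hr x
    simp only [LinearMap.comp_apply, LinearEquiv.coe_coe] at hc sr ⊢
    rw [n, sr]
    exact hc
  bicomod := by
    have ir : Function.Injective (ι.rTensor E) :=
      Module.Flat.rTensor_preserves_injective_linearMap _ hι
    have i2 : Function.Injective ((ι.rTensor E).lTensor C) :=
      Module.Flat.lTensor_preserves_injective_linearMap _ ir
    have n : ∀ t : (C ⊗[k] Q) ⊗[k] E, (ι.rTensor E).lTensor C
        (assoc k C Q E t) =
        assoc k C P.carrier E ((ι.lTensor C).rTensor E t) := by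
      refine fun t => LinearMap.congr_fun (f := (ι.rTensor E).lTensor C ∘ₗ
        (assoc k C Q E).toLinearMap)
        (g := (assoc k C P.carrier E).toLinearMap ∘ₗ
          (ι.lTensor C).rTensor E) ?_ t
      exact ext_threefold fun _ _ _ => rfl
    refine LinearMap.ext fun x => i2 ?_
    have hc := LinearMap.congr_fun P.bicomod (ι x)
    have sl := LinearMap.congr_fun hl x
    have sr := LinearMap.congr_fun hr x
    simp only [LinearMap.comp_apply, LinearEquiv.coe_coe] at hc sl sr ⊢
    rw [n, ← LinearMap.comp_apply (LinearMap.rTensor E _), ← LinearMap.rTensor_comp, hl,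
      LinearMap.rTensor_comp, LinearMap.comp_apply, sr,
      ← LinearMap.comp_apply (LinearMap.lTensor C _), ← LinearMap.lTensor_comp, hr,
      LinearMap.lTensor_comp, LinearMap.comp_apply, sl]
    exact hc
  lequivariant h := by
    have il : Function.Injective (ι.lTensor C) :=
      Module.Flat.lTensor_preserves_injective_linearMap _ hι
    have hd : ι.lTensor C ∘ₗ diagAct (Algebra.lsmul k k C) act h =
        diagAct (Algebra.lsmul k k C) P.act h ∘ₗ ι.lTensor C :=
      diagAct_map (φ := Algebra.lsmul k k C) (φ' := Algebra.lsmul k k C) (f := LinearMap.id)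
        (fun _ => rfl) ha h
    refine (LinearMap.cancel_left il).1 ?_
    rw [← comp_assoc, hl, comp_assoc, ha, ← comp_assoc,
      P.lequivariant, comp_assoc, ← hl, ← comp_assoc, ← hd,
      comp_assoc]
  requivariant h := by
    have ir : Function.Injective (ι.rTensor E) :=
      Module.Flat.rTensor_preserves_injective_linearMap _ hι
    have hd : ι.rTensor E ∘ₗ diagAct act (Algebra.lsmul k k E) h =
        diagAct P.act (Algebra.lsmul k k E) h ∘ₗ ι.rTensor E :=
      diagAct_map (ψ := Algebra.lsmul k k E) (ψ' := Algebra.lsmul k k E) (g := LinearMap.id)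
        ha (fun _ => rfl) h
    refine (LinearMap.cancel_left ir).1 ?_
    rw [← comp_assoc, hr, comp_assoc, ha, ← comp_assoc,
      P.requivariant, comp_assoc, ← hr, ← comp_assoc, ← hd,
      comp_assoc]

/-- The restriction of a representation to a stable subspace. -/
def restrictAct {V : Type u} [AddCommGroup V] [Module k V] (φ : H →ₐ[k] Module.End k V)
    (K : Submodule k V) (ha : ∀ h, ∀ x ∈ K, φ h x ∈ K) : H →ₐ[k] Module.End k K where
  toFun := fun h => (φ h).restrict (ha h)
  map_one' := by ext x; simp
  map_mul' := fun a b => by ext x; simp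
  map_zero' := by ext x; simp
  map_add' := fun a b => by ext x; simp
  commutes' := fun r => by ext x; simp

/-- The subobject of a bicomodule on a subspace `K` that is stable under the action of `H` and
under both coactions: `λ(K) ⊆ C ⊗ K` and `ρ(K) ⊆ K ⊗ E`. -/
noncomputable def sub (P : HBicomod k H C E) (K : Submodule k P.carrier)
    (ha : ∀ h, ∀ x ∈ K, P.act h x ∈ K)
    (hl : ∀ x : K, (P.lcoact ∘ₗ K.subtype) x ∈ LinearMap.range (K.subtype.lTensor C))
    (hr : ∀ x : K, (P.rcoact ∘ₗ K.subtype) x ∈ LinearMap.range (K.subtype.rTensor E)) :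
    HBicomod k H C E :=
  P.ofInjective K K.subtype K.subtype_injective (restrictAct P.act K ha)
    (liftInj (K.subtype.lTensor C)
      (Module.Flat.lTensor_preserves_injective_linearMap _ K.subtype_injective)
      (P.lcoact ∘ₗ K.subtype) hl)
    (liftInj (K.subtype.rTensor E)
      (Module.Flat.rTensor_preserves_injective_linearMap _ K.subtype_injective)
      (P.rcoact ∘ₗ K.subtype) hr)
    (fun _ => rfl) (LinearMap.ext (liftInj_spec _ _ _ hl)) (LinearMap.ext (liftInj_spec _ _ _ hr))

/-- The difference `ρ_M ⊗ id - id ⊗ λ_N`, as a map `M ⊗ N → M ⊗ D ⊗ N`. -/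
def cotensorDiff (M : HBicomod k H C D) (N : HBicomod k H D E) :
    M.carrier ⊗[k] N.carrier →ₗ[k] (M.carrier ⊗[k] D) ⊗[k] N.carrier :=
  M.rcoact.rTensor N.carrier -
    (assoc k M.carrier D N.carrier).symm.toLinearMap ∘ₗ N.lcoact.lTensor M.carrier

theorem cotensorDiff_act (M : HBicomod k H C D) (N : HBicomod k H D E) (h : H) :
    cotensorDiff M N ∘ₗ diagAct M.act N.act h =
      diagAct (diagAct M.act (Algebra.lsmul k k D)) N.act h ∘ₗ cotensorDiff M N := by
  rw [cotensorDiff, LinearMap.sub_comp, LinearMap.comp_sub]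
  congr 1
  · exact diagAct_map (g := LinearMap.id) M.requivariant (fun _ => rfl) h
  · rw [← comp_assoc, ← diagAct_assoc_symm, comp_assoc, comp_assoc]
    exact congrArg _ (diagAct_map (f := LinearMap.id) (fun _ => rfl) N.lequivariant h)

theorem cotensorDiff_lcoact (M : HBicomod k H C D) (N : HBicomod k H D E) :
    (cotensorDiff M N).lTensor C ∘ₗ
        ((assoc k C M.carrier N.carrier).toLinearMap ∘ₗ M.lcoact.rTensor N.carrier) =
      ((assoc k C (M.carrier ⊗[k] D) N.carrier).toLinearMap ∘ₗ
        ((assoc k C M.carrier D).toLinearMap ∘ₗ M.lcoact.rTensor D).rTensor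
          N.carrier) ∘ₗ cotensorDiff M N := by
  rw [cotensorDiff, LinearMap.lTensor_sub, LinearMap.sub_comp, LinearMap.comp_sub]
  congr 1
  · refine TensorProduct.ext' fun m n => ?_
    have hb := LinearMap.congr_fun M.bicomod m
    simp only [LinearMap.comp_apply, LinearEquiv.coe_coe] at hb
    have g : ∀ s : C ⊗[k] M.carrier, (M.rcoact.rTensor N.carrier).lTensor C
        (assoc k C M.carrier N.carrier (s ⊗ₜ n)) =
        assoc k C (M.carrier ⊗[k] D) N.carrier (M.rcoact.lTensor C s ⊗ₜ n) := by
      intro s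
      refine indOn s (by simp) (fun c m => ?_)
        (fun _ _ hy hz => by simp only [add_tmul, map_add, hy, hz])
      simp
    refine (g (M.lcoact m)).trans ?_
    rw [← hb]
    rfl
  · refine TensorProduct.ext' fun m n => ?_
    have g : ∀ (s : C ⊗[k] M.carrier) (t : D ⊗[k] N.carrier), N.lcoact n = t → M.lcoact m = s →
        ((assoc k M.carrier D N.carrier).symm.toLinearMap ∘ₗ
          N.lcoact.lTensor M.carrier).lTensor C
            (assoc k C M.carrier N.carrier (s ⊗ₜ n)) =
        assoc k C (M.carrier ⊗[k] D) N.carrier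
          (((assoc k C M.carrier D).toLinearMap ∘ₗ M.lcoact.rTensor D).rTensor
            N.carrier ((assoc k M.carrier D N.carrier).symm (m ⊗ₜ t))) := by
      intro s t hn hm
      have e1 : ((assoc k M.carrier D N.carrier).symm.toLinearMap ∘ₗ
          N.lcoact.lTensor M.carrier).lTensor C
            (assoc k C M.carrier N.carrier (s ⊗ₜ n)) =
          ((assoc k M.carrier D N.carrier).symm.toLinearMap).lTensor C
            (assoc k C M.carrier (D ⊗[k] N.carrier) (s ⊗ₜ t)) := by
        clear hm
        refine indOn s (by simp) (fun c m => ?_)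
          (fun _ _ hy hz => by simp only [add_tmul, map_add, hy, hz])
        simp [hn]
      rw [e1]
      clear e1 hn
      refine indOn t (by simp) (fun d n => ?_)
        (fun _ _ hy hz => by simp only [tmul_add, map_add, hy, hz])
      simp only [TensorProduct.assoc_symm_tmul, LinearMap.rTensor_tmul,
        LinearMap.comp_apply, hm]
      clear hm
      refine indOn s (by simp) (fun c m => ?_)
        (fun _ _ hy hz => by simp only [add_tmul, map_add, hy, hz])
      simp
    exact g _ _ rfl rfl

theorem cotensorDiff_rcoact (M : HBicomod k H C D) (N : HBicomod k H D E) :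
    (cotensorDiff M N).rTensor E ∘ₗ
        ((assoc k M.carrier N.carrier E).symm.toLinearMap ∘ₗ
          N.rcoact.lTensor M.carrier) =
      ((assoc k (M.carrier ⊗[k] D) N.carrier E).symm.toLinearMap ∘ₗ
        N.rcoact.lTensor (M.carrier ⊗[k] D)) ∘ₗ cotensorDiff M N := by
  refine rTensor_sub_comm ?_ ?_
  · refine TensorProduct.ext' fun m n => ?_
    have g : ∀ (t : N.carrier ⊗[k] E), (M.rcoact.rTensor N.carrier).rTensor E
        ((assoc k M.carrier N.carrier E).symm (m ⊗ₜ t)) =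
        (assoc k (M.carrier ⊗[k] D) N.carrier E).symm (M.rcoact m ⊗ₜ t) := by
      intro t
      refine indOn t (by simp) (fun n e => ?_)
        (fun _ _ hy hz => by simp only [tmul_add, map_add, hy, hz])
      simp
    exact g (N.rcoact n)
  · refine TensorProduct.ext' fun m n => ?_
    have hb := LinearMap.congr_fun N.bicomod n
    simp only [LinearMap.comp_apply, LinearEquiv.coe_coe] at hb
    have g : ∀ (t : N.carrier ⊗[k] E),
        ((assoc k M.carrier D N.carrier).symm.toLinearMap ∘ₗ
          N.lcoact.lTensor M.carrier).rTensor E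
            ((assoc k M.carrier N.carrier E).symm (m ⊗ₜ t)) =
        ((assoc k M.carrier D N.carrier).symm.toLinearMap).rTensor E
          ((assoc k M.carrier (D ⊗[k] N.carrier) E).symm
            (m ⊗ₜ N.lcoact.rTensor E t)) := by
      intro t
      refine indOn t (by simp) (fun n e => ?_)
        (fun _ _ hy hz => by simp only [tmul_add, map_add, hy, hz])
      simp
    have g' : ∀ (s : D ⊗[k] N.carrier),
        ((assoc k M.carrier D N.carrier).symm.toLinearMap).rTensor E
          ((assoc k M.carrier (D ⊗[k] N.carrier) E).symm
            (m ⊗ₜ (assoc k D N.carrier E).symm (N.rcoact.lTensor D s))) =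
        (assoc k (M.carrier ⊗[k] D) N.carrier E).symm
          (N.rcoact.lTensor (M.carrier ⊗[k] D)
            ((assoc k M.carrier D N.carrier).symm (m ⊗ₜ s))) := by
      intro s
      refine indOn s (by simp) (fun d n => ?_)
        (fun _ _ hy hz => by simp only [tmul_add, map_add, hy, hz])
      simp only [TensorProduct.assoc_symm_tmul, LinearMap.lTensor_tmul]
      generalize N.rcoact n = t
      refine indOn t (by simp) (fun n e => ?_)
        (fun _ _ hy hz => by simp only [tmul_add, map_add, hy, hz])
      simp
    refine (g (N.rcoact n)).trans (Eq.trans ?_ (g' (N.lcoact n)))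
    rw [← hb, LinearEquiv.symm_apply_apply]

theorem cotensor_act_mem (M : HBicomod k H C D) (N : HBicomod k H D E) (h : H)
    (x : M.carrier ⊗[k] N.carrier) (hx : x ∈ LinearMap.ker (cotensorDiff M N)) :
    diagAct M.act N.act h x ∈ LinearMap.ker (cotensorDiff M N) := by
  have := LinearMap.congr_fun (cotensorDiff_act M N h) x
  rw [LinearMap.comp_apply, LinearMap.comp_apply, LinearMap.mem_ker.1 hx, map_zero] at this
  exact LinearMap.mem_ker.2 this

theorem cotensor_lcoact_mem (M : HBicomod k H C D) (N : HBicomod k H D E)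
    (x : LinearMap.ker (cotensorDiff M N)) :
    ((assoc k C M.carrier N.carrier).toLinearMap ∘ₗ M.lcoact.rTensor N.carrier)
      (x : M.carrier ⊗[k] N.carrier) ∈
        LinearMap.range ((LinearMap.ker (cotensorDiff M N)).subtype.lTensor C) := by
  have := LinearMap.congr_fun (cotensorDiff_lcoact M N) (x : M.carrier ⊗[k] N.carrier)
  rw [LinearMap.comp_apply, LinearMap.comp_apply (_ ∘ₗ _) (cotensorDiff M N),
    LinearMap.mem_ker.1 x.2, map_zero] at this
  exact (Module.Flat.lTensor_exact C
    (LinearMap.exact_subtype_ker_map (cotensorDiff M N)) _).1 this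

theorem cotensor_rcoact_mem (M : HBicomod k H C D) (N : HBicomod k H D E)
    (x : LinearMap.ker (cotensorDiff M N)) :
    ((assoc k M.carrier N.carrier E).symm.toLinearMap ∘ₗ
      N.rcoact.lTensor M.carrier) (x : M.carrier ⊗[k] N.carrier) ∈
        LinearMap.range ((LinearMap.ker (cotensorDiff M N)).subtype.rTensor E) := by
  have := LinearMap.congr_fun (cotensorDiff_rcoact M N) (x : M.carrier ⊗[k] N.carrier)
  rw [LinearMap.comp_apply, LinearMap.comp_apply (_ ∘ₗ _) (cotensorDiff M N),
    LinearMap.mem_ker.1 x.2, map_zero] at this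
  exact (Module.Flat.rTensor_exact E
    (LinearMap.exact_subtype_ker_map (cotensorDiff M N)) _).1 this

/-- The cotensor product `M □_D N`: the kernel of `ρ_M ⊗ id - id ⊗ λ_N` with the diagonal action
of `H`, the left `C`-coaction of `M` and the right `E`-coaction of `N`. -/
noncomputable def cotensor (M : HBicomod k H C D) (N : HBicomod k H D E) : HBicomod k H C E :=
  (ext M N).sub (LinearMap.ker (cotensorDiff M N)) (cotensor_act_mem M N)
    (cotensor_lcoact_mem M N) (cotensor_rcoact_mem M N)

end HBicomod

section ModuleCategories

universe v₁ u₁ v₂ u₂ v₃ u₃ v₄ u₄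

open Functor MonoidalLeftAction MonoidalRightAction

section Left

variable (T : Type u₁) [Category.{v₁} T] [MonoidalCategory T]
  {𝓐 : Type u₂} [Category.{v₂} 𝓐] [MonoidalLeftAction T 𝓐]
  {𝓑 : Type u₃} [Category.{v₃} 𝓑] [MonoidalLeftAction T 𝓑]
  {𝓒 : Type u₄} [Category.{v₄} 𝓒] [MonoidalLeftAction T 𝓒]

/-- The identity functor as a lax left module functor, with identities as structure morphisms. -/
instance : (𝟭 𝓐).LaxLeftLinear T where
  μₗ _ _ := 𝟙 _

/-- The composite of lax left module functors, with structure morphism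
`X ⊗ G F A ⟶ G (X ⊗ F A) ⟶ G F (X ⊗ A)`. -/
instance (F : 𝓐 ⥤ 𝓑) (G : 𝓑 ⥤ 𝓒) [F.LaxLeftLinear T] [G.LaxLeftLinear T] :
    (F ⋙ G).LaxLeftLinear T where
  μₗ X A := LaxLeftLinear.μₗ G X (F.obj A) ≫ G.map (LaxLeftLinear.μₗ F X A)
  μₗ_naturality_left f A := by
    simp [← Functor.map_comp]
  μₗ_naturality_right X A A' f := by
    simp [← Functor.map_comp]
  μₗ_associativity X Y A := by
    simp only [Category.assoc, Functor.comp_map, Functor.comp_obj]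
    rw [← G.map_comp, LaxLeftLinear.μₗ_associativity]
    simp
  μₗ_unitality A := by
    simp [← Functor.map_comp]

/-- A natural transformation is a morphism of lax left module functors if it is compatible with
the structure morphisms. -/
def IsLeftModuleTrans {F G : 𝓐 ⥤ 𝓑} [F.LaxLeftLinear T] [G.LaxLeftLinear T] (α : F ⟶ G) : Prop :=
  ∀ (X : T) (A : 𝓐), LaxLeftLinear.μₗ F X A ≫ α.app (X ⊙ₗ A) =
    X ⊴ₗ α.app A ≫ LaxLeftLinear.μₗ G X A

variable (𝓐 𝓑) in
/-- Left `T`-module categories `𝓐` and `𝓑` are equivalent: there are lax left `T`-module functors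
`F : 𝓐 ⥤ 𝓑` and `G : 𝓑 ⥤ 𝓐` such that both composites are isomorphic to the identity functors as
lax left `T`-module functors. -/
def LeftModuleEquivalent : Prop :=
  ∃ (F : 𝓐 ⥤ 𝓑) (G : 𝓑 ⥤ 𝓐) (_ : F.LaxLeftLinear T) (_ : G.LaxLeftLinear T)
    (η : F ⋙ G ≅ 𝟭 𝓐) (ε : G ⋙ F ≅ 𝟭 𝓑),
    IsLeftModuleTrans T η.hom ∧ IsLeftModuleTrans T ε.hom

end Left

section Right

variable (T : Type u₁) [Category.{v₁} T] [MonoidalCategory T]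
  {𝓐 : Type u₂} [Category.{v₂} 𝓐] [MonoidalRightAction T 𝓐]
  {𝓑 : Type u₃} [Category.{v₃} 𝓑] [MonoidalRightAction T 𝓑]
  {𝓒 : Type u₄} [Category.{v₄} 𝓒] [MonoidalRightAction T 𝓒]

/-- The identity functor as a lax right module functor, with identities as structure morphisms. -/
instance : (𝟭 𝓐).LaxRightLinear T where
  μᵣ _ _ := 𝟙 _

/-- The composite of lax right module functors, with structure morphism
`G F A ⊗ X ⟶ G (F A ⊗ X) ⟶ G F (A ⊗ X)`. -/
instance (F : 𝓐 ⥤ 𝓑) (G : 𝓑 ⥤ 𝓒) [F.LaxRightLinear T] [G.LaxRightLinear T] :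
    (F ⋙ G).LaxRightLinear T where
  μᵣ A X := LaxRightLinear.μᵣ G (F.obj A) X ≫ G.map (LaxRightLinear.μᵣ F A X)
  μᵣ_naturality_right A X X' f := by
    simp [← Functor.map_comp]
  μᵣ_naturality_left f X := by
    simp [← Functor.map_comp]
  μᵣ_associativity A X Y := by
    simp only [Category.assoc, Functor.comp_map, Functor.comp_obj]
    rw [← G.map_comp, LaxRightLinear.μᵣ_associativity]
    simp
  μᵣ_unitality A := by
    simp [← Functor.map_comp]

/-- A natural transformation is a morphism of lax right module functors if it is compatible with
the structure morphisms. -/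
def IsRightModuleTrans {F G : 𝓐 ⥤ 𝓑} [F.LaxRightLinear T] [G.LaxRightLinear T] (α : F ⟶ G) :
    Prop :=
  ∀ (A : 𝓐) (X : T), LaxRightLinear.μᵣ F A X ≫ α.app (A ⊙ᵣ X) =
    α.app A ⊵ᵣ X ≫ LaxRightLinear.μᵣ G A X

variable (𝓐 𝓑) in
/-- Right `T`-module categories `𝓐` and `𝓑` are equivalent: there are lax right `T`-module functors
`F : 𝓐 ⥤ 𝓑` and `G : 𝓑 ⥤ 𝓐` such that both composites are isomorphic to the identity functors as
lax right `T`-module functors. -/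
def RightModuleEquivalent : Prop :=
  ∃ (F : 𝓐 ⥤ 𝓑) (G : 𝓑 ⥤ 𝓐) (_ : F.LaxRightLinear T) (_ : G.LaxRightLinear T)
    (η : F ⋙ G ≅ 𝟭 𝓐) (ε : G ⋙ F ≅ 𝟭 𝓑),
    IsRightModuleTrans T η.hom ∧ IsRightModuleTrans T ε.hom

end Right

end ModuleCategories

end EqMT

/-! Everything goes through the condition on bicomodules.

Suppose `M □ N ≅ C` and `N □ M ≅ D`. Then cotensoring with `M` and with `N` gives inverse
equivalences. No abstract associativity of `□` is needed. Both `(Y □ M) □ N` and `Y` embed into `(Y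
⊗ M) ⊗ N`, the second by `y ↦ y₍₀₎ ⊗ ι(y₍₁₎)` with `ι : C ≅ M □ N ⊆ M ⊗ N`. Since tensoring over a
field is exact, both images are the intersection of the same two kernels
(`range_rTensor_comp_coactionDiff`, `range_coact_of_range_eq`). The cotensor functor is a subfunctor
of `Y ↦ Y ⊗ M`, on which the module structure is explicit. Over `H`-modules it is the associativity
constraint; over right `H`-comodules it is `x ⊗ (y ⊗ m) ↦ (x₍₀₎ ⊗ y) ⊗ x₍₁₎ m`, which need not be
invertible because `H` is only a bialgebra. `LaxSubfunctor.exists_iso` restricts all of this to the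
subfunctors.

Conversely, let `F` be an equivalence with inverse `G`. Although the functors are only assumed lax,
their structure morphisms are invertible (`isIso_lineator`), so `F` carries a coaction `A ⟶ X ⊙ B`
to `F A ⟶ X ⊙ F B`, and likewise actions. For right comodules, the left coaction of `C` on itself is
a morphism of right comodules, hence `M = F C` is a `C`-`D`-bicomodule; put `N = G D`. Because `M □
D = M`, the coaction `M ⟶ M ⊗ D` is an equalizer of two maps to `M ⊗ D ⊗ D`. Applying `G` gives an
equalizer `C ≅ G M ⟶ M ⊗ N` of two maps to `M ⊗ D ⊗ N`, that is, `C ≅ M □ N`. Exchanging `F` and `G`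
gives `N □ M ≅ D`.

When `H`-comodules act, vector spaces enter as trivial comodules, and the action of `H` on `M` is
transported from `H ⊗ C → C`, which is colinear for the regular comodule `H`. Its compatibility with
the other structure maps is expressed by the colinear map `h ⊗ v ↦ h₍₁₎ v ⊗ h₍₂₎`. For left
comodules over left `H`-comodules the acting object stands on the wrong side, so the tensor factors
are flipped. Right module categories are treated as left ones over the opposite monoidal category.
-/

namespace EqMT

/-! ### Equivalences of module categories: invertibility of the structure morphisms, transport of
coactions and actions -/

section ModuleEquivalence

universe v₁ u₁ v₂ u₂ v₃ u₃

open Functor MonoidalLeftAction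

variable (T : Type u₁) [Category.{v₁} T] [MonoidalCategory T]
  (𝓐 : Type u₂) [Category.{v₂} 𝓐] [MonoidalLeftAction T 𝓐]
  (𝓑 : Type u₃) [Category.{v₃} 𝓑] [MonoidalLeftAction T 𝓑]

/-- An equivalence of left module categories, with chosen lax module functors and
isomorphisms. -/
structure LeftModuleEquivalence where
  F : 𝓐 ⥤ 𝓑
  G : 𝓑 ⥤ 𝓐
  [linF : F.LaxLeftLinear T]
  [linG : G.LaxLeftLinear T]
  η : F ⋙ G ≅ 𝟭 𝓐
  ε : G ⋙ F ≅ 𝟭 𝓑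
  η_trans : IsLeftModuleTrans T η.hom
  ε_trans : IsLeftModuleTrans T ε.hom

attribute [instance] LeftModuleEquivalence.linF LeftModuleEquivalence.linG

variable {T 𝓐 𝓑}

/-- With the data chosen, `symm` exchanges the two functors, so every statement about `F` is also
one about `G`. -/
theorem LeftModuleEquivalent.exists_equivalence (h : LeftModuleEquivalent T 𝓐 𝓑) :
    Nonempty (LeftModuleEquivalence T 𝓐 𝓑) := by
  obtain ⟨F, G, _, _, η, ε, hη, hε⟩ := h
  exact ⟨⟨F, G, η, ε, hη, hε⟩⟩

namespace LeftModuleEquivalence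

variable (e : LeftModuleEquivalence T 𝓐 𝓑)

/-- The inverse equivalence. -/
def symm : LeftModuleEquivalence T 𝓑 𝓐 where
  F := e.G
  G := e.F
  η := e.ε
  ε := e.η
  η_trans := e.ε_trans
  ε_trans := e.η_trans

instance : e.F.IsEquivalence :=
  (CategoryTheory.Equivalence.mk e.F e.G e.η.symm e.ε).isEquivalence_functor

instance : e.G.IsEquivalence := inferInstanceAs e.symm.F.IsEquivalence

/-- The identity functor has identities as structure morphisms. Hence the structure morphism of `F ⋙
G` is a composite of isomorphisms. -/
theorem η_lineator (X : T) (A : 𝓐) :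
    (LaxLeftLinear.μₗ e.G X (e.F.obj A) ≫ e.G.map (LaxLeftLinear.μₗ e.F X A)) ≫
      e.η.hom.app (X ⊙ₗ A) = X ⊴ₗ e.η.hom.app A :=
  (e.η_trans X A).trans (Category.comp_id _)

instance isIso_lineator_comp (X : T) (A : 𝓐) :
    IsIso (LaxLeftLinear.μₗ e.G X (e.F.obj A) ≫ e.G.map (LaxLeftLinear.μₗ e.F X A)) := by
  have h := e.η_lineator X A
  rw [← IsIso.eq_comp_inv] at h
  rw [h]
  infer_instance

/-- The invertible structure morphism of `F ⋙ G` begins with this map, which is therefore split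
mono. The one of `G ⋙ F` ends with its image under `F`, which is therefore epi; `F` is faithful and
reflects this. -/
instance isIso_lineator_G (X : T) (A : 𝓐) :
    IsIso (LaxLeftLinear.μₗ e.G X (e.F.obj A)) := by
  have h1 : IsSplitMono (LaxLeftLinear.μₗ e.G X (e.F.obj A)) :=
    ⟨⟨⟨e.G.map (LaxLeftLinear.μₗ e.F X A) ≫ inv (LaxLeftLinear.μₗ e.G X (e.F.obj A) ≫
      e.G.map (LaxLeftLinear.μₗ e.F X A)), by rw [← Category.assoc, IsIso.hom_inv_id]⟩⟩⟩
  have h2 : Epi (e.F.map (LaxLeftLinear.μₗ e.G X (e.F.obj A))) := by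
    have : IsIso (LaxLeftLinear.μₗ e.F X (e.G.obj (e.F.obj A)) ≫
        e.F.map (LaxLeftLinear.μₗ e.G X (e.F.obj A))) := e.symm.isIso_lineator_comp X (e.F.obj A)
    exact epi_of_epi (LaxLeftLinear.μₗ e.F X (e.G.obj (e.F.obj A))) _
  have h3 : Epi (LaxLeftLinear.μₗ e.G X (e.F.obj A)) := e.F.epi_of_epi_map h2
  exact isIso_of_epi_of_isSplitMono _

/-- Two out of three in the composite structure morphism makes `G (μ)` invertible, and `G` reflects
isomorphisms. -/
instance isIso_lineator (X : T) (A : 𝓐) : IsIso (LaxLeftLinear.μₗ e.F X A) := by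
  have : IsIso (e.G.map (LaxLeftLinear.μₗ e.F X A)) :=
    IsIso.of_isIso_comp_left (LaxLeftLinear.μₗ e.G X (e.F.obj A)) _
  exact isIso_of_reflects_iso _ e.G

/-- The image `F A ⟶ X ⊙ F B` of a morphism `A ⟶ X ⊙ B`. -/
noncomputable def coactMap {A B : 𝓐} {X : T} (f : A ⟶ X ⊙ₗ B) :
    e.F.obj A ⟶ X ⊙ₗ e.F.obj B :=
  e.F.map f ≫ inv (LaxLeftLinear.μₗ e.F X B)

/-- The image `X ⊙ F B ⟶ F A` of a morphism `X ⊙ B ⟶ A`. -/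
def actionMap {A B : 𝓐} {X : T} (f : X ⊙ₗ B ⟶ A) : X ⊙ₗ e.F.obj B ⟶ e.F.obj A :=
  LaxLeftLinear.μₗ e.F X B ≫ e.F.map f

variable {A B E E' : 𝓐} {X X' Y Z Z' : T}

-- This characterizes `coactMap`, since the structure morphism is invertible. The identities below
-- are verified after composing with it.
@[simp]
theorem coactMap_lineator (f : A ⟶ X ⊙ₗ B) :
    e.coactMap f ≫ LaxLeftLinear.μₗ e.F X B = e.F.map f := by
  simp [coactMap]

@[simp]
theorem coactMap_lineator_assoc (f : A ⟶ X ⊙ₗ B) {W : 𝓑} (g : e.F.obj (X ⊙ₗ B) ⟶ W) :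
    e.coactMap f ≫ LaxLeftLinear.μₗ e.F X B ≫ g = e.F.map f ≫ g := by
  simp [coactMap]

@[simp]
theorem action_coactMap_lineator (Z : T) (f : A ⟶ X ⊙ₗ B) :
    Z ⊴ₗ e.coactMap f ≫ Z ⊴ₗ LaxLeftLinear.μₗ e.F X B = Z ⊴ₗ e.F.map f := by
  rw [← actionHomRight_comp, coactMap_lineator]

@[simp]
theorem action_coactMap_lineator_assoc (Z : T) (f : A ⟶ X ⊙ₗ B) {W : 𝓑}
    (g : Z ⊙ₗ e.F.obj (X ⊙ₗ B) ⟶ W) :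
    Z ⊴ₗ e.coactMap f ≫ Z ⊴ₗ LaxLeftLinear.μₗ e.F X B ≫ g = Z ⊴ₗ e.F.map f ≫ g := by
  rw [← Category.assoc, action_coactMap_lineator]

theorem coactMap_whisker (f : A ⟶ X ⊙ₗ B) (u : X ⟶ Y) :
    e.coactMap (f ≫ u ⊵ₗ B) = e.coactMap f ≫ u ⊵ₗ e.F.obj B := by
  rw [← cancel_mono (LaxLeftLinear.μₗ e.F Y B)]
  simp

/-- The associativity axiom merges the structure morphisms for `X` and `Y` into the one for `X ⊗ Y`.
Together with `coactMap_whisker` and `coactMap_unit`, this carries the axioms of a coaction from `A`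
to `F A`. -/
theorem coactMap_comp (f : A ⟶ X ⊙ₗ B) (g : B ⟶ Y ⊙ₗ E) :
    e.coactMap (f ≫ X ⊴ₗ g ≫ (αₗ X Y E).inv) =
      e.coactMap f ≫ X ⊴ₗ e.coactMap g ≫ (αₗ X Y (e.F.obj E)).inv := by
  rw [← cancel_mono (LaxLeftLinear.μₗ e.F (X ⊗ Y) E)]
  simp only [coactMap_lineator, Category.assoc, ← LaxLeftLinear.μₗ_associativity_inv,
    action_coactMap_lineator_assoc, LaxLeftLinear.μₗ_naturality_right_assoc,
    coactMap_lineator_assoc, Functor.map_comp]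

theorem coactMap_unit (f : A ⟶ 𝟙_ T ⊙ₗ B) :
    e.coactMap f ≫ (λₗ (e.F.obj B)).hom = e.F.map (f ≫ (λₗ B).hom) := by
  rw [LaxLeftLinear.μₗ_unitality, coactMap_lineator_assoc, Functor.map_comp]

theorem actionMap_whisker (f : Y ⊙ₗ B ⟶ A) (u : X ⟶ Y) :
    e.actionMap (u ⊵ₗ B ≫ f) = u ⊵ₗ e.F.obj B ≫ e.actionMap f := by
  simp [actionMap]

/-- Actions, unlike coactions, are carried along by any lax module functor: no inverse of a
structure morphism occurs. -/
theorem actionMap_comp (f : X ⊙ₗ B ⟶ A) (g : Y ⊙ₗ E ⟶ B) :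
    e.actionMap ((αₗ X Y E).hom ≫ X ⊴ₗ g ≫ f) =
      (αₗ X Y (e.F.obj E)).hom ≫ X ⊴ₗ e.actionMap g ≫ e.actionMap f := by
  simp [actionMap]

theorem actionMap_unit (f : 𝟙_ T ⊙ₗ B ⟶ A) :
    (λₗ (e.F.obj B)).inv ≫ e.actionMap f = e.F.map ((λₗ B).inv ≫ f) := by
  simp [actionMap, ← Functor.map_comp]

/-- Compatibility of an action with a coaction involves an exchange morphism `p` in `T`. Since `p`
acts only through whiskering, the whole diagram survives transport. It is used to keep the coaction
of `F C` compatible with the action of `H`. -/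
theorem actionMap_coactMap {a : Z ⊙ₗ A ⟶ E} {l : E ⟶ X' ⊙ₗ E'} {f : A ⟶ X ⊙ₗ B}
    {p : Z ⊗ X ⟶ X' ⊗ Z'} {b : Z' ⊙ₗ B ⟶ E'}
    (h : a ≫ l = Z ⊴ₗ f ≫ (αₗ Z X B).inv ≫ p ⊵ₗ B ≫ (αₗ X' Z' B).hom ≫ X' ⊴ₗ b) :
    e.actionMap a ≫ e.coactMap l = Z ⊴ₗ e.coactMap f ≫ (αₗ Z X (e.F.obj B)).inv ≫
      p ⊵ₗ e.F.obj B ≫ (αₗ X' Z' (e.F.obj B)).hom ≫ X' ⊴ₗ e.actionMap b := by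
  rw [← cancel_mono (LaxLeftLinear.μₗ e.F X' E')]
  simp only [actionMap, Category.assoc, coactMap_lineator, ← Functor.map_comp, h]
  simp only [actionHomRight_comp, Category.assoc, LaxLeftLinear.μₗ_naturality_right,
    ← LaxLeftLinear.μₗ_associativity_assoc, LaxLeftLinear.μₗ_naturality_left_assoc,
    ← LaxLeftLinear.μₗ_associativity_inv_assoc]
  simp only [action_coactMap_lineator_assoc, LaxLeftLinear.μₗ_naturality_right_assoc,
    Functor.map_comp]

/-- The unit isomorphism `G F A ≅ A`. -/
def unitIso (A : 𝓐) : e.symm.F.obj (e.F.obj A) ≅ A := e.η.app A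

theorem unitIso_naturality (f : A ⟶ B) :
    e.symm.F.map (e.F.map f) ≫ (e.unitIso B).hom = (e.unitIso A).hom ≫ f :=
  e.η.hom.naturality f

theorem unitIso_lineator (X : T) (A : 𝓐) : LaxLeftLinear.μₗ e.symm.F X (e.F.obj A) ≫
    e.symm.F.map (LaxLeftLinear.μₗ e.F X A) ≫ (e.unitIso (X ⊙ₗ A)).hom =
      X ⊴ₗ (e.unitIso A).hom :=
  (Category.assoc _ _ _).symm.trans (e.η_lineator X A)

/-- Because `η` respects the structure morphisms, transporting a coaction forth and back returns it
up to the unit isomorphism. -/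
theorem coactMap_coactMap (f : A ⟶ X ⊙ₗ B) :
    e.symm.coactMap (e.coactMap f) ≫ X ⊴ₗ (e.unitIso B).hom = (e.unitIso A).hom ≫ f := by
  rw [← e.unitIso_lineator, coactMap_lineator_assoc, ← Functor.map_comp_assoc, coactMap_lineator,
    unitIso_naturality]

theorem actionMap_actionMap (f : X ⊙ₗ B ⟶ A) :
    e.symm.actionMap (e.actionMap f) ≫ (e.unitIso A).hom = X ⊴ₗ (e.unitIso B).hom ≫ f := by
  rw [← e.unitIso_lineator, actionMap, actionMap]
  simp only [Functor.map_comp, Category.assoc, unitIso_naturality]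

/-- If `f` is an equalizer of `u ⊵ B` and `X ⊴ g`, then the universal property holds for the
images of `f` and `g`. -/
theorem exists_lift_coactMap {f : A ⟶ X ⊙ₗ B} {u : X ⟶ X ⊗ Y} {g : B ⟶ Y ⊙ₗ B}
    (hf : ∀ (W : 𝓐) (z : W ⟶ X ⊙ₗ B), z ≫ u ⊵ₗ B = z ≫ X ⊴ₗ g ≫ (αₗ X Y B).inv →
      ∃ w : W ⟶ A, w ≫ f = z) {W : 𝓑} (z : W ⟶ X ⊙ₗ e.F.obj B)
    (hz : z ≫ u ⊵ₗ e.F.obj B = z ≫ X ⊴ₗ e.coactMap g ≫ (αₗ X Y (e.F.obj B)).inv) :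
    ∃ w : W ⟶ e.F.obj A, w ≫ e.coactMap f = z := by
  -- The test object is replaced by an isomorphic one in the image of `F`; fullness then lifts the
  -- test morphism, and faithfulness the equation that it satisfies.
  let i := e.F.objObjPreimageIso W
  obtain ⟨z', hz'⟩ := e.F.map_surjective (i.hom ≫ z ≫ LaxLeftLinear.μₗ e.F X B)
  obtain ⟨w, hw⟩ := hf _ z' (e.F.map_injective (by
    have h := congrArg (fun t => i.hom ≫ t ≫ LaxLeftLinear.μₗ e.F (X ⊗ Y) B) hz
    simp only [Category.assoc, LaxLeftLinear.μₗ_naturality_left,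
      ← LaxLeftLinear.μₗ_associativity_inv, action_coactMap_lineator_assoc,
      LaxLeftLinear.μₗ_naturality_right_assoc] at h
    simpa only [Functor.map_comp, hz', Category.assoc] using h))
  refine ⟨i.inv ≫ e.F.map w, ?_⟩
  rw [← cancel_mono (LaxLeftLinear.μₗ e.F X B), Category.assoc, Category.assoc,
    coactMap_lineator, ← e.F.map_comp, hw, hz', Iso.inv_hom_id_assoc]

theorem mono_coactMap (f : A ⟶ X ⊙ₗ B) [Mono f] : Mono (e.coactMap f) := by
  unfold coactMap
  infer_instance

end LeftModuleEquivalence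

open MonoidalRightAction

attribute [local instance] monoidalOppositeLeftAction

variable {𝓐' : Type u₂} [Category.{v₂} 𝓐'] [MonoidalRightAction T 𝓐']
  {𝓑' : Type u₃} [Category.{v₃} 𝓑'] [MonoidalRightAction T 𝓑']

/-- A lax right module functor is a lax left module functor over the opposite monoidal
category. -/
@[reducible]
def LaxRightLinear.toLeft (F : 𝓐' ⥤ 𝓑') [F.LaxRightLinear T] : F.LaxLeftLinear Tᴹᵒᵖ where
  μₗ X A := LaxRightLinear.μᵣ F A X.unmop
  μₗ_naturality_left f A := LaxRightLinear.μᵣ_naturality_right F A f.unmop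
  μₗ_naturality_right X _ _ f := LaxRightLinear.μᵣ_naturality_left F f X.unmop
  μₗ_associativity X Y A := LaxRightLinear.μᵣ_associativity F A Y.unmop X.unmop
  μₗ_unitality A := LaxRightLinear.μᵣ_unitality F A

/-- A right action of `T` is a left action of `Tᴹᵒᵖ`, so the results on left module categories cover
the right-handed case. -/
theorem RightModuleEquivalent.exists_equivalence (h : RightModuleEquivalent T 𝓐' 𝓑') :
    Nonempty (LeftModuleEquivalence Tᴹᵒᵖ 𝓐' 𝓑') := by
  obtain ⟨F, G, _, _, η, ε, hη, hε⟩ := h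
  let _ := LaxRightLinear.toLeft (T := T) F
  let _ := LaxRightLinear.toLeft (T := T) G
  exact ⟨⟨F, G, η, ε, fun X A => hη A X.unmop, fun X A => hε A X.unmop⟩⟩

end ModuleEquivalence

end EqMT

namespace EqMT

open TensorProduct (sub_tmul tmul_sub)

/-! ### Linear algebra of cotensor products, as kernels of differences of coactions -/

section CoactionDiff

variable {k C D : Type u} [Field k] [AddCommGroup C] [Module k C] [AddCommGroup D] [Module k D]
  {U V W V' W' : Type u} [AddCommGroup U] [Module k U] [AddCommGroup V] [Module k V]
  [AddCommGroup W] [Module k W] [AddCommGroup V'] [Module k V'] [AddCommGroup W'] [Module k W']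

/-- The difference `ρ ⊗ id - id ⊗ σ` for a right coaction `ρ` and a left coaction `σ`. -/
def coactionDiff (ρ : V →ₗ[k] V ⊗[k] D) (σ : W →ₗ[k] D ⊗[k] W) :
    V ⊗[k] W →ₗ[k] (V ⊗[k] D) ⊗[k] W :=
  ρ.rTensor W - (assoc k V D W).symm.toLinearMap ∘ₗ σ.lTensor V

theorem coactionDiff_tmul (ρ : V →ₗ[k] V ⊗[k] D) (σ : W →ₗ[k] D ⊗[k] W) (v : V) (w : W) :
    coactionDiff ρ σ (v ⊗ₜ w) = ρ v ⊗ₜ w - (assoc k V D W).symm (v ⊗ₜ σ w) := rfl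

/-- Naturality in colinear maps; in particular the kernels, that is the cotensor products, are
functorial. -/
theorem coactionDiff_map {ρ : V →ₗ[k] V ⊗[k] D} {σ : W →ₗ[k] D ⊗[k] W}
    {ρ' : V' →ₗ[k] V' ⊗[k] D} {σ' : W' →ₗ[k] D ⊗[k] W'} {f : V →ₗ[k] V'} {g : W →ₗ[k] W'}
    (hf : ρ' ∘ₗ f = f.rTensor D ∘ₗ ρ) (hg : σ' ∘ₗ g = g.lTensor D ∘ₗ σ) (x : V ⊗[k] W) :
    coactionDiff ρ' σ' (TensorProduct.map f g x) =
      TensorProduct.map (f.rTensor D) g (coactionDiff ρ σ x) := by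
  refine indOn x (by simp) (fun m n => ?_) (fun _ _ hx hy => by simp only [map_add, hx, hy])
  have hf := LinearMap.congr_fun hf m
  have hg := LinearMap.congr_fun hg n
  simp only [LinearMap.comp_apply] at hf hg
  simp only [coactionDiff, LinearMap.sub_apply, LinearMap.comp_apply, TensorProduct.map_tmul,
    LinearMap.rTensor_tmul, LinearMap.lTensor_tmul, LinearEquiv.coe_coe, map_sub, hf, hg]
  congr 1
  generalize σ n = t
  refine indOn t (by simp) (fun d n => ?_) (fun _ _ hx hy => by
    simp only [map_add, tmul_add, hx, hy])
  simp

/-- Tensoring with a vector space `U` on the side away from `D` commutes with forming the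
difference. -/
theorem coactionDiff_tensor_left (ρ : V →ₗ[k] V ⊗[k] D) (σ : W →ₗ[k] D ⊗[k] W)
    (x : (U ⊗[k] V) ⊗[k] W) :
    assoc k U (V ⊗[k] D) W ((assoc k U V D).toLinearMap.rTensor W
      (coactionDiff ((assoc k U V D).symm.toLinearMap ∘ₗ ρ.lTensor U) σ x)) =
      (coactionDiff ρ σ).lTensor U (assoc k U V W x) := by
  refine indOn x (by simp) (fun z n => ?_) (fun _ _ hx hy => by simp only [map_add, hx, hy])
  refine indOn z (by simp) (fun y m => ?_) (fun _ _ hx hy => by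
    simp only [map_add, add_tmul, hx, hy])
  simp only [coactionDiff_tmul, LinearMap.comp_apply, LinearMap.rTensor_tmul,
    LinearMap.lTensor_tmul, LinearEquiv.coe_coe, map_sub, TensorProduct.assoc_tmul,
    tmul_sub]
  congr 1
  · simp
  · generalize σ n = t
    refine indOn t (by simp) (fun d n => ?_) (fun _ _ hx hy => by
      simp only [map_add, tmul_add, hx, hy])
    simp

theorem coactionDiff_tensor_right (ρ : U →ₗ[k] U ⊗[k] D) (σ : V →ₗ[k] D ⊗[k] V)
    (x : U ⊗[k] (V ⊗[k] W)) :
    (assoc k (U ⊗[k] D) V W).symm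
      (coactionDiff ρ ((assoc k D V W).toLinearMap ∘ₗ σ.rTensor W) x) =
      (coactionDiff ρ σ).rTensor W ((assoc k U V W).symm x) := by
  refine indOn x (by simp) (fun y z => ?_) (fun _ _ hx hy => by simp only [map_add, hx, hy])
  refine indOn z (by simp) (fun m n => ?_) (fun _ _ hx hy => by
    simp only [map_add, tmul_add, hx, hy])
  simp only [coactionDiff, LinearMap.sub_apply, LinearMap.comp_apply, LinearMap.rTensor_tmul,
    LinearMap.lTensor_tmul, LinearEquiv.coe_coe, map_sub, TensorProduct.assoc_symm_tmul,
    sub_tmul]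
  congr 1
  generalize σ m = t
  refine indOn t (by simp) (fun d n => ?_) (fun _ _ hx hy => by
    simp only [map_add, tmul_add, add_tmul, hx, hy])
  simp

section Counit

variable [Coalgebra k D]

/-- This is `V □ D = V`. The inclusion of the range is coassociativity; the other one uses only the
counit of `D`. -/
theorem ker_coactionDiff_comul {ρ : V →ₗ[k] V ⊗[k] D}
    (hρ : (assoc k V D D).toLinearMap ∘ₗ ρ.rTensor D ∘ₗ ρ = comul.lTensor V ∘ₗ ρ) :
    LinearMap.ker (coactionDiff ρ (comul (R := k) (A := D))) = LinearMap.range ρ := by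
  ext x
  rw [LinearMap.mem_ker, coactionDiff, LinearMap.sub_apply, sub_eq_zero]
  constructor
  · intro h
    -- The preimage of `x` is `(id ⊗ ε) x`: applying `ε` to the last factor of the equation defining
    -- the kernel turns its two sides into `ρ ((id ⊗ ε) x)` and `x`.
    refine ⟨rid k _ ((CoalgebraStruct.counit (R := k) (A := D)).lTensor _ x), ?_⟩
    have h' := congrArg (fun t => rid k _
      ((CoalgebraStruct.counit (R := k) (A := D)).lTensor (V ⊗[k] D) t)) h
    have g1 : ∀ t : V ⊗[k] D, rid k _ ((CoalgebraStruct.counit (R := k) (A := D)).lTensor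
        (V ⊗[k] D) (ρ.rTensor D t)) =
        ρ (rid k _ ((CoalgebraStruct.counit (R := k) (A := D)).lTensor _ t)) := by
      intro t
      refine indOn t (by simp) (fun m d => ?_) (fun _ _ hx hy => by simp only [map_add, hx, hy])
      simp
    have g2 : ∀ t : V ⊗[k] D, rid k _ ((CoalgebraStruct.counit (R := k) (A := D)).lTensor
        (V ⊗[k] D) ((assoc k V D D).symm (comul.lTensor V t))) = t := by
      intro t
      refine indOn t (by simp) (fun m d => ?_) (fun _ _ hx hy => by simp only [map_add, hx, hy])
      have e : ∀ s : D ⊗[k] D, rid k _ ((CoalgebraStruct.counit (R := k) (A := D)).lTensor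
          (V ⊗[k] D) ((assoc k V D D).symm (m ⊗ₜ s))) =
          m ⊗ₜ rid k _ ((CoalgebraStruct.counit (R := k) (A := D)).lTensor D s) := by
        intro s
        refine indOn s (by simp) (fun m d => ?_) (fun _ _ hx hy => by
          simp only [map_add, tmul_add, hx, hy])
        simp
      rw [LinearMap.lTensor_tmul, e, Coalgebra.lTensor_counit_comul]
      simp
    exact (g1 x).symm.trans (h'.trans (g2 x))
  · rintro ⟨m, rfl⟩
    exact (LinearEquiv.eq_symm_apply _).2 (LinearMap.congr_fun hρ m)

theorem ker_coactionDiff_comul_left {σ : V →ₗ[k] D ⊗[k] V}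
    (hσ : (assoc k D D V).toLinearMap ∘ₗ comul.rTensor V ∘ₗ σ = σ.lTensor D ∘ₗ σ) :
    LinearMap.ker (coactionDiff (comul (R := k) (A := D)) σ) = LinearMap.range σ := by
  ext x
  rw [LinearMap.mem_ker, coactionDiff, LinearMap.sub_apply, sub_eq_zero]
  constructor
  · intro h
    refine ⟨lid k _ ((CoalgebraStruct.counit (R := k) (A := D)).rTensor _ x), ?_⟩
    have h' := congrArg (fun t => lid k _
      ((CoalgebraStruct.counit (R := k) (A := D)).rTensor (D ⊗[k] V)
        (assoc k D D V t))) h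
    have g1 : ∀ t : D ⊗[k] V, lid k _ ((CoalgebraStruct.counit (R := k) (A := D)).rTensor
        (D ⊗[k] V) (σ.lTensor D t)) =
        σ (lid k _ ((CoalgebraStruct.counit (R := k) (A := D)).rTensor _ t)) := by
      intro t
      refine indOn t (by simp) (fun m d => ?_) (fun _ _ hx hy => by simp only [map_add, hx, hy])
      simp
    have g2 : ∀ t : D ⊗[k] V, lid k _ ((CoalgebraStruct.counit (R := k) (A := D)).rTensor
        (D ⊗[k] V) (assoc k D D V (comul.rTensor V t))) = t := by
      intro t
      refine indOn t (by simp) (fun d m => ?_) (fun _ _ hx hy => by simp only [map_add, hx, hy])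
      have e : ∀ s : D ⊗[k] D, lid k _ ((CoalgebraStruct.counit (R := k) (A := D)).rTensor
          (D ⊗[k] V) (assoc k D D V (s ⊗ₜ m))) =
          lid k _ ((CoalgebraStruct.counit (R := k) (A := D)).rTensor D s) ⊗ₜ m := by
        intro s
        refine indOn s (by simp) (fun m d => ?_) (fun _ _ hx hy => by
          simp only [map_add, add_tmul, hx, hy])
        simp [TensorProduct.smul_tmul']
      rw [LinearMap.rTensor_tmul, e, Coalgebra.rTensor_counit_comul]
      simp
    simp only [LinearMap.comp_apply, LinearEquiv.coe_coe, LinearEquiv.apply_symm_apply] at h'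
    exact (g1 x).symm.trans (h'.symm.trans (g2 x))
  · rintro ⟨m, rfl⟩
    exact (LinearEquiv.eq_symm_apply _).2 (LinearMap.congr_fun hσ m)

end Counit

section Range

variable {P Q : Type u} [AddCommGroup P] [Module k P] [AddCommGroup Q] [Module k Q]

/-- Here `j` presents `P` as `U □ V` and `i` presents `Q` as `P □ W`, so the range is `(U □ V) □ W`
inside `(U ⊗ V) ⊗ W`. By flatness, being in the range of `j ⊗ W` is the first kernel condition; on
that range the second condition restricts to the one for `P`, as `j` is `D`-colinear. -/
theorem range_rTensor_comp_coactionDiff {ρ : U →ₗ[k] U ⊗[k] C} {σ : V →ₗ[k] C ⊗[k] V}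
    {b : V →ₗ[k] V ⊗[k] D} {c : W →ₗ[k] D ⊗[k] W} {j : P →ₗ[k] U ⊗[k] V}
    {r : P →ₗ[k] P ⊗[k] D} {i : Q →ₗ[k] P ⊗[k] W} (hj : Function.Injective j)
    (hjr : LinearMap.range j = LinearMap.ker (coactionDiff ρ σ))
    (hr : ((assoc k U V D).symm.toLinearMap ∘ₗ b.lTensor U) ∘ₗ j = j.rTensor D ∘ₗ r)
    (hi : LinearMap.range i = LinearMap.ker (coactionDiff r c)) :
    LinearMap.range (j.rTensor W ∘ₗ i) = LinearMap.ker ((coactionDiff ρ σ).rTensor W) ⊓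
      LinearMap.ker (coactionDiff ((assoc k U V D).symm.toLinearMap ∘ₗ b.lTensor U) c) := by
  have hj2 : Function.Injective (TensorProduct.map (j.rTensor D) (LinearMap.id : W →ₗ[k] W)) :=
    Module.Flat.rTensor_preserves_injective_linearMap (M := W) _
      (Module.Flat.rTensor_preserves_injective_linearMap (M := D) _ hj)
  have hm : ∀ x : P ⊗[k] W, coactionDiff ((assoc k U V D).symm.toLinearMap ∘ₗ b.lTensor U) c
      (j.rTensor W x) = TensorProduct.map (j.rTensor D) LinearMap.id (coactionDiff r c x) :=
    fun x => coactionDiff_map (g := LinearMap.id) hr (by simp) x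
  have hex : ∀ z, (coactionDiff ρ σ).rTensor W z = 0 ↔ z ∈ LinearMap.range (j.rTensor W) :=
    Module.Flat.rTensor_exact W (LinearMap.exact_iff.2 hjr.symm)
  apply le_antisymm
  · rintro _ ⟨w, rfl⟩
    have hw : coactionDiff r c (i w) = 0 := hi.le (LinearMap.mem_range_self _ w)
    refine ⟨(hex _).2 (LinearMap.mem_range_self _ (i w)), ?_⟩
    rw [SetLike.mem_coe, LinearMap.mem_ker, LinearMap.comp_apply, hm, hw, map_zero]
  · rintro z ⟨h1, h2⟩
    obtain ⟨w, rfl⟩ := (hex z).1 h1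
    rw [SetLike.mem_coe, LinearMap.mem_ker, hm] at h2
    obtain ⟨v, rfl⟩ := hi.ge ((map_eq_zero_iff _ hj2).1 h2 : coactionDiff r c w = 0)
    exact ⟨v, rfl⟩

/-- The mirror image, for `V □ (V' □ W)`. -/
theorem range_lTensor_comp_coactionDiff {b : V →ₗ[k] V ⊗[k] D} {σ : W →ₗ[k] C ⊗[k] W}
    {ρ : V' →ₗ[k] V' ⊗[k] C} {c : V' →ₗ[k] D ⊗[k] V'} {j : P →ₗ[k] V' ⊗[k] W}
    {r : P →ₗ[k] D ⊗[k] P} {i : Q →ₗ[k] V ⊗[k] P} (hj : Function.Injective j)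
    (hjr : LinearMap.range j = LinearMap.ker (coactionDiff ρ σ))
    (hr : ((assoc k D V' W).toLinearMap ∘ₗ c.rTensor W) ∘ₗ j = j.lTensor D ∘ₗ r)
    (hi : LinearMap.range i = LinearMap.ker (coactionDiff b r)) :
    LinearMap.range (j.lTensor V ∘ₗ i) = LinearMap.ker ((coactionDiff ρ σ).lTensor V) ⊓
      LinearMap.ker (coactionDiff b ((assoc k D V' W).toLinearMap ∘ₗ c.rTensor W)) := by
  have hj2 : Function.Injective (TensorProduct.map
      ((LinearMap.id : V →ₗ[k] V).rTensor D) j) := by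
    rw [LinearMap.rTensor_id]
    exact Module.Flat.lTensor_preserves_injective_linearMap (M := V ⊗[k] D) _ hj
  have hm : ∀ x : V ⊗[k] P, coactionDiff b ((assoc k D V' W).toLinearMap ∘ₗ c.rTensor W)
      (j.lTensor V x) = TensorProduct.map (LinearMap.id.rTensor D) j (coactionDiff b r x) :=
    fun x => coactionDiff_map (f := LinearMap.id) (by simp) hr x
  have hex : ∀ z, (coactionDiff ρ σ).lTensor V z = 0 ↔ z ∈ LinearMap.range (j.lTensor V) :=
    Module.Flat.lTensor_exact V (LinearMap.exact_iff.2 hjr.symm)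
  apply le_antisymm
  · rintro _ ⟨w, rfl⟩
    have hw : coactionDiff b r (i w) = 0 := hi.le (LinearMap.mem_range_self _ w)
    refine ⟨(hex _).2 (LinearMap.mem_range_self _ (i w)), ?_⟩
    rw [SetLike.mem_coe, LinearMap.mem_ker, LinearMap.comp_apply, hm, hw, map_zero]
  · rintro z ⟨h1, h2⟩
    obtain ⟨w, rfl⟩ := (hex z).1 h1
    rw [SetLike.mem_coe, LinearMap.mem_ker, hm] at h2
    obtain ⟨v, rfl⟩ := hi.ge ((map_eq_zero_iff _ hj2).1 h2 : coactionDiff b r w = 0)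
    exact ⟨v, rfl⟩

variable [Coalgebra k C]

/-- If `ι` identifies `C` with `V □ W`, then `u ↦ u₍₀₎ ⊗ ι(u₍₁₎)` has the same image as `(U □ V) □
W`. The second kernel consists of the elements of `U ⊗ ι(C)`, and on these the first condition
becomes membership in `U □ C = U`. -/
theorem range_coact_of_range_eq {ρ : U →ₗ[k] U ⊗[k] C} {σ : V →ₗ[k] C ⊗[k] V}
    {b : V →ₗ[k] V ⊗[k] D} {c : W →ₗ[k] D ⊗[k] W} {ι : C →ₗ[k] V ⊗[k] W}
    (hρ : (assoc k U C C).toLinearMap ∘ₗ ρ.rTensor C ∘ₗ ρ = comul.lTensor U ∘ₗ ρ)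
    (hι : Function.Injective ι) (hr : LinearMap.range ι = LinearMap.ker (coactionDiff b c))
    (hl : ((assoc k C V W).toLinearMap ∘ₗ σ.rTensor W) ∘ₗ ι = ι.lTensor C ∘ₗ comul) :
    LinearMap.range ((assoc k U V W).symm.toLinearMap ∘ₗ ι.lTensor U ∘ₗ ρ) =
      LinearMap.ker ((coactionDiff ρ σ).rTensor W) ⊓
      LinearMap.ker (coactionDiff ((assoc k U V D).symm.toLinearMap ∘ₗ b.lTensor U) c) := by
  have hex : ∀ z, (coactionDiff b c).lTensor U z = 0 ↔ z ∈ LinearMap.range (ι.lTensor U) :=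
    Module.Flat.lTensor_exact U (LinearMap.exact_iff.2 hr.symm)
  have hj : Function.Injective (TensorProduct.map ((LinearMap.id : U →ₗ[k] U).rTensor C) ι) := by
    rw [LinearMap.rTensor_id]
    exact Module.Flat.lTensor_preserves_injective_linearMap (M := U ⊗[k] C) _ hι
  -- The left colinearity of `ι` turns the difference for `σ` into that for `Δ`, to which
  -- `ker_coactionDiff_comul` applies.
  have h1 : ∀ w : U ⊗[k] C, (coactionDiff ρ σ).rTensor W
      ((assoc k _ _ _).symm (ι.lTensor U w)) = 0 ↔ w ∈ LinearMap.range ρ := by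
    intro w
    rw [← ker_coactionDiff_comul hρ, LinearMap.mem_ker, ← coactionDiff_tensor_right,
      LinearEquiv.map_eq_zero_iff, ← map_eq_zero_iff _ hj, ← coactionDiff_map (ρ := ρ) (ρ' := ρ) (by simp) hl]
    rfl
  -- The second condition is the defining equation of `V □ W` tensored with `U`, so exactness
  -- identifies its solutions with the range of `U ⊗ ι`.
  have h2 : ∀ z : (U ⊗[k] V) ⊗[k] W,
      coactionDiff ((assoc k U V D).symm.toLinearMap ∘ₗ b.lTensor U) c z = 0 ↔
      assoc k _ _ _ z ∈ LinearMap.range (ι.lTensor U) := by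
    intro z
    rw [← hex, ← coactionDiff_tensor_left, LinearEquiv.map_eq_zero_iff, map_eq_zero_iff _
      (Module.Flat.rTensor_preserves_injective_linearMap (M := W) _ (assoc k U V D).injective)]
  apply le_antisymm
  · rintro _ ⟨y, rfl⟩
    refine ⟨(h1 _).2 (LinearMap.mem_range_self _ y), (h2 _).2 ?_⟩
    exact ⟨ρ y, by simp⟩
  · rintro z ⟨hz1, hz2⟩
    obtain ⟨w, hw⟩ := (h2 z).1 hz2
    obtain rfl : (assoc k _ _ _).symm (ι.lTensor U w) = z :=
      (LinearEquiv.symm_apply_eq _).2 hw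
    obtain ⟨y, rfl⟩ := (h1 w).1 hz1
    exact ⟨y, rfl⟩

theorem range_coact_of_range_eq_left {b : V →ₗ[k] V ⊗[k] D} {c : W →ₗ[k] D ⊗[k] W}
    {ρ : W →ₗ[k] W ⊗[k] C} {σ : U →ₗ[k] C ⊗[k] U} {ι : C →ₗ[k] V ⊗[k] W}
    (hσ : (assoc k C C U).toLinearMap ∘ₗ comul.rTensor U ∘ₗ σ = σ.lTensor C ∘ₗ σ)
    (hι : Function.Injective ι) (hr : LinearMap.range ι = LinearMap.ker (coactionDiff b c))
    (hl : ((assoc k V W C).symm.toLinearMap ∘ₗ ρ.lTensor V) ∘ₗ ι = ι.rTensor C ∘ₗ comul) :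
    LinearMap.range ((assoc k V W U).toLinearMap ∘ₗ ι.rTensor U ∘ₗ σ) =
      LinearMap.ker ((coactionDiff ρ σ).lTensor V) ⊓
      LinearMap.ker (coactionDiff b ((assoc k D W U).toLinearMap ∘ₗ c.rTensor U)) := by
  have hex : ∀ z, (coactionDiff b c).rTensor U z = 0 ↔ z ∈ LinearMap.range (ι.rTensor U) :=
    Module.Flat.rTensor_exact U (LinearMap.exact_iff.2 hr.symm)
  have hj : Function.Injective (TensorProduct.map (ι.rTensor C) (LinearMap.id : U →ₗ[k] U)) :=
    Module.Flat.rTensor_preserves_injective_linearMap (M := U) _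
      (Module.Flat.rTensor_preserves_injective_linearMap (M := C) _ hι)
  have h1 : ∀ w : C ⊗[k] U, (coactionDiff ρ σ).lTensor V
      (assoc k _ _ _ (ι.rTensor U w)) = 0 ↔ w ∈ LinearMap.range σ := by
    intro w
    rw [← ker_coactionDiff_comul_left hσ, LinearMap.mem_ker, ← coactionDiff_tensor_left,
      LinearEquiv.map_eq_zero_iff, map_eq_zero_iff _
      (Module.Flat.rTensor_preserves_injective_linearMap (M := U) _ (assoc k V W C).injective),
      ← map_eq_zero_iff _ hj, ← coactionDiff_map (σ := σ) (σ' := σ) hl (by simp)]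
    rfl
  have h2 : ∀ z : V ⊗[k] (W ⊗[k] U),
      coactionDiff b ((assoc k D W U).toLinearMap ∘ₗ c.rTensor U) z = 0 ↔
      (assoc k _ _ _).symm z ∈ LinearMap.range (ι.rTensor U) := by
    intro z
    rw [← hex, ← coactionDiff_tensor_right, LinearEquiv.map_eq_zero_iff]
  apply le_antisymm
  · rintro _ ⟨y, rfl⟩
    refine ⟨(h1 _).2 (LinearMap.mem_range_self _ y), (h2 _).2 ?_⟩
    exact ⟨σ y, by simp⟩
  · rintro z ⟨hz1, hz2⟩
    obtain ⟨w, hw⟩ := (h2 z).1 hz2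
    obtain rfl : assoc k _ _ _ (ι.rTensor U w) = z :=
      ((LinearEquiv.symm_apply_eq _).1 hw.symm).symm
    obtain ⟨y, rfl⟩ := (h1 w).1 hz1
    exact ⟨y, rfl⟩

end Range

end CoactionDiff

/-! ### Bicomodules: `Y ≅ (Y □ M) □ N` and `Y ≅ M □ (N □ Y)` when `M □ N ≅ C` -/

namespace HBicomod

variable {k H A C D E : Type u} [Field k] [Ring H] [Bialgebra k H]
  [AddCommGroup A] [Module k A] [Coalgebra k A] [Module H A] [IsScalarTower k H A]
  [AddCommGroup C] [Module k C] [Coalgebra k C] [Module H C] [IsScalarTower k H C]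
  [AddCommGroup D] [Module k D] [Coalgebra k D] [Module H D] [IsScalarTower k H D]
  [AddCommGroup E] [Module k E] [Coalgebra k E] [Module H E] [IsScalarTower k H E]

theorem hom_ext {M N : HBicomod k H C D} {f g : M ⟶ N} (h : ∀ x, f.lin x = g.lin x) : f = g :=
  Hom.ext (LinearMap.ext h)

/-- A linear map through which a morphism factors along an injective morphism is a morphism. -/
def liftHom {P Q R : HBicomod k H C D} (i : Q ⟶ R) (hi : Function.Injective i.lin) (f : P ⟶ R)
    (g : P.carrier →ₗ[k] Q.carrier) (hg : i.lin ∘ₗ g = f.lin) : P ⟶ Q where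
  lin := g
  comm_act h := by
    refine (LinearMap.cancel_left hi).1 ?_
    rw [← comp_assoc, hg, f.comm_act, ← comp_assoc, i.comm_act, comp_assoc, hg]
  lcomm := by
    refine (LinearMap.cancel_left
      (Module.Flat.lTensor_preserves_injective_linearMap (M := C) _ hi)).1 ?_
    rw [← comp_assoc, ← i.lcomm, comp_assoc, hg, f.lcomm, ← comp_assoc, ← LinearMap.lTensor_comp,
      hg]
  rcomm := by
    refine (LinearMap.cancel_left
      (Module.Flat.rTensor_preserves_injective_linearMap (M := D) _ hi)).1 ?_
    rw [← comp_assoc, ← i.rcomm, comp_assoc, hg, f.rcomm, ← comp_assoc, ← LinearMap.rTensor_comp,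
      hg]

/-- The factorization of a morphism along an injective morphism whose range contains its range. -/
noncomputable def liftOfRange {P Q R : HBicomod k H C D} (i : Q ⟶ R)
    (hi : Function.Injective i.lin) (f : P ⟶ R)
    (h : LinearMap.range f.lin ≤ LinearMap.range i.lin) : P ⟶ Q :=
  liftHom i hi f (liftInj i.lin hi f.lin fun x => h (LinearMap.mem_range_self _ x))
    (LinearMap.ext (liftInj_spec i.lin hi f.lin _))

theorem liftOfRange_spec {P Q R : HBicomod k H C D} (i : Q ⟶ R)
    (hi : Function.Injective i.lin) (f : P ⟶ R)
    (h : LinearMap.range f.lin ≤ LinearMap.range i.lin) (x : P.carrier) :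
    i.lin ((liftOfRange i hi f h).lin x) = f.lin x :=
  liftInj_spec i.lin hi f.lin _ x

/-- Two injective morphisms with the same range have isomorphic sources. -/
noncomputable def isoOfRange {P Q R : HBicomod k H C D} (f : P ⟶ R) (i : Q ⟶ R)
    (hf : Function.Injective f.lin) (hi : Function.Injective i.lin)
    (h : LinearMap.range f.lin = LinearMap.range i.lin) : P ≅ Q where
  hom := liftOfRange i hi f h.le
  inv := liftOfRange f hf i h.ge
  hom_inv_id := hom_ext fun x => hf
    ((liftOfRange_spec f hf i h.ge _).trans (liftOfRange_spec i hi f h.le x))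
  inv_hom_id := hom_ext fun x => hi
    ((liftOfRange_spec i hi f h.le _).trans (liftOfRange_spec f hf i h.ge x))

theorem isoOfRange_hom {P Q R : HBicomod k H C D} (f : P ⟶ R) (i : Q ⟶ R)
    (hf : Function.Injective f.lin) (hi : Function.Injective i.lin)
    (h : LinearMap.range f.lin = LinearMap.range i.lin) (x : P.carrier) :
    i.lin ((isoOfRange f i hf hi h).hom.lin x) = f.lin x :=
  liftOfRange_spec i hi f h.le x

/-- The inclusion of a subobject. -/
noncomputable def subHom (P : HBicomod k H C E) (K : Submodule k P.carrier)
    (ha : ∀ h, ∀ x ∈ K, P.act h x ∈ K)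
    (hl : ∀ x : K, (P.lcoact ∘ₗ K.subtype) x ∈ LinearMap.range (K.subtype.lTensor C))
    (hr : ∀ x : K, (P.rcoact ∘ₗ K.subtype) x ∈ LinearMap.range (K.subtype.rTensor E)) :
    P.sub K ha hl hr ⟶ P where
  lin := K.subtype
  comm_act _ := rfl
  lcomm := (LinearMap.ext (liftInj_spec _ _ _ hl)).symm
  rcomm := (LinearMap.ext (liftInj_spec _ _ _ hr)).symm

/-- The inclusion of the cotensor product into the tensor product. -/
noncomputable def incl (M : HBicomod k H C D) (N : HBicomod k H D E) : cotensor M N ⟶ ext M N :=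
  subHom _ _ _ _ _

theorem incl_injective (M : HBicomod k H C D) (N : HBicomod k H D E) :
    Function.Injective (incl M N).lin :=
  Submodule.subtype_injective _

theorem range_incl (M : HBicomod k H C D) (N : HBicomod k H D E) :
    LinearMap.range (incl M N).lin = LinearMap.ker (cotensorDiff M N) :=
  Submodule.range_subtype _

/-- The tensor product of two morphisms. -/
def extMap {M M' : HBicomod k H C D} {N N' : HBicomod k H D E} (f : M ⟶ M') (g : N ⟶ N') :
    ext M N ⟶ ext M' N' where
  lin := TensorProduct.map f.lin g.lin
  comm_act := diagAct_map f.comm_act g.comm_act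
  -- Each coaction of `ext` comes from one factor, the other counting only as an `H`-module, so the
  -- one-sided results apply on each side.
  lcomm := (HLComod.tensMap (M := M.left) (M' := M'.left) (X := N.toHMod) (X' := N'.toHMod)
    ⟨f.lin, f.lcomm, f.comm_act⟩ ⟨g.lin, g.comm_act⟩).comm
  rcomm := (HRComod.tensMap (M := N.right) (M' := N'.right) (X := M.toHMod) (X' := M'.toHMod)
    ⟨f.lin, f.comm_act⟩ ⟨g.lin, g.rcomm, g.comm_act⟩).comm

/-- The associativity morphism `M ⊗ (N ⊗ P) ⟶ (M ⊗ N) ⊗ P`. -/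
def extAssoc (M : HBicomod k H A C) (N : HBicomod k H C D) (P : HBicomod k H D E) :
    ext M (ext N P) ⟶ ext (ext M N) P where
  lin := (assoc k M.carrier N.carrier P.carrier).symm.toLinearMap
  comm_act := diagAct_assoc_symm M.act N.act P.act
  lcomm := (HLComod.tensAssoc M.left N.toHMod P.toHMod).hom.comm
  rcomm := (HRComod.tensAssoc M.toHMod N.toHMod P.right).inv.comm

/-- The associativity morphism `(M ⊗ N) ⊗ P ⟶ M ⊗ (N ⊗ P)`. -/
def extAssocSymm (M : HBicomod k H A C) (N : HBicomod k H C D) (P : HBicomod k H D E) :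
    ext (ext M N) P ⟶ ext M (ext N P) where
  lin := (assoc k M.carrier N.carrier P.carrier).toLinearMap
  comm_act := diagAct_assoc M.act N.act P.act
  lcomm := (HLComod.tensAssoc M.left N.toHMod P.toHMod).inv.comm
  rcomm := (HRComod.tensAssoc M.toHMod N.toHMod P.right).hom.comm

/-- The right coaction as a morphism of bicomodules. -/
def rcoactHom [ModuleCoalgebra k H D] (M : HBicomod k H C D) : M ⟶ ext M (regular k H D) where
  lin := M.rcoact
  comm_act := M.requivariant
  lcomm := M.bicomod
  rcomm := by
    refine LinearMap.ext fun x => ?_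
    have h := LinearMap.congr_fun M.rcoassoc x
    exact (LinearEquiv.symm_apply_eq (assoc k _ _ _)).2 h.symm

/-- The left coaction as a morphism of bicomodules. -/
def lcoactHom [ModuleCoalgebra k H C] (M : HBicomod k H C D) : M ⟶ ext (regular k H C) M where
  lin := M.lcoact
  comm_act := M.lequivariant
  lcomm := M.lcoassoc
  rcomm := by
    refine LinearMap.ext fun x => ?_
    have h := LinearMap.congr_fun M.bicomod x
    exact (LinearEquiv.symm_apply_eq (assoc k _ _ _)).2 h.symm

theorem rcoact_injective (M : HBicomod k H C D) : Function.Injective M.rcoact :=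
  Function.HasLeftInverse.injective ⟨fun x => rid k M.carrier
    ((CoalgebraStruct.counit (R := k) (A := D)).lTensor M.carrier x), LinearMap.congr_fun M.rcounit⟩

theorem lcoact_injective (M : HBicomod k H C D) : Function.Injective M.lcoact :=
  Function.HasLeftInverse.injective ⟨fun x => lid k M.carrier
    ((CoalgebraStruct.counit (R := k) (A := C)).rTensor M.carrier x), LinearMap.congr_fun M.lcounit⟩

/-- The composite inclusion `(Y □ M) □ N ⟶ (Y ⊗ M) ⊗ N`. -/
noncomputable def inclLeft (Y : HBicomod k H A C) (M : HBicomod k H C D) (N : HBicomod k H D E) :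
    cotensor (cotensor Y M) N ⟶ ext (ext Y M) N :=
  incl (cotensor Y M) N ≫ extMap (incl Y M) (𝟙 N)

/-- The composite inclusion `M □ (N □ Y) ⟶ M ⊗ (N ⊗ Y)`. -/
noncomputable def inclRight (M : HBicomod k H A C) (N : HBicomod k H C D) (Y : HBicomod k H D E) :
    cotensor M (cotensor N Y) ⟶ ext M (ext N Y) :=
  incl M (cotensor N Y) ≫ extMap (𝟙 M) (incl N Y)

theorem inclLeft_injective (Y : HBicomod k H A C) (M : HBicomod k H C D) (N : HBicomod k H D E) :
    Function.Injective (inclLeft Y M N).lin :=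
  (Module.Flat.rTensor_preserves_injective_linearMap (M := N.carrier) _
    (incl_injective Y M)).comp (incl_injective _ N)

theorem inclRight_injective (M : HBicomod k H A C) (N : HBicomod k H C D) (Y : HBicomod k H D E) :
    Function.Injective (inclRight M N Y).lin :=
  (Module.Flat.lTensor_preserves_injective_linearMap (M := M.carrier) _
    (incl_injective N Y)).comp (incl_injective M _)

/-- The right-hand side is also that of `range_toExtLeft`; the comparison of the two yields
`isoCotensorLeft`. -/
theorem range_inclLeft (Y : HBicomod k H A C) (M : HBicomod k H C D) (N : HBicomod k H D E) :
    LinearMap.range (inclLeft Y M N).lin =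
      LinearMap.ker ((coactionDiff Y.rcoact M.lcoact).rTensor N.carrier) ⊓
        LinearMap.ker (coactionDiff ((assoc k Y.carrier M.carrier D).symm.toLinearMap ∘ₗ
          M.rcoact.lTensor Y.carrier) N.lcoact) :=
  range_rTensor_comp_coactionDiff (j := (incl Y M).lin) (i := (incl _ N).lin)
    (incl_injective Y M) (range_incl Y M) (incl Y M).rcomm (range_incl _ N)

theorem range_inclRight (M : HBicomod k H A C) (N : HBicomod k H C D) (Y : HBicomod k H D E) :
    LinearMap.range (inclRight M N Y).lin =
      LinearMap.ker ((coactionDiff N.rcoact Y.lcoact).lTensor M.carrier) ⊓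
        LinearMap.ker (coactionDiff M.rcoact ((assoc k C N.carrier Y.carrier).toLinearMap ∘ₗ
          N.lcoact.rTensor Y.carrier)) :=
  range_lTensor_comp_coactionDiff (j := (incl N Y).lin) (i := (incl M _).lin)
    (incl_injective N Y) (range_incl N Y) (incl N Y).lcomm (range_incl M _)

section Invertible

variable [ModuleCoalgebra k H C] {M : HBicomod k H C D} {N : HBicomod k H D C}
  (ι : regular k H C ⟶ ext M N)

/-- The morphism `Y ⟶ (Y ⊗ M) ⊗ N`, `y ↦ y₍₀₎ ⊗ ι(y₍₁₎)`. -/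
def toExtLeft (Y : HBicomod k H A C) : Y ⟶ ext (ext Y M) N :=
  rcoactHom Y ≫ extMap (𝟙 Y) ι ≫ extAssoc Y M N

/-- The morphism `Y ⟶ M ⊗ (N ⊗ Y)`, `y ↦ ι(y₍₋₁₎) ⊗ y₍₀₎`. -/
def toExtRight (Y : HBicomod k H C E) : Y ⟶ ext M (ext N Y) :=
  lcoactHom Y ≫ extMap ι (𝟙 Y) ≫ extAssocSymm M N Y

variable {ι}

theorem toExtLeft_injective (hι : Function.Injective ι.lin) (Y : HBicomod k H A C) :
    Function.Injective (toExtLeft ι Y).lin :=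
  (assoc k Y.carrier M.carrier N.carrier).symm.injective.comp
    ((Module.Flat.lTensor_preserves_injective_linearMap (M := Y.carrier) _ hι).comp
      Y.rcoact_injective)

theorem toExtRight_injective (hι : Function.Injective ι.lin) (Y : HBicomod k H C E) :
    Function.Injective (toExtRight ι Y).lin :=
  (assoc k M.carrier N.carrier Y.carrier).injective.comp
    ((Module.Flat.rTensor_preserves_injective_linearMap (M := Y.carrier) _ hι).comp
      Y.lcoact_injective)

/-- The hypotheses say that `ι` presents `C` as `M □ N`, without mentioning an isomorphism with
`cotensor`. -/
theorem range_toExtLeft (hι : Function.Injective ι.lin)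
    (hr : LinearMap.range ι.lin = LinearMap.ker (cotensorDiff M N)) (Y : HBicomod k H A C) :
    LinearMap.range (toExtLeft ι Y).lin =
      LinearMap.ker ((coactionDiff Y.rcoact M.lcoact).rTensor N.carrier) ⊓
        LinearMap.ker (coactionDiff ((assoc k Y.carrier M.carrier D).symm.toLinearMap ∘ₗ
          M.rcoact.lTensor Y.carrier) N.lcoact) :=
  range_coact_of_range_eq (ι := (show C →ₗ[k] M.carrier ⊗[k] N.carrier from ι.lin)) Y.rcoassoc hι hr ι.lcomm

theorem range_toExtRight (hι : Function.Injective ι.lin)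
    (hr : LinearMap.range ι.lin = LinearMap.ker (cotensorDiff M N)) (Y : HBicomod k H C E) :
    LinearMap.range (toExtRight ι Y).lin =
      LinearMap.ker ((coactionDiff N.rcoact Y.lcoact).lTensor M.carrier) ⊓
        LinearMap.ker (coactionDiff M.rcoact ((assoc k D N.carrier Y.carrier).toLinearMap ∘ₗ
          N.lcoact.rTensor Y.carrier)) :=
  range_coact_of_range_eq_left (ι := (show C →ₗ[k] M.carrier ⊗[k] N.carrier from ι.lin)) Y.lcoassoc hι hr ι.rcomm

/-- The isomorphism `Y ≅ (Y □ M) □ N` if `M □ N ≅ C`. -/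
noncomputable def isoCotensorLeft (hι : Function.Injective ι.lin)
    (hr : LinearMap.range ι.lin = LinearMap.ker (cotensorDiff M N)) (Y : HBicomod k H A C) :
    Y ≅ cotensor (cotensor Y M) N :=
  isoOfRange (toExtLeft ι Y) (inclLeft Y M N) (toExtLeft_injective hι Y)
    (inclLeft_injective Y M N) ((range_toExtLeft hι hr Y).trans (range_inclLeft Y M N).symm)

/-- The isomorphism `Y ≅ M □ (N □ Y)` if `M □ N ≅ C`. -/
noncomputable def isoCotensorRight (hι : Function.Injective ι.lin)
    (hr : LinearMap.range ι.lin = LinearMap.ker (cotensorDiff M N)) (Y : HBicomod k H C E) :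
    Y ≅ cotensor M (cotensor N Y) :=
  isoOfRange (toExtRight ι Y) (inclRight M N Y) (toExtRight_injective hι Y)
    (inclRight_injective M N Y) ((range_toExtRight hι hr Y).trans (range_inclRight M N Y).symm)

/-- The isomorphism respects the two embeddings into `(Y ⊗ M) ⊗ N`. Naturality and compatibility
with the module structure will follow from this alone, as they can be checked in the ambient object.
-/
theorem inclLeft_isoCotensorLeft (hι : Function.Injective ι.lin)
    (hr : LinearMap.range ι.lin = LinearMap.ker (cotensorDiff M N)) (Y : HBicomod k H A C)
    (y : Y.carrier) :
    (inclLeft Y M N).lin ((isoCotensorLeft hι hr Y).hom.lin y) = (toExtLeft ι Y).lin y :=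
  isoOfRange_hom _ _ _ _ _ y

theorem inclRight_isoCotensorRight (hι : Function.Injective ι.lin)
    (hr : LinearMap.range ι.lin = LinearMap.ker (cotensorDiff M N)) (Y : HBicomod k H C E)
    (y : Y.carrier) :
    (inclRight M N Y).lin ((isoCotensorRight hι hr Y).hom.lin y) = (toExtRight ι Y).lin y :=
  isoOfRange_hom _ _ _ _ _ y

end Invertible

end HBicomod

end EqMT

namespace EqMT

/-! ### Subfunctors of lax module functors -/

section SubfunctorLinear

universe v₁ u₁ v₂ u₂ v₃ u₃ v₄ u₄

open Functor MonoidalLeftAction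

variable {T : Type u₁} [Category.{v₁} T] [MonoidalCategory T]
  {𝓐 : Type u₂} [Category.{v₂} 𝓐] [MonoidalLeftAction T 𝓐]
  {𝓑 : Type u₃} [Category.{v₃} 𝓑] [MonoidalLeftAction T 𝓑]
  {𝓒 : Type u₄} [Category.{v₄} 𝓒] [MonoidalLeftAction T 𝓒]

/-- The lax structure on a subfunctor of a lax module functor that is stable under the structure
morphisms. -/
@[reducible]
def LaxLeftLinear.ofMono {F E : 𝓐 ⥤ 𝓑} [E.LaxLeftLinear T] (i : F ⟶ E)
    (hi : ∀ A, Mono (i.app A)) (μ : ∀ (X : T) (A : 𝓐), X ⊙ₗ F.obj A ⟶ F.obj (X ⊙ₗ A))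
    (hμ : ∀ X A, μ X A ≫ i.app (X ⊙ₗ A) = X ⊴ₗ i.app A ≫ LaxLeftLinear.μₗ E X A) :
    F.LaxLeftLinear T where
  μₗ := μ
  μₗ_naturality_left {X Y} f A := by
    have := hi (Y ⊙ₗ A)
    -- As for the remaining axioms, the equation holds in `E` and is pulled back along the
    -- monomorphism `i`.
    rw [← cancel_mono (i.app _)]
    simp only [Category.assoc, hμ, i.naturality]
    rw [reassoc_of% hμ, ← action_exchange_assoc]
    simp
  μₗ_naturality_right X A B f := by
    have := hi (X ⊙ₗ B)
    rw [← cancel_mono (i.app _)]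
    simp only [Category.assoc, hμ, i.naturality]
    rw [reassoc_of% hμ, ← actionHomRight_comp_assoc, i.naturality]
    simp
  μₗ_associativity X Y A := by
    have := hi (X ⊙ₗ Y ⊙ₗ A)
    rw [← cancel_mono (i.app _)]
    simp only [Category.assoc, hμ, i.naturality]
    rw [reassoc_of% hμ, ← actionHomRight_comp_assoc, hμ]
    simp
  μₗ_unitality A := by
    have := hi A
    rw [← cancel_mono (i.app _)]
    simp only [Category.assoc, i.naturality]
    rw [reassoc_of% hμ]
    simp

/-- Compatibility may be tested after a componentwise monic module transformation. -/
theorem IsLeftModuleTrans.of_comp_mono {F G E : 𝓐 ⥤ 𝓑} [F.LaxLeftLinear T] [G.LaxLeftLinear T]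
    [E.LaxLeftLinear T] {β : F ⟶ G} {j : G ⟶ E} (hj : IsLeftModuleTrans T j)
    (hm : ∀ A, Mono (j.app A)) (h : IsLeftModuleTrans T (β ≫ j)) : IsLeftModuleTrans T β := by
  intro X A
  have := hm (X ⊙ₗ A)
  rw [← cancel_mono (j.app _)]
  have := h X A
  simp only [NatTrans.comp_app, actionHomRight_comp, Category.assoc] at this ⊢
  rw [this, hj]

theorem IsLeftModuleTrans.inv {F G : 𝓐 ⥤ 𝓑} [F.LaxLeftLinear T] [G.LaxLeftLinear T]
    {e : F ≅ G} (h : IsLeftModuleTrans T e.hom) : IsLeftModuleTrans T e.inv := by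
  intro X A
  have := h X A
  rw [← cancel_mono (e.hom.app _), Category.assoc, Category.assoc, this,
    ← actionHomRight_comp_assoc]
  simp

/-- Applied to two inclusions of subfunctors, this makes the inclusion of the composite subfunctor
into the composite ambient functor a module transformation. -/
theorem IsLeftModuleTrans.hcomp {F F' : 𝓐 ⥤ 𝓑} {G G' : 𝓑 ⥤ 𝓒} [F.LaxLeftLinear T]
    [F'.LaxLeftLinear T] [G.LaxLeftLinear T] [G'.LaxLeftLinear T] {α : F ⟶ F'} {β : G ⟶ G'}
    (hα : IsLeftModuleTrans T α) (hβ : IsLeftModuleTrans T β) : IsLeftModuleTrans T (α ◫ β) := by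
  intro X A
  have h1 := hα X A
  have h2 := hβ X (F.obj A)
  change (LaxLeftLinear.μₗ G _ _ ≫ G.map (LaxLeftLinear.μₗ F _ _)) ≫ _ = _ ≫
    LaxLeftLinear.μₗ G' _ _ ≫ G'.map (LaxLeftLinear.μₗ F' _ _)
  simp only [NatTrans.hcomp_app, Category.assoc, actionHomRight_comp]
  rw [LaxLeftLinear.μₗ_naturality_right_assoc, ← reassoc_of% h2, β.naturality_assoc,
    ← G'.map_comp, h1, G'.map_comp]

variable (T) in
/-- A family of subobjects of the values of a lax module functor that is stable under the values
of the functor on morphisms and under the structure morphisms. -/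
structure LaxSubfunctor (E : 𝓐 ⥤ 𝓑) [E.LaxLeftLinear T] where
  obj : 𝓐 → 𝓑
  ι (A : 𝓐) : obj A ⟶ E.obj A
  mono (A : 𝓐) : Mono (ι A)
  exists_map {A B : 𝓐} (f : A ⟶ B) : ∃ g : obj A ⟶ obj B, g ≫ ι B = ι A ≫ E.map f
  exists_lineator (X : T) (A : 𝓐) :
    ∃ g : X ⊙ₗ obj A ⟶ obj (X ⊙ₗ A), g ≫ ι (X ⊙ₗ A) = X ⊴ₗ ι A ≫ LaxLeftLinear.μₗ E X A

namespace LaxSubfunctor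

attribute [instance] LaxSubfunctor.mono

variable {E : 𝓐 ⥤ 𝓑} [E.LaxLeftLinear T] (S : LaxSubfunctor T E)

/-- The subfunctor of a family of subobjects. -/
noncomputable def functor : 𝓐 ⥤ 𝓑 where
  obj := S.obj
  -- Lifts along the monomorphisms `ι` are unique, so the choices are functorial.
  map f := (S.exists_map f).choose
  map_id A := by
    rw [← cancel_mono (S.ι A), (S.exists_map _).choose_spec]
    simp
  map_comp f g := by
    rw [← cancel_mono (S.ι _), (S.exists_map _).choose_spec, Category.assoc,
      (S.exists_map g).choose_spec, reassoc_of% (S.exists_map f).choose_spec, E.map_comp]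

/-- The inclusion of a subfunctor. -/
noncomputable def incl : S.functor ⟶ E where
  app := S.ι
  naturality _ _ f := (S.exists_map f).choose_spec

noncomputable instance : S.functor.LaxLeftLinear T :=
  LaxLeftLinear.ofMono S.incl S.mono (fun X A => (S.exists_lineator X A).choose)
    (fun X A => (S.exists_lineator X A).choose_spec)

theorem isLeftModuleTrans_incl : IsLeftModuleTrans T S.incl :=
  fun X A => (S.exists_lineator X A).choose_spec

/-- A module transformation `γ` from the identity to the ambient composite `E ⋙ E'` is given, and
each of its components is an isomorphism onto the subobject. Since the inclusion of the composite
subfunctor is monic, the isomorphisms inherit naturality and compatibility from `γ`. -/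
theorem exists_iso {E' : 𝓑 ⥤ 𝓐} [E'.LaxLeftLinear T] (S' : LaxSubfunctor T E')
    (hm : ∀ A, Mono (E'.map (S.ι A))) (γ : 𝟭 𝓐 ⟶ E ⋙ E') (hγ : IsLeftModuleTrans T γ)
    (hb : ∀ A, ∃ b : A ≅ S'.obj (S.obj A), b.hom ≫ S'.ι (S.obj A) ≫ E'.map (S.ι A) = γ.app A) :
    ∃ e : S.functor ⋙ S'.functor ≅ 𝟭 𝓐, IsLeftModuleTrans T e.hom := by
  choose b hb using hb
  let b (A : 𝓐) : (𝟭 𝓐).obj A ≅ (S.functor ⋙ S'.functor).obj A := b A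
  have hb (A : 𝓐) : (b A).hom ≫ (S.incl ◫ S'.incl).app A = γ.app A := hb A
  have hj : ∀ A, Mono ((S.incl ◫ S'.incl).app A) := fun A => by
    have := hm A
    exact mono_comp (S'.ι (S.obj A)) (E'.map (S.ι A))
  let β : 𝟭 𝓐 ≅ S.functor ⋙ S'.functor := NatIso.ofComponents b (fun {A B} f => by
    have := hj B
    rw [← cancel_mono ((S.incl ◫ S'.incl).app B), Category.assoc, Category.assoc,
      NatTrans.naturality]
    rw [reassoc_of% hb A, hb B, γ.naturality])
  have hβ : β.hom ≫ (S.incl ◫ S'.incl) = γ := by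
    ext A
    exact hb A
  refine ⟨β.symm, IsLeftModuleTrans.inv (IsLeftModuleTrans.of_comp_mono
    (S.isLeftModuleTrans_incl.hcomp S'.isLeftModuleTrans_incl) hj ?_)⟩
  rwa [hβ]

end LaxSubfunctor

end SubfunctorLinear

/-! ### Back from left modules over the opposite monoidal category to right modules -/

section Opposite

universe v₁ u₁ v₂ u₂ v₃ u₃

open Functor MonoidalLeftAction MonoidalRightAction

attribute [local instance] monoidalOppositeLeftAction

variable {T : Type u₁} [Category.{v₁} T] [MonoidalCategory T]
  {𝓐 : Type u₂} [Category.{v₂} 𝓐] [MonoidalRightAction T 𝓐]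
  {𝓑 : Type u₃} [Category.{v₃} 𝓑] [MonoidalRightAction T 𝓑]

/-- A lax left module functor over the opposite monoidal category is a lax right module
functor. -/
@[reducible]
def LaxRightLinear.ofLeft (F : 𝓐 ⥤ 𝓑) [F.LaxLeftLinear Tᴹᵒᵖ] : F.LaxRightLinear T where
  μᵣ A X := LaxLeftLinear.μₗ F (MonoidalOpposite.mop X) A
  μᵣ_naturality_right A _ _ f := LaxLeftLinear.μₗ_naturality_left F f.mop A
  μᵣ_naturality_left f X := LaxLeftLinear.μₗ_naturality_right F (MonoidalOpposite.mop X) f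
  μᵣ_associativity A X Y := LaxLeftLinear.μₗ_associativity F (MonoidalOpposite.mop Y)
    (MonoidalOpposite.mop X) A
  μᵣ_unitality A := LaxLeftLinear.μₗ_unitality (C := Tᴹᵒᵖ) F A

theorem RightModuleEquivalent.of_mop (h : LeftModuleEquivalent Tᴹᵒᵖ 𝓐 𝓑) :
    RightModuleEquivalent T 𝓐 𝓑 := by
  obtain ⟨F, G, _, _, η, ε, hη, hε⟩ := h
  exact ⟨F, G, LaxRightLinear.ofLeft F, LaxRightLinear.ofLeft G, η, ε,
    fun A X => hη (MonoidalOpposite.mop X) A, fun A X => hε (MonoidalOpposite.mop X) A⟩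

end Opposite

end EqMT

namespace EqMT

/-! ### One-sided comodules as bicomodules over the ground field; plain comodules as the case `H =
k` -/

section TrivialCoalgebra

/-- The ground field as a module coalgebra with the trivial action `h r = ε(h) r`. -/
def TrivialCoalgebra (k H : Type u) [Field k] [Ring H] [Bialgebra k H] : Type u := k

variable (k H : Type u) [Field k] [Ring H] [Bialgebra k H]

instance : AddCommGroup (TrivialCoalgebra k H) := inferInstanceAs (AddCommGroup k)

instance : Module k (TrivialCoalgebra k H) := inferInstanceAs (Module k k)

noncomputable instance : Coalgebra k (TrivialCoalgebra k H) := inferInstanceAs (Coalgebra k k)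

noncomputable instance : Module H (TrivialCoalgebra k H) :=
  Module.compHom k (Bialgebra.counitAlgHom k H).toRingHom

theorem TrivialCoalgebra.smul_def (h : H) (r : TrivialCoalgebra k H) :
    h • r = CoalgebraStruct.counit (R := k) h * (show k from r) := rfl

instance : IsScalarTower k H (TrivialCoalgebra k H) where
  smul_assoc r h x := by
    simp only [TrivialCoalgebra.smul_def, map_smul, smul_eq_mul]
    exact mul_assoc (show k from r) _ _

end TrivialCoalgebra

section ScalarAction

variable {k V W : Type u} [Field k] [AddCommGroup V] [Module k V] [AddCommGroup W] [Module k W]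

/-- Over the bialgebra `k` a diagonal action is just scalar multiplication. This allows results on
`H`-equivariant comodules to be applied, with `H = k`, to comodules without action. -/
theorem diagAct_lsmul (r : k) (t : V ⊗[k] W) :
    diagAct (H := k) (Algebra.lsmul k k V) (Algebra.lsmul k k W) r t = r • t := by
  refine indOn t (by simp) (fun v w => ?_) (fun _ _ hx hy => by
    simp only [map_add, smul_add, hx, hy])
  rw [diagAct_tmul, CommSemiring.comul_apply]
  simp [TensorProduct.smul_tmul']

/-- Needed to apply the bicomodule results over the bialgebra `k` to an arbitrary coalgebra. -/
instance {C : Type u} [AddCommGroup C] [Module k C] [Coalgebra k C] : ModuleCoalgebra k k C where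
  comul_smul r c := by
    rw [map_smul, CommSemiring.comul_apply]
    generalize comul (R := k) c = t
    refine indOn t (by simp) (fun v w => ?_) (fun _ _ hx hy => by
      simp only [map_add, smul_add, tmul_add, hx, hy])
    simp [actMap, TensorProduct.smul_tmul']
  counit_smul r c := by simp

variable {C D : Type u} [AddCommGroup C] [Module k C] [AddCommGroup D] [Module k D]

/-- The bicomodule axiom for the trivial left coaction `y ↦ 1 ⊗ y`. -/
theorem lid_symm_rTensor (f : W →ₗ[k] V ⊗[k] D) (y : W) :
    assoc k k V D ((lid k V).symm.toLinearMap.rTensor D (f y)) =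
      f.lTensor k ((lid k W).symm y) := by
  rw [TensorProduct.lid_symm_apply, LinearMap.lTensor_tmul]
  generalize f y = t
  refine indOn t (by simp) (fun _ _ => ?_)
    (fun _ _ hx hy => by simp only [map_add, tmul_add, hx, hy])
  simp

theorem rid_symm_lTensor (f : W →ₗ[k] C ⊗[k] V) (y : W) :
    assoc k C V k (f.rTensor k ((rid k W).symm y)) =
      (rid k V).symm.toLinearMap.lTensor C (f y) := by
  rw [TensorProduct.rid_symm_apply, LinearMap.rTensor_tmul]
  generalize f y = t
  refine indOn t (by simp) (fun _ _ => ?_)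
    (fun _ _ hx hy => by simp only [map_add, add_tmul, hx, hy])
  simp

/-- The two factors of the codomain are unrelated to `V`, so left and right coactions are both
covered. -/
theorem comp_lsmul (f : V →ₗ[k] W ⊗[k] D) (r : k) : f ∘ₗ Algebra.lsmul k k V r =
    diagAct (H := k) (Algebra.lsmul k k W) (Algebra.lsmul k k D) r ∘ₗ f :=
  LinearMap.ext fun x => (f.map_smul r x).trans (diagAct_lsmul r (f x)).symm

end ScalarAction

variable {k H C D : Type u} [Field k] [Ring H] [Bialgebra k H]
  [AddCommGroup C] [Module k C] [Coalgebra k C] [Module H C] [IsScalarTower k H C]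
  [AddCommGroup D] [Module k D] [Coalgebra k D] [Module H D] [IsScalarTower k H D]

/-- A right comodule in the category of `H`-modules as a bicomodule. -/
noncomputable def HRComod.toBicomod (Y : HRComod k H C) :
    HBicomod k H (TrivialCoalgebra k H) C where
  carrier := Y.carrier
  act := Y.act
  lcoact := (lid k Y.carrier).symm.toLinearMap
  rcoact := Y.coact
  lcoassoc := LinearMap.ext fun _ => rfl
  lcounit := LinearMap.ext fun y => (lid k Y.carrier).apply_symm_apply y
  rcoassoc := Y.coassoc
  rcounit := Y.counit
  bicomod := LinearMap.ext fun y => lid_symm_rTensor Y.coact y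
  lequivariant h := by
    refine LinearMap.ext fun y => (lid k Y.carrier).injective ?_
    have := LinearMap.congr_fun (diagAct_lid Y.act h) ((lid k Y.carrier).symm y)
    simp only [LinearMap.comp_apply, LinearEquiv.coe_coe, LinearEquiv.apply_symm_apply] at this
    exact ((lid k Y.carrier).apply_symm_apply _).trans this.symm
  requivariant := Y.equivariant

/-- A left comodule in the category of `H`-modules as a bicomodule. -/
noncomputable def HLComod.toBicomod (Y : HLComod k H C) :
    HBicomod k H C (TrivialCoalgebra k H) where
  carrier := Y.carrier
  act := Y.act
  lcoact := Y.coact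
  rcoact := (rid k Y.carrier).symm.toLinearMap
  lcoassoc := Y.coassoc
  lcounit := Y.counit
  rcoassoc := LinearMap.ext fun _ => rfl
  rcounit := LinearMap.ext fun y => (rid k Y.carrier).apply_symm_apply y
  bicomod := LinearMap.ext fun y => rid_symm_lTensor Y.coact y
  lequivariant := Y.equivariant
  requivariant h := by
    refine LinearMap.ext fun y => (rid k Y.carrier).injective ?_
    have := LinearMap.congr_fun (diagAct_rid Y.act h) ((rid k Y.carrier).symm y)
    simp only [LinearMap.comp_apply, LinearEquiv.coe_coe, LinearEquiv.apply_symm_apply] at this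
    exact ((rid k Y.carrier).apply_symm_apply _).trans this.symm

/-- A right comodule as a right comodule with the action of the ground field. -/
def RComod.toHRComod (Y : RComod k C) : HRComod k k C :=
  { Y with
    act := Algebra.lsmul k k Y.carrier
    equivariant := comp_lsmul Y.coact }

/-- A left comodule as a left comodule with the action of the ground field. -/
def LComod.toHLComod (Y : LComod k C) : HLComod k k C :=
  { Y with
    act := Algebra.lsmul k k Y.carrier
    equivariant := comp_lsmul Y.coact }

/-- The underlying bicomodule over the ground field. -/
def HBicomod.forgetAct (M : HBicomod k H C D) : HBicomod k k C D where
  carrier := M.carrier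
  act := Algebra.lsmul k k M.carrier
  lcoact := M.lcoact
  rcoact := M.rcoact
  lcoassoc := M.lcoassoc
  lcounit := M.lcounit
  rcoassoc := M.rcoassoc
  rcounit := M.rcounit
  bicomod := M.bicomod
  lequivariant := comp_lsmul M.lcoact
  requivariant := comp_lsmul M.rcoact

/-- A bicolinear map is a morphism of bicomodules over the ground field. -/
def HBicomod.homOfColinear {M N : HBicomod k k C D} (hM : M.act = Algebra.lsmul k k M.carrier)
    (hN : N.act = Algebra.lsmul k k N.carrier) (f : M.carrier →ₗ[k] N.carrier)
    (hl : N.lcoact ∘ₗ f = f.lTensor C ∘ₗ M.lcoact)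
    (hr : N.rcoact ∘ₗ f = f.rTensor D ∘ₗ M.rcoact) : M ⟶ N where
  lin := f
  comm_act h := by
    rw [hM, hN]
    exact LinearMap.ext fun x => f.map_smul h x
  lcomm := hl
  rcomm := hr

end EqMT

namespace EqMT

/-! ### Factoring morphisms through injective morphisms -/

section Lift

variable {k H C : Type u} [Field k] [Ring H] [Bialgebra k H]
  [AddCommGroup C] [Module k C] [Coalgebra k C] [Module H C] [IsScalarTower k H C]

theorem HRComod.mono_of_injective {P Q : HRComod k H C} (i : P ⟶ Q)
    (hi : Function.Injective i.lin) : Mono i :=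
  ⟨fun _ _ h => hom_ext fun x => hi (LinearMap.congr_fun (congrArg Hom.lin h) x)⟩

theorem HLComod.mono_of_injective {P Q : HLComod k H C} (i : P ⟶ Q)
    (hi : Function.Injective i.lin) : Mono i :=
  ⟨fun _ _ h => hom_ext fun x => hi (LinearMap.congr_fun (congrArg Hom.lin h) x)⟩

theorem RComod.mono_of_injective {P Q : RComod k C} (i : P ⟶ Q)
    (hi : Function.Injective i.lin) : Mono i :=
  ⟨fun _ _ h => hom_ext fun x => hi (LinearMap.congr_fun (congrArg Hom.lin h) x)⟩

theorem LComod.mono_of_injective {P Q : LComod k C} (i : P ⟶ Q)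
    (hi : Function.Injective i.lin) : Mono i :=
  ⟨fun _ _ h => hom_ext fun x => hi (LinearMap.congr_fun (congrArg Hom.lin h) x)⟩

theorem liftInj_comp {A B X : Type u} [AddCommGroup A] [Module k A] [AddCommGroup B] [Module k B]
    [AddCommGroup X] [Module k X] (g : A →ₗ[k] B) (hg : Function.Injective g) (f : X →ₗ[k] B)
    (h : ∀ x, f x ∈ LinearMap.range g) : g ∘ₗ liftInj g hg f h = f :=
  LinearMap.ext (liftInj_spec g hg f h)

/-- Colinearity of `g` can be tested after the injective map `i`, since `i ⊗ C` is again injective.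
-/
theorem rcolinear_of_comp {P Q R : Type u} [AddCommGroup P] [Module k P] [AddCommGroup Q]
    [Module k Q] [AddCommGroup R] [Module k R] {p : P →ₗ[k] P ⊗[k] C} {q : Q →ₗ[k] Q ⊗[k] C}
    {r : R →ₗ[k] R ⊗[k] C} {i : Q →ₗ[k] R} {g : P →ₗ[k] Q} (hi : Function.Injective i)
    (h : r ∘ₗ i = i.rTensor C ∘ₗ q) (hg : r ∘ₗ (i ∘ₗ g) = (i ∘ₗ g).rTensor C ∘ₗ p) :
    q ∘ₗ g = g.rTensor C ∘ₗ p := by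
  refine (LinearMap.cancel_left
    (Module.Flat.rTensor_preserves_injective_linearMap (M := C) _ hi)).1 ?_
  rw [← comp_assoc, ← h, comp_assoc, hg, ← comp_assoc, ← LinearMap.rTensor_comp]

theorem lcolinear_of_comp {P Q R : Type u} [AddCommGroup P] [Module k P] [AddCommGroup Q]
    [Module k Q] [AddCommGroup R] [Module k R] {p : P →ₗ[k] C ⊗[k] P} {q : Q →ₗ[k] C ⊗[k] Q}
    {r : R →ₗ[k] C ⊗[k] R} {i : Q →ₗ[k] R} {g : P →ₗ[k] Q} (hi : Function.Injective i)
    (h : r ∘ₗ i = i.lTensor C ∘ₗ q) (hg : r ∘ₗ (i ∘ₗ g) = (i ∘ₗ g).lTensor C ∘ₗ p) :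
    q ∘ₗ g = g.lTensor C ∘ₗ p := by
  refine (LinearMap.cancel_left
    (Module.Flat.lTensor_preserves_injective_linearMap (M := C) _ hi)).1 ?_
  rw [← comp_assoc, ← h, comp_assoc, hg, ← comp_assoc, ← LinearMap.lTensor_comp]

theorem linear_of_comp {P Q R : Type u} [AddCommGroup P] [Module k P] [AddCommGroup Q]
    [Module k Q] [AddCommGroup R] [Module k R] {p : P →ₗ[k] P} {q : Q →ₗ[k] Q}
    {r : R →ₗ[k] R} {i : Q →ₗ[k] R} {g : P →ₗ[k] Q} (hi : Function.Injective i)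
    (h : i ∘ₗ q = r ∘ₗ i) (hg : (i ∘ₗ g) ∘ₗ p = r ∘ₗ (i ∘ₗ g)) :
    g ∘ₗ p = q ∘ₗ g := by
  refine (LinearMap.cancel_left hi).1 ?_
  rw [← comp_assoc, hg, ← comp_assoc, ← h, comp_assoc]

/-- The linear factorization through an injective colinear map is unique and hence automatically
colinear. -/
theorem RComod.exists_lift {P Q R : RComod k C} (i : Q ⟶ R) (hi : Function.Injective i.lin)
    (f : P ⟶ R) (h : ∀ x, f.lin x ∈ LinearMap.range i.lin) : ∃ g : P ⟶ Q, g ≫ i = f :=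
  ⟨⟨liftInj i.lin hi f.lin h, rcolinear_of_comp hi i.comm (by rw [liftInj_comp, f.comm])⟩,
    Hom.ext (liftInj_comp i.lin hi f.lin h)⟩

theorem LComod.exists_lift {P Q R : LComod k C} (i : Q ⟶ R) (hi : Function.Injective i.lin)
    (f : P ⟶ R) (h : ∀ x, f.lin x ∈ LinearMap.range i.lin) : ∃ g : P ⟶ Q, g ≫ i = f :=
  ⟨⟨liftInj i.lin hi f.lin h, lcolinear_of_comp hi i.comm (by rw [liftInj_comp, f.comm])⟩,
    Hom.ext (liftInj_comp i.lin hi f.lin h)⟩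

theorem HRComod.exists_lift {P Q R : HRComod k H C} (i : Q ⟶ R) (hi : Function.Injective i.lin)
    (f : P ⟶ R) (h : ∀ x, f.lin x ∈ LinearMap.range i.lin) : ∃ g : P ⟶ Q, g ≫ i = f :=
  ⟨⟨liftInj i.lin hi f.lin h, rcolinear_of_comp hi i.comm (by rw [liftInj_comp, f.comm]),
    fun a => linear_of_comp hi (i.comm_act a) (by rw [liftInj_comp, f.comm_act])⟩,
    Hom.ext (liftInj_comp i.lin hi f.lin h)⟩

theorem HLComod.exists_lift {P Q R : HLComod k H C} (i : Q ⟶ R) (hi : Function.Injective i.lin)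
    (f : P ⟶ R) (h : ∀ x, f.lin x ∈ LinearMap.range i.lin) : ∃ g : P ⟶ Q, g ≫ i = f :=
  ⟨⟨liftInj i.lin hi f.lin h, lcolinear_of_comp hi i.comm (by rw [liftInj_comp, f.comm]),
    fun a => linear_of_comp hi (i.comm_act a) (by rw [liftInj_comp, f.comm_act])⟩,
    Hom.ext (liftInj_comp i.lin hi f.lin h)⟩

end Lift

end EqMT

namespace EqMT

/-! ### Compatibility of cotensor products with an extra tensor factor -/

section Kernel

variable {k D U V W P : Type u} [Field k] [AddCommGroup D] [Module k D] [AddCommGroup U]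
  [Module k U] [AddCommGroup V] [Module k V] [AddCommGroup W] [Module k W] [AddCommGroup P]
  [Module k P] {ρ : V →ₗ[k] V ⊗[k] D} {σ : W →ₗ[k] D ⊗[k] W} {i : P →ₗ[k] V ⊗[k] W}

/-- With `P = V □ W` this is `U ⊗ (V □ W) ⊆ (U ⊗ V) □ W`: the associativity constraint, as structure
morphism of `Y ↦ Y ⊗ M`, restricts to the cotensor products. -/
theorem coactionDiff_tensor_left_eq_zero (hi : ∀ x, coactionDiff ρ σ (i x) = 0) (x : U ⊗[k] P) :
    coactionDiff ((assoc k U V D).symm.toLinearMap ∘ₗ ρ.lTensor U) σ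
      ((assoc k U V W).symm (i.lTensor U x)) = 0 := by
  refine (map_eq_zero_iff _ (Module.Flat.rTensor_preserves_injective_linearMap (M := W) _
    (assoc k U V D).injective)).1 ((assoc k U (V ⊗[k] D) W).map_eq_zero_iff.1 ?_)
  rw [coactionDiff_tensor_left, LinearEquiv.apply_symm_apply, ← LinearMap.comp_apply,
    ← LinearMap.lTensor_comp,
    show coactionDiff ρ σ ∘ₗ i = 0 from LinearMap.ext hi]
  exact LinearMap.congr_fun (LinearMap.lTensor_zero U) x

theorem coactionDiff_tensor_right_eq_zero (hi : ∀ x, coactionDiff ρ σ (i x) = 0)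
    (x : P ⊗[k] U) : coactionDiff ρ ((assoc k D W U).toLinearMap ∘ₗ σ.rTensor U)
      (assoc k V W U (i.rTensor U x)) = 0 := by
  refine (assoc k (V ⊗[k] D) W U).symm.map_eq_zero_iff.1 ?_
  rw [coactionDiff_tensor_right, LinearEquiv.symm_apply_apply, ← LinearMap.comp_apply,
    ← LinearMap.rTensor_comp,
    show coactionDiff ρ σ ∘ₗ i = 0 from LinearMap.ext hi]
  exact LinearMap.congr_fun (LinearMap.rTensor_zero U) x

variable {U' C : Type u} [AddCommGroup U'] [Module k U'] [AddCommGroup C] [Module k C]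

/-- Naturality in `Y` of the embedding `y ↦ y₍₀₎ ⊗ ι(y₍₁₎)` of `Y` into `(Y ⊗ M) ⊗ N`. -/
theorem assoc_symm_lTensor_natural {ρ : U →ₗ[k] U ⊗[k] C} {ρ' : U' →ₗ[k] U' ⊗[k] C}
    {f : U →ₗ[k] U'} (hf : ρ' ∘ₗ f = f.rTensor C ∘ₗ ρ) (ι : C →ₗ[k] V ⊗[k] W) (y : U) :
    (assoc k U' V W).symm (ι.lTensor U' (ρ' (f y))) =
      TensorProduct.map (TensorProduct.map f LinearMap.id) LinearMap.id
        ((assoc k U V W).symm (ι.lTensor U (ρ y))) := by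
  rw [show ρ' (f y) = f.rTensor C (ρ y) from LinearMap.congr_fun hf y]
  generalize ρ y = t
  refine indOn t (by simp) (fun u c => ?_) (fun _ _ hx hy => by simp only [map_add, hx, hy])
  simp only [LinearMap.rTensor_tmul, LinearMap.lTensor_tmul]
  generalize ι c = s
  refine indOn s (by simp) (fun v w => ?_) (fun _ _ hx hy => by
    simp only [map_add, tmul_add, hx, hy])
  simp

theorem assoc_rTensor_natural {ρ : U →ₗ[k] C ⊗[k] U} {ρ' : U' →ₗ[k] C ⊗[k] U'}
    {f : U →ₗ[k] U'} (hf : ρ' ∘ₗ f = f.lTensor C ∘ₗ ρ) (ι : C →ₗ[k] V ⊗[k] W) (y : U) :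
    assoc k V W U' (ι.rTensor U' (ρ' (f y))) =
      TensorProduct.map LinearMap.id (TensorProduct.map LinearMap.id f)
        (assoc k V W U (ι.rTensor U (ρ y))) := by
  rw [show ρ' (f y) = f.lTensor C (ρ y) from LinearMap.congr_fun hf y]
  generalize ρ y = t
  refine indOn t (by simp) (fun c u => ?_) (fun _ _ hx hy => by simp only [map_add, hx, hy])
  simp only [LinearMap.rTensor_tmul, LinearMap.lTensor_tmul]
  generalize ι c = s
  refine indOn s (by simp) (fun v w => ?_) (fun _ _ hx hy => by
    simp only [map_add, add_tmul, hx, hy])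
  simp

/-- The same embedding respects the structure morphisms, because the coaction of `P ⊗ U` does not
touch `P`. -/
theorem assoc_symm_lTensor_tensor (ρ : U →ₗ[k] U ⊗[k] C) (ι : C →ₗ[k] V ⊗[k] W) (x : P) (y : U) :
    (assoc k (P ⊗[k] U) V W).symm (ι.lTensor (P ⊗[k] U) ((assoc k P U C).symm (x ⊗ₜ ρ y))) =
      (assoc k P U V).symm.toLinearMap.rTensor W ((assoc k P (U ⊗[k] V) W).symm
        (x ⊗ₜ (assoc k U V W).symm (ι.lTensor U (ρ y)))) := by
  generalize ρ y = t
  refine indOn t (by simp) (fun u c => ?_) (fun _ _ hx hy => by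
    simp only [map_add, tmul_add, hx, hy])
  simp only [TensorProduct.assoc_symm_tmul, LinearMap.lTensor_tmul]
  generalize ι c = s
  refine indOn s (by simp) (fun v w => ?_) (fun _ _ hx hy => by
    simp only [map_add, tmul_add, hx, hy])
  simp

theorem assoc_rTensor_tensor (ρ : U →ₗ[k] C ⊗[k] U) (ι : C →ₗ[k] V ⊗[k] W) (x : P) (y : U) :
    assoc k V W (U ⊗[k] P) (ι.rTensor (U ⊗[k] P) (assoc k C U P (ρ y ⊗ₜ x))) =
      (assoc k W U P).toLinearMap.lTensor V (assoc k V (W ⊗[k] U) P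
        (assoc k V W U (ι.rTensor U (ρ y)) ⊗ₜ x)) := by
  generalize ρ y = t
  refine indOn t (by simp) (fun c u => ?_) (fun _ _ hx hy => by
    simp only [map_add, add_tmul, hx, hy])
  simp only [TensorProduct.assoc_tmul, LinearMap.rTensor_tmul]
  generalize ι c = s
  refine indOn s (by simp) (fun v w => ?_) (fun _ _ hx hy => by
    simp only [map_add, add_tmul, hx, hy])
  simp

end Kernel

/-! ### From bicomodules to an equivalence of right comodules in `H`-modules -/

section CotensorFunctor

open Functor MonoidalLeftAction MonoidalRightAction

variable {k H C D : Type u} [Field k] [Ring H] [Bialgebra k H]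
  [AddCommGroup C] [Module k C] [Coalgebra k C] [Module H C] [IsScalarTower k H C]
  [AddCommGroup D] [Module k D] [Coalgebra k D] [Module H D] [IsScalarTower k H D]

/-- The underlying module. -/
def HRComod.toHMod (Y : HRComod k H C) : HMod k H where
  carrier := Y.carrier
  act := Y.act

/-- Extracts from `M □ N ≅ C` what is used of it: an embedding of `C` into `M ⊗ N` with image the
kernel. -/
theorem HBicomod.incl_of_iso [ModuleCoalgebra k H C] {M : HBicomod k H C D}
    {N : HBicomod k H D C} (κ : M.cotensor N ≅ HBicomod.regular k H C) :
    Function.Injective (κ.inv ≫ HBicomod.incl M N).lin ∧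
      LinearMap.range (κ.inv ≫ HBicomod.incl M N).lin = LinearMap.ker (cotensorDiff M N) := by
  have h1 (x) : κ.hom.lin (κ.inv.lin x) = x :=
    LinearMap.congr_fun (congrArg HBicomod.Hom.lin κ.inv_hom_id) x
  have h2 (x) : κ.inv.lin (κ.hom.lin x) = x :=
    LinearMap.congr_fun (congrArg HBicomod.Hom.lin κ.hom_inv_id) x
  refine ⟨(incl_injective M N).comp (Function.LeftInverse.injective h1), ?_⟩
  exact (LinearMap.range_comp_of_range_eq_top _ (LinearMap.range_eq_top.2
    (Function.RightInverse.surjective h2))).trans (range_incl M N)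

/-- The functor `Y ↦ Y ⊗ M`, where the coaction of `Y` is ignored. -/
def HRComod.tensorFunctor (M : HBicomod k H C D) : HRComod k H C ⥤ HRComod k H D where
  obj Y := tens Y.toHMod M.right
  map {Y Y'} f := tensMap (X := Y.toHMod) (X' := Y'.toHMod) ⟨f.lin, f.comm_act⟩ (𝟙 M.right)
  map_id _ := Hom.ext (TensorProduct.ext' fun _ _ => rfl)
  map_comp _ _ := Hom.ext (TensorProduct.ext' fun _ _ => rfl)

/-- The structure morphism is the constraint `X ⊗ (Y ⊗ M) ⟶ (X ⊗ Y) ⊗ M`. -/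
instance (M : HBicomod k H C D) : (HRComod.tensorFunctor M).LaxLeftLinear (HMod k H) where
  μₗ X Y := (HRComod.tensAssoc X Y.toHMod M.right).inv
  μₗ_naturality_left _ _ := HRComod.Hom.ext (TensorProduct.ext_threefold' fun _ _ _ => rfl)
  μₗ_naturality_right _ _ _ _ := HRComod.Hom.ext (TensorProduct.ext_threefold' fun _ _ _ => rfl)
  μₗ_associativity _ _ _ := HRComod.Hom.ext (TensorProduct.ext_fourfold' fun _ _ _ _ => rfl)
  μₗ_unitality _ := HRComod.Hom.ext (TensorProduct.ext_threefold' fun (r : k) y m =>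
    TensorProduct.smul_tmul' r y m)

/-- The cotensor products `Y □ M` as a subfunctor of `Y ↦ Y ⊗ M`. -/
noncomputable def HRComod.cotensorSubfunctor (M : HBicomod k H C D) :
    LaxSubfunctor (HMod k H) (HRComod.tensorFunctor M) where
  obj Y := (HBicomod.cotensor Y.toBicomod M).right
  ι Y := ⟨(HBicomod.incl Y.toBicomod M).lin, (HBicomod.incl Y.toBicomod M).rcomm,
    (HBicomod.incl Y.toBicomod M).comm_act⟩
  mono Y := mono_of_injective _ (HBicomod.incl_injective Y.toBicomod M)
  exists_map {A B} f := exists_lift _ (HBicomod.incl_injective B.toBicomod M) _ (by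
    intro x
    refine (HBicomod.range_incl B.toBicomod M).ge ?_
    refine (coactionDiff_map (σ := M.lcoact) f.comm (g := LinearMap.id) (by simp) x.1).trans ?_
    exact (congrArg _ x.2).trans (map_zero _))
  exists_lineator X A := exists_lift _ (HBicomod.incl_injective (X ⊙ₗ A).toBicomod M) _ (by
    intro x
    refine (HBicomod.range_incl (X ⊙ₗ A).toBicomod M).ge ?_
    exact coactionDiff_tensor_left_eq_zero (σ := M.lcoact) (i := (HBicomod.incl A.toBicomod M).lin)
      (fun y => y.2) x)

/-- The natural transformation `Y ⟶ (Y ⊗ M) ⊗ N` given by a morphism `C ⟶ M ⊗ N`. -/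
noncomputable def HRComod.toTensorFunctor [ModuleCoalgebra k H C] {M : HBicomod k H C D}
    {N : HBicomod k H D C} (ι : HBicomod.regular k H C ⟶ HBicomod.ext M N) :
    𝟭 _ ⟶ tensorFunctor M ⋙ tensorFunctor N where
  app Y := ⟨(HBicomod.toExtLeft ι Y.toBicomod).lin, (HBicomod.toExtLeft ι Y.toBicomod).rcomm,
    (HBicomod.toExtLeft ι Y.toBicomod).comm_act⟩
  naturality _ _ f := hom_ext fun y => assoc_symm_lTensor_natural f.comm
    (show C →ₗ[k] M.carrier ⊗[k] N.carrier from ι.lin) y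

theorem HRComod.isLeftModuleTrans_toTensorFunctor [ModuleCoalgebra k H C] {M : HBicomod k H C D}
    {N : HBicomod k H D C} (ι : HBicomod.regular k H C ⟶ HBicomod.ext M N) :
    IsLeftModuleTrans (HMod k H) (toTensorFunctor ι) := fun _ A =>
  Hom.ext (TensorProduct.ext' fun x y => assoc_symm_lTensor_tensor A.coact
    (show C →ₗ[k] M.carrier ⊗[k] N.carrier from ι.lin) x y)

/-- Only `M □ N ≅ C` is needed for this composite; the other composite comes from the second
isomorphism by exchanging the roles of `M` and `N`. -/
theorem HRComod.exists_cotensor_iso [ModuleCoalgebra k H C] {M : HBicomod k H C D}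
    {N : HBicomod k H D C} (κ : M.cotensor N ≅ HBicomod.regular k H C) :
    ∃ e : (cotensorSubfunctor M).functor ⋙ (cotensorSubfunctor N).functor ≅ 𝟭 _,
      IsLeftModuleTrans (HMod k H) e.hom := by
  let ι := κ.inv ≫ HBicomod.incl M N
  obtain ⟨hι, hr⟩ := HBicomod.incl_of_iso κ
  refine LaxSubfunctor.exists_iso _ _ (fun A => mono_of_injective _ ?_) (toTensorFunctor ι)
    (isLeftModuleTrans_toTensorFunctor ι) (fun A => ?_)
  -- The tensor functor sends the inclusion `Y □ M ⊆ Y ⊗ M` to its tensor product with the identity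
  -- of `N`, still injective by flatness.
  · have h := Module.Flat.rTensor_preserves_injective_linearMap (M := N.carrier) _
      (HBicomod.incl_injective A.toBicomod M)
    exact h
  · let b := HBicomod.isoCotensorLeft hι hr A.toBicomod
    refine ⟨⟨⟨b.hom.lin, b.hom.rcomm, b.hom.comm_act⟩, ⟨b.inv.lin, b.inv.rcomm, b.inv.comm_act⟩,
      hom_ext fun y => LinearMap.congr_fun (congrArg HBicomod.Hom.lin b.hom_inv_id) y,
      hom_ext fun y => LinearMap.congr_fun (congrArg HBicomod.Hom.lin b.inv_hom_id) y⟩, ?_⟩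
    exact hom_ext fun y => HBicomod.inclLeft_isoCotensorLeft hι hr A.toBicomod y

theorem HRComod.leftModuleEquivalent [ModuleCoalgebra k H C] [ModuleCoalgebra k H D]
    {M : HBicomod k H C D} {N : HBicomod k H D C} (κ : M.cotensor N ≅ HBicomod.regular k H C)
    (κ' : N.cotensor M ≅ HBicomod.regular k H D) :
    LeftModuleEquivalent (HMod k H) (HRComod k H C) (HRComod k H D) := by
  obtain ⟨η, hη⟩ := exists_cotensor_iso κ
  obtain ⟨ε, hε⟩ := exists_cotensor_iso κ'
  exact ⟨_, _, _, _, η, ε, hη, hε⟩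

end CotensorFunctor
end EqMT

namespace EqMT

/-! ### From bicomodules to an equivalence of left comodules in `H`-modules -/

section CotensorFunctor

open Functor MonoidalLeftAction MonoidalRightAction

attribute [local instance] monoidalOppositeLeftAction

variable {k H C D : Type u} [Field k] [Ring H] [Bialgebra k H]
  [AddCommGroup C] [Module k C] [Coalgebra k C] [Module H C] [IsScalarTower k H C]
  [AddCommGroup D] [Module k D] [Coalgebra k D] [Module H D] [IsScalarTower k H D]

/-- The underlying module. -/
def HLComod.toHMod (Y : HLComod k H C) : HMod k H where
  carrier := Y.carrier
  act := Y.act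

/-- The functor `Y ↦ N ⊗ Y`, where the coaction of `Y` is ignored. -/
def HLComod.tensorFunctor (N : HBicomod k H D C) : HLComod k H C ⥤ HLComod k H D where
  obj Y := tens N.left Y.toHMod
  map {Y Y'} f := tensMap (X := Y.toHMod) (X' := Y'.toHMod) (𝟙 N.left) ⟨f.lin, f.comm_act⟩
  map_id _ := Hom.ext (TensorProduct.ext' fun _ _ => rfl)
  map_comp _ _ := Hom.ext (TensorProduct.ext' fun _ _ => rfl)

/-- The acting module stands on the right, `(N ⊗ Y) ⊗ X`, so the constraint again serves, now over
the opposite monoidal category. -/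
instance (N : HBicomod k H D C) : (HLComod.tensorFunctor N).LaxLeftLinear (HMod k H)ᴹᵒᵖ where
  μₗ X Y := (HLComod.tensAssoc N.left Y.toHMod X.unmop).inv
  μₗ_naturality_left _ _ := HLComod.Hom.ext (ext_threefold fun _ _ _ => rfl)
  μₗ_naturality_right _ _ _ _ := HLComod.Hom.ext (ext_threefold fun _ _ _ => rfl)
  μₗ_associativity _ _ _ := HLComod.Hom.ext (TensorProduct.ext_fourfold' fun _ _ _ _ => rfl)
  μₗ_unitality _ := HLComod.Hom.ext (ext_threefold fun n y (r : k) =>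
    (TensorProduct.tmul_smul r n y).symm)

/-- The cotensor products `N □ Y` as a subfunctor of `Y ↦ N ⊗ Y`. -/
noncomputable def HLComod.cotensorSubfunctor (N : HBicomod k H D C) :
    LaxSubfunctor (HMod k H)ᴹᵒᵖ (HLComod.tensorFunctor N) where
  obj Y := (HBicomod.cotensor N Y.toBicomod).left
  ι Y := ⟨(HBicomod.incl N Y.toBicomod).lin, (HBicomod.incl N Y.toBicomod).lcomm,
    (HBicomod.incl N Y.toBicomod).comm_act⟩
  mono Y := mono_of_injective _ (HBicomod.incl_injective N Y.toBicomod)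
  exists_map {A B} f := exists_lift _ (HBicomod.incl_injective N B.toBicomod) _ (by
    intro x
    refine (HBicomod.range_incl N B.toBicomod).ge ?_
    refine (coactionDiff_map (ρ := N.rcoact) (f := LinearMap.id) (by simp) f.comm x.1).trans ?_
    exact (congrArg _ x.2).trans (map_zero _))
  exists_lineator X A := exists_lift _
    (HBicomod.incl_injective N (HLComod.tens A X.unmop).toBicomod) _ (by
    intro x
    refine (HBicomod.range_incl N (HLComod.tens A X.unmop).toBicomod).ge ?_
    exact coactionDiff_tensor_right_eq_zero (ρ := N.rcoact)
      (i := (HBicomod.incl N A.toBicomod).lin) (fun y => y.2) x)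

/-- The natural transformation `Y ⟶ M ⊗ (N ⊗ Y)` given by a morphism `C ⟶ M ⊗ N`. -/
noncomputable def HLComod.toTensorFunctor [ModuleCoalgebra k H C] {M : HBicomod k H C D}
    {N : HBicomod k H D C} (ι : HBicomod.regular k H C ⟶ HBicomod.ext M N) :
    𝟭 _ ⟶ tensorFunctor N ⋙ tensorFunctor M where
  app Y := ⟨(HBicomod.toExtRight ι Y.toBicomod).lin, (HBicomod.toExtRight ι Y.toBicomod).lcomm,
    (HBicomod.toExtRight ι Y.toBicomod).comm_act⟩
  naturality _ _ f := hom_ext fun y => assoc_rTensor_natural f.comm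
    (show C →ₗ[k] M.carrier ⊗[k] N.carrier from ι.lin) y

theorem HLComod.isLeftModuleTrans_toTensorFunctor [ModuleCoalgebra k H C] {M : HBicomod k H C D}
    {N : HBicomod k H D C} (ι : HBicomod.regular k H C ⟶ HBicomod.ext M N) :
    IsLeftModuleTrans (HMod k H)ᴹᵒᵖ (toTensorFunctor ι) := fun _ A =>
  Hom.ext (TensorProduct.ext' fun y x => assoc_rTensor_tensor A.coact
    (show C →ₗ[k] M.carrier ⊗[k] N.carrier from ι.lin) x y)

theorem HLComod.exists_cotensor_iso [ModuleCoalgebra k H C] {M : HBicomod k H C D}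
    {N : HBicomod k H D C} (κ : M.cotensor N ≅ HBicomod.regular k H C) :
    ∃ e : (cotensorSubfunctor N).functor ⋙ (cotensorSubfunctor M).functor ≅ 𝟭 _,
      IsLeftModuleTrans (HMod k H)ᴹᵒᵖ e.hom := by
  let ι := κ.inv ≫ HBicomod.incl M N
  obtain ⟨hι, hr⟩ := HBicomod.incl_of_iso κ
  refine LaxSubfunctor.exists_iso _ _ (fun A => mono_of_injective _ ?_) (toTensorFunctor ι)
    (isLeftModuleTrans_toTensorFunctor ι) (fun A => ?_)
  · have h := Module.Flat.lTensor_preserves_injective_linearMap (M := M.carrier) _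
      (HBicomod.incl_injective N A.toBicomod)
    exact h
  · let b := HBicomod.isoCotensorRight hι hr A.toBicomod
    refine ⟨⟨⟨b.hom.lin, b.hom.lcomm, b.hom.comm_act⟩, ⟨b.inv.lin, b.inv.lcomm, b.inv.comm_act⟩,
      hom_ext fun y => LinearMap.congr_fun (congrArg HBicomod.Hom.lin b.hom_inv_id) y,
      hom_ext fun y => LinearMap.congr_fun (congrArg HBicomod.Hom.lin b.inv_hom_id) y⟩, ?_⟩
    exact hom_ext fun y => HBicomod.inclRight_isoCotensorRight hι hr A.toBicomod y

theorem HLComod.rightModuleEquivalent [ModuleCoalgebra k H C] [ModuleCoalgebra k H D]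
    {M : HBicomod k H C D} {N : HBicomod k H D C} (κ : M.cotensor N ≅ HBicomod.regular k H C)
    (κ' : N.cotensor M ≅ HBicomod.regular k H D) :
    RightModuleEquivalent (HMod k H) (HLComod k H C) (HLComod k H D) := by
  obtain ⟨η, hη⟩ := exists_cotensor_iso κ
  obtain ⟨ε, hε⟩ := exists_cotensor_iso κ'
  exact RightModuleEquivalent.of_mop ⟨_, _, _, _, η, ε, hη, hε⟩

end CotensorFunctor

end EqMT

namespace EqMT

/-! ### The maps `(x ⊗ h) ⊗ (v ⊗ p) ↦ (x ⊗ v) ⊗ h p`, source of the structure morphisms over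
`H`-comodules -/

section MulAct

variable {k H : Type u} [Field k] [Ring H] [Bialgebra k H]
  {X X' V V' P Q R : Type u} [AddCommGroup X] [Module k X] [AddCommGroup X'] [Module k X']
  [AddCommGroup V] [Module k V] [AddCommGroup V'] [Module k V'] [AddCommGroup P] [Module k P]
  [AddCommGroup Q] [Module k Q] [AddCommGroup R] [Module k R]

section Def

/-- The map `(x ⊗ h) ⊗ (v ⊗ p) ↦ (x ⊗ v) ⊗ h p`. -/
def mulAct (φ : H →ₐ[k] Module.End k P) (X V : Type u) [AddCommGroup X] [Module k X]
    [AddCommGroup V] [Module k V] :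
     (X ⊗[k] H) ⊗[k] (V ⊗[k] P) →ₗ[k] (X ⊗[k] V) ⊗[k] P :=
  (actMap φ).lTensor (X ⊗[k] V) ∘ₗ (tensorTensorTensorComm k X H V P).toLinearMap

/-- The map `(h ⊗ x) ⊗ (p ⊗ v) ↦ h p ⊗ (x ⊗ v)`. -/
def mulActL (φ : H →ₐ[k] Module.End k P) (X V : Type u) [AddCommGroup X] [Module k X]
    [AddCommGroup V] [Module k V] :
     (H ⊗[k] X) ⊗[k] (P ⊗[k] V) →ₗ[k] P ⊗[k] (X ⊗[k] V) :=
  (actMap φ).rTensor (X ⊗[k] V) ∘ₗ (tensorTensorTensorComm k H X P V).toLinearMap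

variable (φ : H →ₐ[k] Module.End k P)

@[simp]
theorem mulAct_tmul (x : X) (h : H) (v : V) (p : P) :
    mulAct φ X V ((x ⊗ₜ h) ⊗ₜ (v ⊗ₜ p)) = (x ⊗ₜ v) ⊗ₜ φ h p := rfl

@[simp]
theorem mulActL_tmul (x : X) (h : H) (v : V) (p : P) :
    mulActL φ X V ((h ⊗ₜ x) ⊗ₜ (p ⊗ₜ v)) = φ h p ⊗ₜ (x ⊗ₜ v) := rfl

end Def

variable (φ : H →ₐ[k] Module.End k P) (ψ : H →ₐ[k] Module.End k Q) (χ : H →ₐ[k] Module.End k R)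

theorem mulAct_map (f : X →ₗ[k] X') (g : V →ₗ[k] V') (t : X ⊗[k] H) (s : V ⊗[k] P) :
    mulAct φ X' V' (f.rTensor H t ⊗ₜ TensorProduct.map g LinearMap.id s) =
      TensorProduct.map (TensorProduct.map f g) LinearMap.id (mulAct φ X V (t ⊗ₜ s)) := by
  refine indOn t (by simp) (fun x h => ?_)
    (fun _ _ hx hy => by simp only [add_tmul, map_add, hx, hy])
  refine indOn s (by simp) (fun v p => ?_)
    (fun _ _ hx hy => by simp only [tmul_add, map_add, hx, hy])
  simp

theorem mulActL_map (f : X →ₗ[k] X') (g : V →ₗ[k] V') (t : H ⊗[k] X) (s : P ⊗[k] V) :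
    mulActL φ X' V' (f.lTensor H t ⊗ₜ TensorProduct.map LinearMap.id g s) =
      TensorProduct.map LinearMap.id (TensorProduct.map f g) (mulActL φ X V (t ⊗ₜ s)) := by
  refine indOn t (by simp) (fun h x => ?_)
    (fun _ _ hx hy => by simp only [add_tmul, map_add, hx, hy])
  refine indOn s (by simp) (fun v p => ?_)
    (fun _ _ hx hy => by simp only [tmul_add, map_add, hx, hy])
  simp

/-- Multiplicativity of the action gives the associativity axiom of the structure morphism. -/
theorem mulAct_mulAct (t : X ⊗[k] H) (s : X' ⊗[k] H) (r : V ⊗[k] P) :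
    TensorProduct.map (assoc k X X' V).toLinearMap LinearMap.id (mulAct φ (X ⊗[k] X') V
      (mulCoact k H H X X' (t ⊗ₜ s) ⊗ₜ r)) =
      mulAct φ X (X' ⊗[k] V) (t ⊗ₜ mulAct φ X' V (s ⊗ₜ r)) := by
  refine indOn t (by simp) (fun x h => ?_)
    (fun _ _ hx hy => by simp only [add_tmul, map_add, hx, hy])
  refine indOn s (by simp) (fun y h => ?_)
    (fun _ _ hx hy => by simp only [add_tmul, tmul_add, map_add, hx, hy])
  refine indOn r (by simp) (fun m c => ?_)
    (fun _ _ hx hy => by simp only [tmul_add, map_add, hx, hy])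
  simp

theorem mulActL_mulActL (t : H ⊗[k] X) (s : H ⊗[k] X') (r : P ⊗[k] V) :
    TensorProduct.map LinearMap.id (assoc k X X' V).toLinearMap (mulActL φ (X ⊗[k] X') V
      (mulCoactL k H H X X' (t ⊗ₜ s) ⊗ₜ r)) =
      mulActL φ X (X' ⊗[k] V) (t ⊗ₜ mulActL φ X' V (s ⊗ₜ r)) := by
  refine indOn t (by simp) (fun x h => ?_)
    (fun _ _ hx hy => by simp only [add_tmul, map_add, hx, hy])
  refine indOn s (by simp) (fun y h => ?_)
    (fun _ _ hx hy => by simp only [add_tmul, tmul_add, map_add, hx, hy])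
  refine indOn r (by simp) (fun m c => ?_)
    (fun _ _ hx hy => by simp only [tmul_add, map_add, hx, hy])
  simp

theorem mulAct_unit (r : k) (s : V ⊗[k] P) : TensorProduct.map (lid k V).toLinearMap LinearMap.id
    (mulAct φ k V (LinearMap.toSpanSingleton k (k ⊗[k] H) (1 ⊗ₜ 1) r ⊗ₜ s)) = r • s := by
  refine indOn s (by simp) (fun v p => ?_)
    (fun _ _ hx hy => by simp only [tmul_add, map_add, hx, hy, smul_add])
  simp [TensorProduct.smul_tmul']

theorem mulActL_unit (r : k) (s : P ⊗[k] V) : TensorProduct.map LinearMap.id (lid k V).toLinearMap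
    (mulActL φ k V (LinearMap.toSpanSingleton k (H ⊗[k] k) (1 ⊗ₜ 1) r ⊗ₜ s)) = r • s := by
  refine indOn s (by simp) (fun v p => ?_)
    (fun _ _ hx hy => by simp only [tmul_add, map_add, hx, hy, smul_add])
  simp [TensorProduct.smul_tmul']

/-- The map `((x ⊗ h) ⊗ h') ⊗ ((v ⊗ p) ⊗ q) ↦ ((x ⊗ v) ⊗ h p) ⊗ h' q`. -/
def mulActTwo : ((X ⊗[k] H) ⊗[k] H) ⊗[k] ((V ⊗[k] P) ⊗[k] Q) →ₗ[k]
    ((X ⊗[k] V) ⊗[k] P) ⊗[k] Q :=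
  (mulAct φ X V).rTensor Q ∘ₗ mulAct ψ (X ⊗[k] H) (V ⊗[k] P)

/-- The map `(h ⊗ (h' ⊗ x)) ⊗ (p ⊗ (q ⊗ v)) ↦ h p ⊗ (h' q ⊗ (x ⊗ v))`. -/
def mulActTwoL : (H ⊗[k] (H ⊗[k] X)) ⊗[k] (P ⊗[k] (Q ⊗[k] V)) →ₗ[k]
    P ⊗[k] (Q ⊗[k] (X ⊗[k] V)) :=
  (mulActL ψ X V).lTensor P ∘ₗ mulActL φ (H ⊗[k] X) (Q ⊗[k] V)

variable {φ ψ χ}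

/-- An equivariant `σ` splits `h r` as `h₍₁₎ p ⊗ h₍₂₎ q`. No coaction on `X` is involved yet. -/
theorem mulAct_equivariant {σ : R →ₗ[k] P ⊗[k] Q} (hσ : ∀ h, σ ∘ₗ χ h = diagAct φ ψ h ∘ₗ σ)
    (t : X ⊗[k] H) (s : V ⊗[k] R) :
    (assoc k (X ⊗[k] V) P Q).symm (σ.lTensor (X ⊗[k] V) (mulAct χ X V (t ⊗ₜ s))) =
      mulActTwo φ ψ ((assoc k X H H).symm (comul.lTensor X t) ⊗ₜ
        (assoc k V P Q).symm (σ.lTensor V s)) := by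
  refine indOn t (by simp) (fun x h => ?_)
    (fun _ _ hx hy => by simp only [add_tmul, map_add, hx, hy])
  refine indOn s (by simp) (fun v r => ?_)
    (fun _ _ hx hy => by simp only [tmul_add, map_add, hx, hy])
  have hh := LinearMap.congr_fun (hσ h) r
  simp only [LinearMap.comp_apply] at hh
  simp only [mulAct_tmul, LinearMap.lTensor_tmul, hh]
  generalize σ r = w
  refine indOn w (by simp) (fun p q => ?_)
    (fun _ _ hx hy => by simp only [tmul_add, map_add, hx, hy])
  rw [diagAct_tmul]
  generalize comul (R := k) h = u
  refine indOn u (by simp) (fun a b => ?_)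
    (fun _ _ hx hy => by simp only [add_tmul, tmul_add, map_add, hx, hy])
  simp [mulActTwo]

theorem mulActL_equivariant {σ : R →ₗ[k] P ⊗[k] Q} (hσ : ∀ h, σ ∘ₗ χ h = diagAct φ ψ h ∘ₗ σ)
    (t : H ⊗[k] X) (s : R ⊗[k] V) :
    assoc k P Q (X ⊗[k] V) (σ.rTensor (X ⊗[k] V) (mulActL χ X V (t ⊗ₜ s))) =
      mulActTwoL φ ψ (assoc k H H X (comul.rTensor X t) ⊗ₜ
        assoc k P Q V (σ.rTensor V s)) := by
  refine indOn t (by simp) (fun h x => ?_)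
    (fun _ _ hx hy => by simp only [add_tmul, map_add, hx, hy])
  refine indOn s (by simp) (fun r v => ?_)
    (fun _ _ hx hy => by simp only [tmul_add, map_add, hx, hy])
  have hh := LinearMap.congr_fun (hσ h) r
  simp only [LinearMap.comp_apply] at hh
  simp only [mulActL_tmul, LinearMap.rTensor_tmul, hh]
  generalize σ r = w
  refine indOn w (by simp) (fun p q => ?_)
    (fun _ _ hx hy => by simp only [add_tmul, tmul_add, map_add, hx, hy])
  rw [diagAct_tmul]
  generalize comul (R := k) h = u
  refine indOn u (by simp) (fun a b => ?_)
    (fun _ _ hx hy => by simp only [add_tmul, map_add, hx, hy])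
  simp [mulActTwoL]

theorem mulActTwo_rTensor (ρ : X →ₗ[k] X ⊗[k] H) (t : X ⊗[k] H) (u : (V ⊗[k] P) ⊗[k] Q) :
    mulActTwo φ ψ (ρ.rTensor H t ⊗ₜ u) =
      (mulAct φ X V ∘ₗ ρ.rTensor (V ⊗[k] P)).rTensor Q (mulAct ψ X (V ⊗[k] P) (t ⊗ₜ u)) := by
  refine indOn t (by simp) (fun x h => ?_)
    (fun _ _ hx hy => by simp only [add_tmul, map_add, hx, hy])
  refine indOn u (by simp) (fun v r => ?_)
    (fun _ _ hx hy => by simp only [tmul_add, map_add, hx, hy])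
  simp [mulActTwo]

theorem mulActTwoL_lTensor (ρ : X →ₗ[k] H ⊗[k] X) (t : H ⊗[k] X) (u : P ⊗[k] (Q ⊗[k] V)) :
    mulActTwoL φ ψ (ρ.lTensor H t ⊗ₜ u) =
      (mulActL ψ X V ∘ₗ ρ.rTensor (Q ⊗[k] V)).lTensor P (mulActL φ X (Q ⊗[k] V) (t ⊗ₜ u)) := by
  refine indOn t (by simp) (fun x h => ?_)
    (fun _ _ hx hy => by simp only [add_tmul, map_add, hx, hy])
  refine indOn u (by simp) (fun v r => ?_)
    (fun _ _ hx hy => by simp only [tmul_add, map_add, hx, hy])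
  simp [mulActTwoL]

/-- Coassociativity of `ρ` allows the two halves of `x₍₁₎` to be produced by coacting twice. This
identity is used for three choices of `σ`. The right coaction of `M` gives colinearity of the
structure morphism, the left coaction its stability on cotensor products, and `ι` the compatibility
of `Y ⟶ (Y ⊗ M) ⊗ N`. -/
theorem mulAct_rTensor_equivariant {σ : R →ₗ[k] P ⊗[k] Q}
    (hσ : ∀ h, σ ∘ₗ χ h = diagAct φ ψ h ∘ₗ σ) {ρ : X →ₗ[k] X ⊗[k] H}
    (hρ : (assoc k X H H).toLinearMap ∘ₗ ρ.rTensor H ∘ₗ ρ = comul.lTensor X ∘ₗ ρ)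
    (x : X) (s : V ⊗[k] R) :
    (assoc k (X ⊗[k] V) P Q).symm (σ.lTensor (X ⊗[k] V) (mulAct χ X V (ρ x ⊗ₜ s))) =
      (mulAct φ X V ∘ₗ ρ.rTensor (V ⊗[k] P)).rTensor Q (mulAct ψ X (V ⊗[k] P)
        (ρ x ⊗ₜ (assoc k V P Q).symm (σ.lTensor V s))) := by
  rw [mulAct_equivariant hσ, ← mulActTwo_rTensor]
  congr 2
  exact ((LinearEquiv.eq_symm_apply _).2 (LinearMap.congr_fun hρ x)).symm

theorem mulActL_lTensor_equivariant {σ : R →ₗ[k] P ⊗[k] Q}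
    (hσ : ∀ h, σ ∘ₗ χ h = diagAct φ ψ h ∘ₗ σ) {ρ : X →ₗ[k] H ⊗[k] X}
    (hρ : (assoc k H H X).toLinearMap ∘ₗ comul.rTensor X ∘ₗ ρ = ρ.lTensor H ∘ₗ ρ)
    (x : X) (s : R ⊗[k] V) :
    assoc k P Q (X ⊗[k] V) (σ.rTensor (X ⊗[k] V) (mulActL χ X V (ρ x ⊗ₜ s))) =
      (mulActL ψ X V ∘ₗ ρ.rTensor (Q ⊗[k] V)).lTensor P (mulActL φ X (Q ⊗[k] V)
        (ρ x ⊗ₜ assoc k P Q V (σ.rTensor V s))) := by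
  rw [mulActL_equivariant hσ, ← mulActTwoL_lTensor]
  congr 2
  exact LinearMap.congr_fun hρ x

/-- Both terms of the difference take the form `(x₍₀₎ ⊗ -) ⊗ x₍₁₎ - ⊗ x₍₂₎ -` applied to the
corresponding term for `z`. -/
theorem coactionDiff_mulAct {ρ : X →ₗ[k] X ⊗[k] H}
    (hρ : (assoc k X H H).toLinearMap ∘ₗ ρ.rTensor H ∘ₗ ρ = comul.lTensor X ∘ₗ ρ)
    {σ : Q →ₗ[k] P ⊗[k] Q} (hσ : ∀ h, σ ∘ₗ ψ h = diagAct φ ψ h ∘ₗ σ) (τ : V →ₗ[k] V ⊗[k] P)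
    (x : X) (z : V ⊗[k] Q) :
    coactionDiff (mulAct φ X V ∘ₗ TensorProduct.map ρ τ) σ (mulAct ψ X V (ρ x ⊗ₜ z)) =
      (mulAct φ X V ∘ₗ ρ.rTensor (V ⊗[k] P)).rTensor Q
        (mulAct ψ X (V ⊗[k] P) (ρ x ⊗ₜ coactionDiff τ σ z)) := by
  simp only [coactionDiff, LinearMap.sub_apply, TensorProduct.tmul_sub, map_sub,
    LinearMap.comp_apply, LinearEquiv.coe_coe]
  refine congrArg₂ (HSub.hSub (α := ((X ⊗[k] V) ⊗[k] P) ⊗[k] Q)) ?_ ?_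
  -- In the term with `τ` the action on `Q` is untouched, so naturality in `V` suffices; only the
  -- term with `σ` needs equivariance.
  · have h := mulAct_map ψ LinearMap.id τ (ρ x) z
    rw [LinearMap.rTensor_id, LinearMap.id_apply] at h
    refine Eq.trans ?_ (congrArg _ h.symm)
    generalize mulAct ψ X V (ρ x ⊗ₜ z) = w
    refine indOn w (by simp) (fun y q => ?_) (fun _ _ hx hy => by simp only [map_add, hx, hy])
    refine indOn y (by simp) (fun x v => ?_) (fun _ _ hx hy => by
      simp only [map_add, add_tmul, hx, hy])
    simp
  · exact mulAct_rTensor_equivariant hσ hρ x z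

theorem coactionDiff_mulActL {ρ : X →ₗ[k] H ⊗[k] X}
    (hρ : (assoc k H H X).toLinearMap ∘ₗ comul.rTensor X ∘ₗ ρ = ρ.lTensor H ∘ₗ ρ)
    {σ : P →ₗ[k] P ⊗[k] Q} (hσ : ∀ h, σ ∘ₗ φ h = diagAct φ ψ h ∘ₗ σ) (τ : V →ₗ[k] Q ⊗[k] V)
    (x : X) (z : P ⊗[k] V) :
    assoc k P Q (X ⊗[k] V) (coactionDiff σ (mulActL ψ X V ∘ₗ TensorProduct.map ρ τ)
      (mulActL φ X V (ρ x ⊗ₜ z))) =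
      (mulActL ψ X V ∘ₗ ρ.rTensor (Q ⊗[k] V)).lTensor P (mulActL φ X (Q ⊗[k] V)
        (ρ x ⊗ₜ assoc k P Q V (coactionDiff σ τ z))) := by
  simp only [coactionDiff, LinearMap.sub_apply, TensorProduct.tmul_sub, map_sub,
    LinearMap.comp_apply, LinearEquiv.coe_coe, LinearEquiv.apply_symm_apply]
  congr 1
  · exact mulActL_lTensor_equivariant hσ hρ x z
  · have h := mulActL_map φ LinearMap.id τ (ρ x) z
    rw [LinearMap.lTensor_id, LinearMap.id_apply] at h
    refine Eq.trans ?_ (congrArg _ h.symm)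
    generalize mulActL φ X V (ρ x ⊗ₜ z) = w
    refine indOn w (by simp) (fun q y => ?_) (fun _ _ hx hy => by simp only [map_add, hx, hy])
    refine indOn y (by simp) (fun x v => ?_) (fun _ _ hx hy => by
      simp only [map_add, tmul_add, hx, hy])
    simp

variable {Z : Type u} [AddCommGroup Z] [Module k Z]

/-- Thus `x ⊗ (v ⊗ q) ↦ (x₍₀₎ ⊗ v) ⊗ x₍₁₎ q` maps `X ⊗ (V □ Q)` into `(X ⊗ V) □ Q`. -/
theorem coactionDiff_mulAct_eq_zero {ρ : X →ₗ[k] X ⊗[k] H}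
    (hρ : (assoc k X H H).toLinearMap ∘ₗ ρ.rTensor H ∘ₗ ρ = comul.lTensor X ∘ₗ ρ)
    {σ : Q →ₗ[k] P ⊗[k] Q} (hσ : ∀ h, σ ∘ₗ ψ h = diagAct φ ψ h ∘ₗ σ) {τ : V →ₗ[k] V ⊗[k] P}
    {i : Z →ₗ[k] V ⊗[k] Q} (hi : ∀ z, coactionDiff τ σ (i z) = 0) (x : X ⊗[k] Z) :
    coactionDiff (mulAct φ X V ∘ₗ TensorProduct.map ρ τ) σ
      (mulAct ψ X V (ρ.rTensor (V ⊗[k] Q) (i.lTensor X x))) = 0 := by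
  refine indOn x (by simp) (fun x z => ?_) (fun _ _ hx hy => by
    simp only [map_add, hx, hy, add_zero])
  rw [LinearMap.lTensor_tmul, LinearMap.rTensor_tmul, coactionDiff_mulAct hρ hσ, hi,
    TensorProduct.tmul_zero, map_zero, map_zero]

theorem coactionDiff_mulActL_eq_zero {ρ : X →ₗ[k] H ⊗[k] X}
    (hρ : (assoc k H H X).toLinearMap ∘ₗ comul.rTensor X ∘ₗ ρ = ρ.lTensor H ∘ₗ ρ)
    {σ : P →ₗ[k] P ⊗[k] Q} (hσ : ∀ h, σ ∘ₗ φ h = diagAct φ ψ h ∘ₗ σ) {τ : V →ₗ[k] Q ⊗[k] V}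
    {i : Z →ₗ[k] P ⊗[k] V} (hi : ∀ z, coactionDiff σ τ (i z) = 0) (x : X ⊗[k] Z) :
    coactionDiff σ (mulActL ψ X V ∘ₗ TensorProduct.map ρ τ)
      (mulActL φ X V (ρ.rTensor (P ⊗[k] V) (i.lTensor X x))) = 0 := by
  refine indOn x (by simp) (fun x z => ?_) (fun _ _ hx hy => by
    simp only [map_add, hx, hy, add_zero])
  refine (assoc k P Q (X ⊗[k] V)).map_eq_zero_iff.1 ?_
  rw [LinearMap.lTensor_tmul, LinearMap.rTensor_tmul, coactionDiff_mulActL hρ hσ, hi,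
    map_zero, TensorProduct.tmul_zero, map_zero, map_zero]

end MulAct

end EqMT

namespace EqMT

/-! ### Subcomodules -/

section Sub

variable {k C : Type u} [Field k] [AddCommGroup C] [Module k C] [Coalgebra k C]

/-- The subcomodule on a subspace `K` with `ρ(K) ⊆ K ⊗ C`. -/
noncomputable def RComod.sub (P : RComod k C) (K : Submodule k P.carrier)
    (h : ∀ x : K, (P.coact ∘ₗ K.subtype) x ∈ LinearMap.range (K.subtype.rTensor C)) : RComod k C :=
  -- Every subspace is stable under scalars and under the trivial left coaction `y ↦ 1 ⊗ y`.
  (P.toHRComod.toBicomod.sub K (fun r _ hx => K.smul_mem r hx)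
    (fun x => ⟨(lid k K).symm x, rfl⟩) h).right.toRComod

/-- The inclusion of a subcomodule. -/
noncomputable def RComod.subHom (P : RComod k C) (K : Submodule k P.carrier)
    (h : ∀ x : K, (P.coact ∘ₗ K.subtype) x ∈ LinearMap.range (K.subtype.rTensor C)) :
    P.sub K h ⟶ P where
  lin := K.subtype
  comm := (LinearMap.ext (liftInj_spec _ _ _ h)).symm

/-- The subcomodule on a subspace `K` with `λ(K) ⊆ C ⊗ K`. -/
noncomputable def LComod.sub (P : LComod k C) (K : Submodule k P.carrier)
    (h : ∀ x : K, (P.coact ∘ₗ K.subtype) x ∈ LinearMap.range (K.subtype.lTensor C)) : LComod k C :=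
  (P.toHLComod.toBicomod.sub K (fun r _ hx => K.smul_mem r hx) h
    (fun x => ⟨(rid k K).symm x, rfl⟩)).left.toLComod

/-- The inclusion of a subcomodule. -/
noncomputable def LComod.subHom (P : LComod k C) (K : Submodule k P.carrier)
    (h : ∀ x : K, (P.coact ∘ₗ K.subtype) x ∈ LinearMap.range (K.subtype.lTensor C)) :
    P.sub K h ⟶ P where
  lin := K.subtype
  comm := (LinearMap.ext (liftInj_spec _ _ _ h)).symm

theorem RComod.exists_iso_of_range {P Q R : RComod k C} (f : P ⟶ R) (i : Q ⟶ R)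
    (hf : Function.Injective f.lin) (hi : Function.Injective i.lin)
    (h : LinearMap.range f.lin = LinearMap.range i.lin) : ∃ b : P ≅ Q, b.hom ≫ i = f := by
  obtain ⟨a, ha⟩ := exists_lift i hi f fun x => h.le (LinearMap.mem_range_self _ x)
  obtain ⟨b, hb⟩ := exists_lift f hf i fun x => h.ge (LinearMap.mem_range_self _ x)
  have := mono_of_injective f hf
  have := mono_of_injective i hi
  exact ⟨⟨a, b, by rw [← cancel_mono f, Category.assoc, hb, ha, Category.id_comp],
    by rw [← cancel_mono i, Category.assoc, ha, hb, Category.id_comp]⟩, ha⟩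

theorem LComod.exists_iso_of_range {P Q R : LComod k C} (f : P ⟶ R) (i : Q ⟶ R)
    (hf : Function.Injective f.lin) (hi : Function.Injective i.lin)
    (h : LinearMap.range f.lin = LinearMap.range i.lin) : ∃ b : P ≅ Q, b.hom ≫ i = f := by
  obtain ⟨a, ha⟩ := exists_lift i hi f fun x => h.le (LinearMap.mem_range_self _ x)
  obtain ⟨b, hb⟩ := exists_lift f hf i fun x => h.ge (LinearMap.mem_range_self _ x)
  have := mono_of_injective f hf
  have := mono_of_injective i hi
  exact ⟨⟨a, b, by rw [← cancel_mono f, Category.assoc, hb, ha, Category.id_comp],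
    by rw [← cancel_mono i, Category.assoc, ha, hb, Category.id_comp]⟩, ha⟩

end Sub

/-! ### From bicomodules to an equivalence of right comodules over right `H`-comodules -/

section CotensorFunctor

open Functor MonoidalLeftAction

variable {k H C D : Type u} [Field k] [Ring H] [Bialgebra k H]
  [AddCommGroup C] [Module k C] [Coalgebra k C] [Module H C] [IsScalarTower k H C]
  [AddCommGroup D] [Module k D] [Coalgebra k D] [Module H D] [IsScalarTower k H D]

/-- The underlying morphism of bicomodules over the ground field. -/
noncomputable def HBicomod.forgetActHom [ModuleCoalgebra k H C] {M : HBicomod k H C D}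
    {N : HBicomod k H D C} (ι : regular k H C ⟶ ext M N) :
    regular k k C ⟶ ext M.forgetAct N.forgetAct :=
  homOfColinear rfl (AlgHom.ext fun r => LinearMap.ext fun x => diagAct_lsmul r x) ι.lin
    ι.lcomm ι.rcomm

theorem HBicomod.equivariant_of_hom [ModuleCoalgebra k H C] {M : HBicomod k H C D}
    {N : HBicomod k H D C} (ι : regular k H C ⟶ ext M N) (h : H) :
    (show C →ₗ[k] M.carrier ⊗[k] N.carrier from ι.lin) ∘ₗ Algebra.lsmul k k C h =
      diagAct M.act N.act h ∘ₗ (show C →ₗ[k] M.carrier ⊗[k] N.carrier from ι.lin) :=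
  ι.comm_act h

theorem HBicomod.forgetActHom_injective [ModuleCoalgebra k H C] {M : HBicomod k H C D}
    {N : HBicomod k H D C} {ι : regular k H C ⟶ ext M N} (hι : Function.Injective ι.lin) :
    Function.Injective (forgetActHom ι).lin := hι

/-- The functor `Y ↦ Y ⊗ M`, where the coaction of `Y` is ignored. -/
def RComod.tensorFunctor (M : HBicomod k H C D) : RComod k C ⥤ RComod k D where
  obj Y := (HRComod.tens Y.toHRComod.toHMod M.forgetAct.right).toRComod
  map {Y Y'} f := ⟨TensorProduct.map f.lin LinearMap.id,
    (HRComod.tensMap (X := Y.toHRComod.toHMod) (X' := Y'.toHRComod.toHMod)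
      ⟨f.lin, fun r => LinearMap.ext fun y => f.lin.map_smul r y⟩ (𝟙 M.forgetAct.right)).comm⟩
  map_id _ := Hom.ext (TensorProduct.ext' fun _ _ => rfl)
  map_comp _ _ := Hom.ext (TensorProduct.ext' fun _ _ => rfl)

variable [ModuleCoalgebra k H C] [ModuleCoalgebra k H D]

/-- The map `X ⊗ (Y ⊗ M) ⟶ (X ⊗ Y) ⊗ M`, `x ⊗ (y ⊗ m) ↦ (x₍₀₎ ⊗ y) ⊗ x₍₁₎ m`. -/
def RComod.tensorLineator (M : HBicomod k H C D) (X : RComod k H) (Y : RComod k C) :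
    tens X ((tensorFunctor M).obj Y) ⟶ (tensorFunctor M).obj (tens X Y) where
  lin := mulAct M.act X.carrier Y.carrier ∘ₗ X.coact.rTensor (Y.carrier ⊗[k] M.carrier)
  comm := TensorProduct.ext' fun x z => mulAct_rTensor_equivariant M.requivariant X.coassoc x z

/-- The underlying functor forgets the action of `H` on `M`, but the structure morphism uses it. -/
instance (M : HBicomod k H C D) : (RComod.tensorFunctor M).LaxLeftLinear (RComod k H) where
  μₗ := RComod.tensorLineator M
  μₗ_naturality_left {X X'} f Y := RComod.Hom.ext (TensorProduct.ext' fun x z => by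
    have h := mulAct_map M.act f.lin LinearMap.id (X.coact x) z
    rw [← show X'.coact (f.lin x) = f.lin.rTensor H (X.coact x) from
      LinearMap.congr_fun f.comm x, TensorProduct.map_id] at h
    exact h)
  μₗ_naturality_right X Y Y' f := RComod.Hom.ext (TensorProduct.ext' fun x z => by
    have h := mulAct_map M.act LinearMap.id f.lin (X.coact x) z
    rw [LinearMap.rTensor_id] at h
    exact h)
  μₗ_associativity X X' Y := RComod.Hom.ext (ext_threefold fun x x' z =>
    mulAct_mulAct M.act (X.coact x) (X'.coact x') z)
  μₗ_unitality Y := RComod.Hom.ext (TensorProduct.ext' fun r z =>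
    (mulAct_unit M.act r z).symm)

/-- The cotensor products `Y □ M` as a subfunctor of `Y ↦ Y ⊗ M`. -/
noncomputable def RComod.cotensorSubfunctor (M : HBicomod k H C D) :
    LaxSubfunctor (RComod k H) (RComod.tensorFunctor M) where
  obj Y := ((tensorFunctor M).obj Y).sub (LinearMap.ker (coactionDiff Y.coact M.lcoact))
    (HBicomod.cotensor_rcoact_mem Y.toHRComod.toBicomod M.forgetAct)
  ι Y := subHom _ _ _
  mono Y := mono_of_injective _ (Submodule.subtype_injective _)
  exists_map {A B} f := exists_lift _ (Submodule.subtype_injective _) _ (by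
    intro x
    refine (Submodule.range_subtype _).ge ?_
    refine (coactionDiff_map (σ := M.lcoact) (σ' := M.lcoact) f.comm (g := LinearMap.id)
      (by simp) x.1).trans ?_
    exact (congrArg _ x.2).trans (map_zero _))
  exists_lineator X A := exists_lift _ (Submodule.subtype_injective _) _ (by
    intro x
    refine (Submodule.range_subtype _).ge ?_
    exact coactionDiff_mulAct_eq_zero X.coassoc M.lequivariant (τ := A.coact)
      (i := (LinearMap.ker (coactionDiff A.coact M.lcoact)).subtype) (fun z => z.2) x)

/-- The natural transformation `Y ⟶ (Y ⊗ M) ⊗ N` given by a morphism `C ⟶ M ⊗ N`. -/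
noncomputable def RComod.toTensorFunctor {M : HBicomod k H C D}
    {N : HBicomod k H D C} (ι : HBicomod.regular k H C ⟶ HBicomod.ext M N) :
    𝟭 _ ⟶ tensorFunctor M ⋙ tensorFunctor N where
  app Y := ⟨(HBicomod.toExtLeft (HBicomod.forgetActHom ι) Y.toHRComod.toBicomod).lin,
    (HBicomod.toExtLeft (HBicomod.forgetActHom ι) Y.toHRComod.toBicomod).rcomm⟩
  naturality _ _ f := hom_ext fun y => assoc_symm_lTensor_natural f.comm
    (show C →ₗ[k] M.carrier ⊗[k] N.carrier from ι.lin) y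

/-- The `H`-linearity of `ι` enters here and nowhere else in this case: `ι(x₍₁₎ c) = x₍₁₎ ι(c)` for
the diagonal action. -/
theorem RComod.isLeftModuleTrans_toTensorFunctor {M : HBicomod k H C D}
    {N : HBicomod k H D C} (ι : HBicomod.regular k H C ⟶ HBicomod.ext M N) :
    IsLeftModuleTrans (RComod k H) (toTensorFunctor ι) := fun X A =>
  Hom.ext (TensorProduct.ext' fun x y => mulAct_rTensor_equivariant
    (HBicomod.equivariant_of_hom ι) X.coassoc x (A.coact y))

theorem RComod.injective_toTensorFunctor {M : HBicomod k H C D} {N : HBicomod k H D C}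
    {ι : HBicomod.regular k H C ⟶ HBicomod.ext M N} (hι : Function.Injective ι.lin)
    (A : RComod k C) : Function.Injective ((toTensorFunctor ι).app A).lin :=
  HBicomod.toExtLeft_injective (HBicomod.forgetActHom_injective hι) A.toHRComod.toBicomod

theorem RComod.injective_map_ι (M : HBicomod k H C D) (N : HBicomod k H D C) (A : RComod k C) :
    Function.Injective ((tensorFunctor N).map ((cotensorSubfunctor M).ι A)).lin := by
  have h := Module.Flat.rTensor_preserves_injective_linearMap (M := N.carrier) _
    (LinearMap.ker (coactionDiff A.coact M.lcoact)).subtype_injective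
  exact h

theorem RComod.injective_ι_comp_map_ι (M : HBicomod k H C D) (N : HBicomod k H D C)
    (A : RComod k C) : Function.Injective ((cotensorSubfunctor N).ι _ ≫
      (tensorFunctor N).map ((cotensorSubfunctor M).ι A)).lin :=
  (injective_map_ι M N A).comp (Submodule.subtype_injective _)

theorem RComod.range_toTensorFunctor {M : HBicomod k H C D} {N : HBicomod k H D C}
    {ι : HBicomod.regular k H C ⟶ HBicomod.ext M N} (hι : Function.Injective ι.lin)
    (hr : LinearMap.range ι.lin = LinearMap.ker (HBicomod.cotensorDiff M N)) (A : RComod k C) :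
    LinearMap.range ((toTensorFunctor ι).app A).lin =
      LinearMap.ker ((coactionDiff A.coact M.lcoact).rTensor N.carrier) ⊓
        LinearMap.ker (coactionDiff ((assoc k A.carrier M.carrier D).symm.toLinearMap ∘ₗ
          M.rcoact.lTensor A.carrier) N.lcoact) :=
  range_coact_of_range_eq (ι := (show C →ₗ[k] M.carrier ⊗[k] N.carrier from ι.lin))
    A.coassoc hι hr ι.lcomm

/-- The intersection is that of `RComod.range_toTensorFunctor`, so the two embeddings into `(A ⊗ M)
⊗ N` have isomorphic sources. -/
theorem RComod.range_ι_comp_map_ι (M : HBicomod k H C D) (N : HBicomod k H D C) (A : RComod k C) :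
    LinearMap.range ((cotensorSubfunctor N).ι _ ≫
      (tensorFunctor N).map ((cotensorSubfunctor M).ι A)).lin =
      LinearMap.ker ((coactionDiff A.coact M.lcoact).rTensor N.carrier) ⊓
        LinearMap.ker (coactionDiff ((assoc k A.carrier M.carrier D).symm.toLinearMap ∘ₗ
          M.rcoact.lTensor A.carrier) N.lcoact) :=
  range_rTensor_comp_coactionDiff (j := (LinearMap.ker (coactionDiff A.coact M.lcoact)).subtype)
    (i := ((cotensorSubfunctor N).ι ((cotensorSubfunctor M).obj A)).lin)
    (Submodule.subtype_injective _) (Submodule.range_subtype _)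
    ((cotensorSubfunctor M).ι A).comm (Submodule.range_subtype _)

theorem RComod.exists_cotensor_iso {M : HBicomod k H C D}
    {N : HBicomod k H D C} (κ : M.cotensor N ≅ HBicomod.regular k H C) :
    ∃ e : (cotensorSubfunctor M).functor ⋙ (cotensorSubfunctor N).functor ≅ 𝟭 _,
      IsLeftModuleTrans (RComod k H) e.hom := by
  obtain ⟨hι, hr⟩ := HBicomod.incl_of_iso κ
  exact LaxSubfunctor.exists_iso _ _ (fun A => mono_of_injective _ (injective_map_ι M N A))
    (toTensorFunctor _) (isLeftModuleTrans_toTensorFunctor _) (fun A =>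
      exists_iso_of_range _ _ (injective_toTensorFunctor hι A) (injective_ι_comp_map_ι M N A)
        ((range_toTensorFunctor hι hr A).trans (range_ι_comp_map_ι M N A).symm))

theorem RComod.leftModuleEquivalent
    {M : HBicomod k H C D} {N : HBicomod k H D C} (κ : M.cotensor N ≅ HBicomod.regular k H C)
    (κ' : N.cotensor M ≅ HBicomod.regular k H D) :
    LeftModuleEquivalent (RComod k H) (RComod k C) (RComod k D) := by
  obtain ⟨η, hη⟩ := exists_cotensor_iso κ
  obtain ⟨ε, hε⟩ := exists_cotensor_iso κ'
  exact ⟨_, _, _, _, η, ε, hη, hε⟩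

end CotensorFunctor

end EqMT

namespace EqMT

/-! ### From bicomodules to an equivalence of left comodules over left `H`-comodules -/

section CotensorFunctor

open Functor MonoidalLeftAction

variable {k H C D : Type u} [Field k] [Ring H] [Bialgebra k H]
  [AddCommGroup C] [Module k C] [Coalgebra k C] [Module H C] [IsScalarTower k H C]
  [AddCommGroup D] [Module k D] [Coalgebra k D] [Module H D] [IsScalarTower k H D]

/-- The functor `Y ↦ N ⊗ Y`, where the coaction of `Y` is ignored. -/
def LComod.tensorFunctor (N : HBicomod k H D C) : LComod k C ⥤ LComod k D where
  obj Y := (HLComod.tens N.forgetAct.left Y.toHLComod.toHMod).toLComod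
  map {Y Y'} f := ⟨TensorProduct.map LinearMap.id f.lin,
    (HLComod.tensMap (X := Y.toHLComod.toHMod) (X' := Y'.toHLComod.toHMod) (𝟙 N.forgetAct.left)
      ⟨f.lin, fun r => LinearMap.ext fun y => f.lin.map_smul r y⟩).comm⟩
  map_id _ := Hom.ext (TensorProduct.ext' fun _ _ => rfl)
  map_comp _ _ := Hom.ext (TensorProduct.ext' fun _ _ => rfl)

variable [ModuleCoalgebra k H C] [ModuleCoalgebra k H D]

/-- The map `X ⊗ (N ⊗ Y) ⟶ N ⊗ (X ⊗ Y)`, `x ⊗ (n ⊗ y) ↦ x₍₋₁₎ n ⊗ (x₍₀₎ ⊗ y)`. -/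
def LComod.tensorLineator (N : HBicomod k H D C) (X : LComod k H) (Y : LComod k C) :
    tens X ((tensorFunctor N).obj Y) ⟶ (tensorFunctor N).obj (tens X Y) where
  lin := mulActL N.act X.carrier Y.carrier ∘ₗ X.coact.rTensor (N.carrier ⊗[k] Y.carrier)
  comm := TensorProduct.ext' fun x z => mulActL_lTensor_equivariant N.lequivariant X.coassoc x z

instance (N : HBicomod k H D C) : (LComod.tensorFunctor N).LaxLeftLinear (LComod k H) where
  μₗ := LComod.tensorLineator N
  μₗ_naturality_left {X X'} f Y := LComod.Hom.ext (TensorProduct.ext' fun x z => by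
    have h := mulActL_map N.act f.lin LinearMap.id (X.coact x) z
    rw [← show X'.coact (f.lin x) = f.lin.lTensor H (X.coact x) from
      LinearMap.congr_fun f.comm x, TensorProduct.map_id] at h
    exact h)
  μₗ_naturality_right X Y Y' f := LComod.Hom.ext (TensorProduct.ext' fun x z => by
    have h := mulActL_map N.act LinearMap.id f.lin (X.coact x) z
    rw [LinearMap.lTensor_id] at h
    exact h)
  μₗ_associativity X X' Y := LComod.Hom.ext (ext_threefold fun x x' z =>
    mulActL_mulActL N.act (X.coact x) (X'.coact x') z)
  μₗ_unitality Y := LComod.Hom.ext (TensorProduct.ext' fun r z => (mulActL_unit N.act r z).symm)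

/-- The cotensor products `N □ Y` as a subfunctor of `Y ↦ N ⊗ Y`. -/
noncomputable def LComod.cotensorSubfunctor (N : HBicomod k H D C) :
    LaxSubfunctor (LComod k H) (LComod.tensorFunctor N) where
  obj Y := ((tensorFunctor N).obj Y).sub (LinearMap.ker (coactionDiff N.rcoact Y.coact))
    (HBicomod.cotensor_lcoact_mem N.forgetAct Y.toHLComod.toBicomod)
  ι Y := subHom _ _ _
  mono Y := mono_of_injective _ (Submodule.subtype_injective _)
  exists_map {A B} f := exists_lift _ (Submodule.subtype_injective _) _ (by
    intro x
    refine (Submodule.range_subtype _).ge ?_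
    refine (coactionDiff_map (ρ := N.rcoact) (ρ' := N.rcoact) (f := LinearMap.id)
      (by simp) f.comm x.1).trans ?_
    exact (congrArg _ x.2).trans (map_zero _))
  exists_lineator X A := exists_lift _ (Submodule.subtype_injective _) _ (by
    intro x
    refine (Submodule.range_subtype _).ge ?_
    exact coactionDiff_mulActL_eq_zero X.coassoc N.requivariant (τ := A.coact)
      (i := (LinearMap.ker (coactionDiff N.rcoact A.coact)).subtype) (fun z => z.2) x)

/-- The natural transformation `Y ⟶ M ⊗ (N ⊗ Y)` given by a morphism `C ⟶ M ⊗ N`. -/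
noncomputable def LComod.toTensorFunctor {M : HBicomod k H C D}
    {N : HBicomod k H D C} (ι : HBicomod.regular k H C ⟶ HBicomod.ext M N) :
    𝟭 _ ⟶ tensorFunctor N ⋙ tensorFunctor M where
  app Y := ⟨(HBicomod.toExtRight (HBicomod.forgetActHom ι) Y.toHLComod.toBicomod).lin,
    (HBicomod.toExtRight (HBicomod.forgetActHom ι) Y.toHLComod.toBicomod).lcomm⟩
  naturality _ _ f := hom_ext fun y => assoc_rTensor_natural f.comm
    (show C →ₗ[k] M.carrier ⊗[k] N.carrier from ι.lin) y

/-- As on the right, this is where the `H`-linearity of `ι` is used, now moving `x₍₋₁₎` past `ι`. -/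
theorem LComod.isLeftModuleTrans_toTensorFunctor {M : HBicomod k H C D}
    {N : HBicomod k H D C} (ι : HBicomod.regular k H C ⟶ HBicomod.ext M N) :
    IsLeftModuleTrans (LComod k H) (toTensorFunctor ι) := fun X A =>
  Hom.ext (TensorProduct.ext' fun x y => mulActL_lTensor_equivariant
    (HBicomod.equivariant_of_hom ι) X.coassoc x (A.coact y))

theorem LComod.injective_toTensorFunctor {M : HBicomod k H C D} {N : HBicomod k H D C}
    {ι : HBicomod.regular k H C ⟶ HBicomod.ext M N} (hι : Function.Injective ι.lin)
    (A : LComod k C) : Function.Injective ((toTensorFunctor ι).app A).lin :=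
  HBicomod.toExtRight_injective (HBicomod.forgetActHom_injective hι) A.toHLComod.toBicomod

theorem LComod.injective_map_ι (M : HBicomod k H C D) (N : HBicomod k H D C) (A : LComod k C) :
    Function.Injective ((tensorFunctor M).map ((cotensorSubfunctor N).ι A)).lin := by
  have h := Module.Flat.lTensor_preserves_injective_linearMap (M := M.carrier) _
    (LinearMap.ker (coactionDiff N.rcoact A.coact)).subtype_injective
  exact h

theorem LComod.injective_ι_comp_map_ι (M : HBicomod k H C D) (N : HBicomod k H D C)
    (A : LComod k C) : Function.Injective ((cotensorSubfunctor M).ι _ ≫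
      (tensorFunctor M).map ((cotensorSubfunctor N).ι A)).lin :=
  (injective_map_ι M N A).comp (Submodule.subtype_injective _)

theorem LComod.range_toTensorFunctor {M : HBicomod k H C D} {N : HBicomod k H D C}
    {ι : HBicomod.regular k H C ⟶ HBicomod.ext M N} (hι : Function.Injective ι.lin)
    (hr : LinearMap.range ι.lin = LinearMap.ker (HBicomod.cotensorDiff M N)) (A : LComod k C) :
    LinearMap.range ((toTensorFunctor ι).app A).lin =
      LinearMap.ker ((coactionDiff N.rcoact A.coact).lTensor M.carrier) ⊓
        LinearMap.ker (coactionDiff M.rcoact ((assoc k D N.carrier A.carrier).toLinearMap ∘ₗ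
          N.lcoact.rTensor A.carrier)) :=
  range_coact_of_range_eq_left (ι := (show C →ₗ[k] M.carrier ⊗[k] N.carrier from ι.lin))
    A.coassoc hι hr ι.rcomm

theorem LComod.range_ι_comp_map_ι (M : HBicomod k H C D) (N : HBicomod k H D C) (A : LComod k C) :
    LinearMap.range ((cotensorSubfunctor M).ι _ ≫
      (tensorFunctor M).map ((cotensorSubfunctor N).ι A)).lin =
      LinearMap.ker ((coactionDiff N.rcoact A.coact).lTensor M.carrier) ⊓
        LinearMap.ker (coactionDiff M.rcoact ((assoc k D N.carrier A.carrier).toLinearMap ∘ₗ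
          N.lcoact.rTensor A.carrier)) :=
  range_lTensor_comp_coactionDiff (j := (LinearMap.ker (coactionDiff N.rcoact A.coact)).subtype)
    (i := ((cotensorSubfunctor M).ι ((cotensorSubfunctor N).obj A)).lin)
    (Submodule.subtype_injective _) (Submodule.range_subtype _)
    ((cotensorSubfunctor N).ι A).comm (Submodule.range_subtype _)

theorem LComod.exists_cotensor_iso {M : HBicomod k H C D}
    {N : HBicomod k H D C} (κ : M.cotensor N ≅ HBicomod.regular k H C) :
    ∃ e : (cotensorSubfunctor N).functor ⋙ (cotensorSubfunctor M).functor ≅ 𝟭 _,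
      IsLeftModuleTrans (LComod k H) e.hom := by
  obtain ⟨hι, hr⟩ := HBicomod.incl_of_iso κ
  exact LaxSubfunctor.exists_iso _ _ (fun A => mono_of_injective _ (injective_map_ι M N A))
    (toTensorFunctor _) (isLeftModuleTrans_toTensorFunctor _) (fun A =>
      exists_iso_of_range _ _ (injective_toTensorFunctor hι A) (injective_ι_comp_map_ι M N A)
        ((range_toTensorFunctor hι hr A).trans (range_ι_comp_map_ι M N A).symm))

theorem LComod.leftModuleEquivalent
    {M : HBicomod k H C D} {N : HBicomod k H D C} (κ : M.cotensor N ≅ HBicomod.regular k H C)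
    (κ' : N.cotensor M ≅ HBicomod.regular k H D) :
    LeftModuleEquivalent (LComod k H) (LComod k C) (LComod k D) := by
  obtain ⟨η, hη⟩ := exists_cotensor_iso κ
  obtain ⟨ε, hε⟩ := exists_cotensor_iso κ'
  exact ⟨_, _, _, _, η, ε, hη, hε⟩

end CotensorFunctor

end EqMT

namespace EqMT

/-! ### Transposes `A ⟶ X ⊙ G B` of morphisms `F A ⟶ X ⊙ B` -/

namespace LeftModuleEquivalence

universe v₁ u₁ v₂ u₂ v₃ u₃

open Functor MonoidalLeftAction

variable {T : Type u₁} [Category.{v₁} T] [MonoidalCategory T]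
  {𝓐 : Type u₂} [Category.{v₂} 𝓐] [MonoidalLeftAction T 𝓐]
  {𝓑 : Type u₃} [Category.{v₃} 𝓑] [MonoidalLeftAction T 𝓑]
  (e : LeftModuleEquivalence T 𝓐 𝓑) {A : 𝓐} {B : 𝓑} {X Y Z Z' : T}

/-- The morphism `A ⟶ X ⊙ G B` that corresponds to `F A ⟶ X ⊙ B`. -/
noncomputable def transpose (f : e.F.obj A ⟶ X ⊙ₗ B) : A ⟶ X ⊙ₗ e.symm.F.obj B :=
  (e.unitIso A).inv ≫ e.symm.coactMap f

/-- For `f` the coaction of `M = F C`, the hypothesis is the bicomodule axiom, and the conclusion is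
colinearity of `C ⟶ M ⊗ N` for the structure on `M` that comes from `C`. -/
theorem transpose_whisker {f : e.F.obj A ⟶ X ⊙ₗ B} {u : X ⟶ Y ⊗ X} {l : A ⟶ Y ⊙ₗ A}
    (h : f ≫ u ⊵ₗ B = e.coactMap l ≫ Y ⊴ₗ f ≫ (αₗ Y X B).inv) :
    e.transpose f ≫ u ⊵ₗ e.symm.F.obj B = l ≫ Y ⊴ₗ e.transpose f ≫ (αₗ Y X _).inv := by
  have h' := congrArg (fun t => (e.unitIso A).inv ≫ e.symm.coactMap t) h
  simp only [coactMap_whisker, coactMap_comp] at h'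
  rw [transpose, Category.assoc, h']
  have h2 := e.coactMap_coactMap l
  rw [← Iso.inv_comp_eq, ← Category.assoc] at h2
  conv_rhs => rw [← h2]
  simp only [actionHomRight_comp, Category.assoc]
  rw [← actionHomRight_comp_assoc Y (e.unitIso A).hom]
  simp

/-- In the same way, equivariance of the coaction of `M` becomes `H`-linearity of `C ⟶ M ⊗ N`. -/
theorem action_transpose {f : e.F.obj A ⟶ X ⊙ₗ B} {a : Z ⊙ₗ A ⟶ A} {b : Z' ⊙ₗ B ⟶ B}
    {p : Z ⊗ X ⟶ X ⊗ Z'}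
    (h : e.actionMap a ≫ f = Z ⊴ₗ f ≫ (αₗ Z X B).inv ≫ p ⊵ₗ B ≫ (αₗ X Z' B).hom ≫ X ⊴ₗ b) :
    a ≫ e.transpose f = Z ⊴ₗ e.transpose f ≫ (αₗ Z X _).inv ≫ p ⊵ₗ e.symm.F.obj B ≫
      (αₗ X Z' _).hom ≫ X ⊴ₗ e.symm.actionMap b := by
  have h' := e.symm.actionMap_coactMap h
  have h2 := e.actionMap_actionMap a
  rw [← Iso.eq_comp_inv, Category.assoc] at h2
  rw [h2] at h'
  rw [transpose, actionHomRight_comp, Category.assoc, ← h', Category.assoc,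
    ← actionHomRight_comp_assoc]
  simp

/-- Coassociativity of the coaction of `M` thereby puts the image of `C` into the cotensor product.
-/
theorem transpose_equalizes {f : e.F.obj A ⟶ X ⊙ₗ B} {u : X ⟶ X ⊗ Y} {g : B ⟶ Y ⊙ₗ B}
    (h : f ≫ u ⊵ₗ B = f ≫ X ⊴ₗ g ≫ (αₗ X Y B).inv) :
    e.transpose f ≫ u ⊵ₗ e.symm.F.obj B =
      e.transpose f ≫ X ⊴ₗ e.symm.coactMap g ≫ (αₗ X Y _).inv := by
  have h' := congrArg (fun t => (e.unitIso A).inv ≫ e.symm.coactMap t) h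
  simp only [coactMap_whisker, coactMap_comp] at h'
  rw [transpose, Category.assoc, Category.assoc, h']

/-- Equivalences preserve equalizers. The universal property is stated by existence of lifts only;
uniqueness is carried by `mono_transpose`. -/
theorem exists_lift_transpose {f : e.F.obj A ⟶ X ⊙ₗ B} {u : X ⟶ X ⊗ Y} {g : B ⟶ Y ⊙ₗ B}
    (hf : ∀ (W : 𝓑) (z : W ⟶ X ⊙ₗ B), z ≫ u ⊵ₗ B = z ≫ X ⊴ₗ g ≫ (αₗ X Y B).inv →
      ∃ w : W ⟶ e.F.obj A, w ≫ f = z) {W : 𝓐} (z : W ⟶ X ⊙ₗ e.symm.F.obj B)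
    (hz : z ≫ u ⊵ₗ e.symm.F.obj B = z ≫ X ⊴ₗ e.symm.coactMap g ≫ (αₗ X Y _).inv) :
    ∃ w : W ⟶ A, w ≫ e.transpose f = z := by
  obtain ⟨w, hw⟩ := e.symm.exists_lift_coactMap hf z hz
  exact ⟨w ≫ (e.unitIso A).hom, by simp [transpose, hw]⟩

theorem mono_transpose {f : e.F.obj A ⟶ X ⊙ₗ B} (hf : Mono f) : Mono (e.transpose f) :=
  have := e.symm.mono_coactMap f
  mono_comp _ _

/-- This and the next three lemmas make `F A` a comodule and a module over the same objects as `A`.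
-/
theorem coactMap_coassoc {l : A ⟶ X ⊙ₗ A} {u : X ⟶ X ⊗ X}
    (h : l ≫ X ⊴ₗ l ≫ (αₗ X X A).inv = l ≫ u ⊵ₗ A) :
    e.coactMap l ≫ X ⊴ₗ e.coactMap l ≫ (αₗ X X _).inv = e.coactMap l ≫ u ⊵ₗ e.F.obj A := by
  rw [← coactMap_comp, h, coactMap_whisker]

theorem coactMap_counit {l : A ⟶ X ⊙ₗ A} {u : X ⟶ 𝟙_ T} (h : l ≫ u ⊵ₗ A ≫ (λₗ A).hom = 𝟙 A) :
    e.coactMap l ≫ u ⊵ₗ e.F.obj A ≫ (λₗ _).hom = 𝟙 _ := by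
  rw [← Category.assoc, ← coactMap_whisker, coactMap_unit, Category.assoc, h,
    CategoryTheory.Functor.map_id]

theorem actionMap_mul {a : X ⊙ₗ A ⟶ A} {u : X ⊗ X ⟶ X}
    (h : (αₗ X X A).hom ≫ X ⊴ₗ a ≫ a = u ⊵ₗ A ≫ a) :
    (αₗ X X _).hom ≫ X ⊴ₗ e.actionMap a ≫ e.actionMap a = u ⊵ₗ e.F.obj A ≫ e.actionMap a := by
  rw [← actionMap_comp, h, actionMap_whisker]

theorem actionMap_one {a : X ⊙ₗ A ⟶ A} {u : 𝟙_ T ⟶ X} (h : (λₗ A).inv ≫ u ⊵ₗ A ≫ a = 𝟙 A) :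
    (λₗ _).inv ≫ u ⊵ₗ e.F.obj A ≫ e.actionMap a = 𝟙 _ := by
  rw [← actionMap_whisker, actionMap_unit, h, CategoryTheory.Functor.map_id]

end LeftModuleEquivalence

end EqMT

namespace EqMT

open Functor MonoidalLeftAction

variable {k H C D : Type u} [Field k] [Ring H] [Bialgebra k H]
  [AddCommGroup C] [Module k C] [Coalgebra k C] [Module H C] [IsScalarTower k H C]
  [AddCommGroup D] [Module k D] [Coalgebra k D] [Module H D] [IsScalarTower k H D]

/-! ### From an equivalence of right comodules in `H`-modules to bicomodules -/

namespace HBicomod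

/-- The underlying morphism of right comodules. -/
def homRight {M N : HBicomod k H C D} (f : M ⟶ N) : M.right ⟶ N.right :=
  ⟨f.lin, f.rcomm, f.comm_act⟩

/-- The underlying morphism of left comodules. -/
def homLeft {M N : HBicomod k H C D} (f : M ⟶ N) : M.left ⟶ N.left :=
  ⟨f.lin, f.lcomm, f.comm_act⟩

variable (k H C) in
/-- The comultiplication as a morphism of modules. -/
def comulHMod [ModuleCoalgebra k H C] :
    (regular k H C).toHMod ⟶ (regular k H C).toHMod ⊗ (regular k H C).toHMod :=
  ⟨(comul (R := k) (A := C) : C →ₗ[k] C ⊗[k] C), by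
    have h := comul_equivariant (k := k) (H := H) C
    exact h⟩

variable (k H C) in
/-- The counit as a morphism of modules. -/
def counitHMod [ModuleCoalgebra k H C] : (regular k H C).toHMod ⟶ 𝟙_ (HMod k H) :=
  ⟨CoalgebraStruct.counit (R := k) (A := C), fun h => LinearMap.ext fun (c : C) =>
    ModuleCoalgebra.counit_smul (k := k) h c⟩

/-- The left coaction as a morphism of modules. -/
def lcoactHMod [ModuleCoalgebra k H C] (M : HBicomod k H C D) :
    M.toHMod ⟶ (regular k H C).toHMod ⊗ M.toHMod :=
  ⟨M.lcoact, M.lequivariant⟩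

/-- The right coaction as a morphism of modules. -/
def rcoactHMod [ModuleCoalgebra k H D] (M : HBicomod k H C D) :
    M.toHMod ⟶ M.toHMod ⊗ (regular k H D).toHMod :=
  ⟨M.rcoact, M.requivariant⟩

/-- The left coaction as a morphism of right comodules. -/
def lcoactRight [ModuleCoalgebra k H C] (M : HBicomod k H C D) :
    M.right ⟶ (regular k H C).toHMod ⊙ₗ M.right :=
  homRight (lcoactHom M)

/-- The right coaction as a morphism of right comodules. -/
def rcoactRight [ModuleCoalgebra k H D] (M : HBicomod k H C D) :
    M.right ⟶ M.toHMod ⊙ₗ (regular k H D).right :=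
  homRight (rcoactHom M)

/-- The inclusion `M □ N ⟶ M ⊗ N` as a morphism of right comodules. -/
noncomputable def cotensorInclRight (M : HBicomod k H C D) (N : HBicomod k H D C) :
    (cotensor M N).right ⟶ M.toHMod ⊙ₗ N.right :=
  homRight (incl M N)

end HBicomod

namespace HRComod

variable [ModuleCoalgebra k H C]

/-- The bicomodule given by a left coaction in the category of right comodules. -/
def bicomod (P : HRComod k H D) (l : P ⟶ (HBicomod.regular k H C).toHMod ⊙ₗ P)
    (h : l ≫ _ ⊴ₗ l ≫ (αₗ _ _ P).inv = l ≫ HBicomod.comulHMod k H C ⊵ₗ P)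
    (h' : l ≫ HBicomod.counitHMod k H C ⊵ₗ P ≫ (λₗ P).hom = 𝟙 P) : HBicomod k H C D where
  carrier := P.carrier
  act := P.act
  lcoact := l.lin
  rcoact := P.coact
  lcoassoc := LinearMap.ext fun x =>
    ((LinearEquiv.symm_apply_eq (assoc k C C P.carrier)).1
      (LinearMap.congr_fun (congrArg Hom.lin h) x)).symm
  lcounit := congrArg Hom.lin h'
  rcoassoc := P.coassoc
  rcounit := P.counit
  bicomod := LinearMap.ext fun x =>
    ((LinearEquiv.symm_apply_eq (assoc k C P.carrier D)).1 (LinearMap.congr_fun l.comm x)).symm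
  lequivariant := l.comm_act
  requivariant := P.equivariant

-- Coassociativity of `C`, written in the module category so that `F` can be applied to it.
variable (k H C) in
theorem regular_coassoc :
    (HBicomod.regular k H C).lcoactRight ≫
      _ ⊴ₗ (HBicomod.regular k H C).lcoactRight ≫ (αₗ _ _ _).inv =
    (HBicomod.regular k H C).lcoactRight ≫
      HBicomod.comulHMod k H C ⊵ₗ _ := by
  refine hom_ext fun (c : C) => ?_
  exact Coalgebra.coassoc_symm_apply (R := k) c

variable (k H C) in
theorem regular_counit :
    (HBicomod.regular k H C).lcoactRight ≫
      HBicomod.counitHMod k H C ⊵ₗ (HBicomod.regular k H C).right ≫ (λₗ _).hom = 𝟙 _ := by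
  refine hom_ext fun (c : C) => ?_
  exact LinearMap.congr_fun (HBicomod.regular k H C).lcounit c

variable [ModuleCoalgebra k H D]
  (e : LeftModuleEquivalence (HMod k H) (HRComod k H C) (HRComod k H D))

/-- The image of the bicomodule `C` under an equivalence of module categories. -/
noncomputable def imageRegular : HBicomod k H C D :=
  bicomod (e.F.obj (HBicomod.regular k H C).right)
    (e.coactMap ((HBicomod.regular k H C).lcoactRight))
    (e.coactMap_coassoc (regular_coassoc k H C)) (e.coactMap_counit (regular_counit k H C))

/-- The morphism `C ⟶ M ⊗ N` of right comodules for the images `M` of `C` and `N` of `D`. -/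
noncomputable def regularMap : (HBicomod.regular k H C).right ⟶
    (imageRegular e).toHMod ⊙ₗ (imageRegular e.symm).right :=
  e.transpose (A := (HBicomod.regular k H C).right) (B := (HBicomod.regular k H D).right)
    (X := (imageRegular e).toHMod) ((imageRegular e).rcoactRight)

/-- The transpose of the bicomodule axiom of `M = F C`. -/
theorem regularMap_lcoact : regularMap e ≫ (imageRegular e).lcoactHMod ⊵ₗ _ =
    (HBicomod.regular k H C).lcoactRight ≫
      _ ⊴ₗ regularMap e ≫ (αₗ _ _ (imageRegular e.symm).right).inv :=
  e.transpose_whisker (X := (imageRegular e).toHMod) (u := (imageRegular e).lcoactHMod)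
    (hom_ext fun x => ((LinearEquiv.symm_apply_eq (assoc k C _ D)).2
      (LinearMap.congr_fun (imageRegular e).bicomod x).symm).symm)

/-- The morphism `C ⟶ M ⊗ N` of bicomodules for the images `M` of `C` and `N` of `D`. -/
noncomputable def regularHom : HBicomod.regular k H C ⟶
    HBicomod.ext (imageRegular e) (imageRegular e.symm) where
  lin := (regularMap e).lin
  comm_act := (regularMap e).comm_act
  lcomm := LinearMap.ext fun x =>
    (LinearEquiv.eq_symm_apply (assoc k C (imageRegular e).carrier (imageRegular e.symm).carrier)).1
      (LinearMap.congr_fun (congrArg Hom.lin (regularMap_lcoact e)) x)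
  rcomm := (regularMap e).comm

/-- Because `M □ D = M`, the coaction `M ⟶ M ⊗ D` has the universal property of an equalizer. This
is the equalizer to which the inverse equivalence is applied. -/
theorem exists_lift_rcoactRight (M : HBicomod k H C D) {W : HRComod k H D}
    (z : W ⟶ M.toHMod ⊙ₗ (HBicomod.regular k H D).right)
    (hz : z ≫ M.rcoactHMod ⊵ₗ _ =
      z ≫ M.toHMod ⊴ₗ (HBicomod.regular k H D).lcoactRight ≫ (αₗ _ _ _).inv) :
    ∃ w : W ⟶ M.right, w ≫ M.rcoactRight = z := by
  refine exists_lift M.rcoactRight M.rcoact_injective z fun x => ?_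
  refine (ker_coactionDiff_comul M.rcoassoc).le (LinearMap.mem_ker.2 (sub_eq_zero.2 ?_))
  exact LinearMap.congr_fun (congrArg Hom.lin hz) x

theorem rcoactRight_equalizes (M : HBicomod k H C D) :
    M.rcoactRight ≫ M.rcoactHMod ⊵ₗ (HBicomod.regular k H D).right =
      M.rcoactRight ≫ M.toHMod ⊴ₗ (HBicomod.regular k H D).lcoactRight ≫ (αₗ _ _ _).inv :=
  hom_ext fun x => (LinearEquiv.eq_symm_apply (assoc k M.carrier D D)).2
    (LinearMap.congr_fun M.rcoassoc x)

theorem regularMap_equalizes : regularMap e ≫ (imageRegular e).rcoactHMod ⊵ₗ _ =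
    regularMap e ≫ (imageRegular e).toHMod ⊴ₗ (imageRegular e.symm).lcoactRight ≫
      (αₗ _ _ _).inv :=
  e.transpose_equalizes (rcoactRight_equalizes (imageRegular e))

theorem mono_regularMap : Mono (regularMap e) :=
  e.mono_transpose (mono_of_injective (imageRegular e).rcoactRight
    (imageRegular e).rcoact_injective)

theorem regularHom_mem_ker (c : C) : (regularHom e).lin c ∈
    LinearMap.ker (HBicomod.cotensorDiff (imageRegular e) (imageRegular e.symm)) := by
  have h := LinearMap.congr_fun (congrArg Hom.lin (regularMap_equalizes e)) c
  exact sub_eq_zero.2 h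

/-- The inclusion of `M □ N` equalizes the two maps to `M ⊗ D ⊗ N`, and `regularMap` is universal
among such morphisms. -/
theorem exists_comp_regularMap : ∃ w : (HBicomod.cotensor (imageRegular e)
    (imageRegular e.symm)).right ⟶ (HBicomod.regular k H C).right,
    w ≫ regularMap e = HBicomod.cotensorInclRight _ _ := by
  refine e.exists_lift_transpose (fun W z => exists_lift_rcoactRight (imageRegular e) z)
    (HBicomod.cotensorInclRight (imageRegular e) (imageRegular e.symm))
    (hom_ext fun x => ?_)
  exact sub_eq_zero.1 x.2

theorem range_regularHom : LinearMap.range (regularHom e).lin =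
    LinearMap.ker (HBicomod.cotensorDiff (imageRegular e) (imageRegular e.symm)) := by
  obtain ⟨w, hw⟩ := exists_comp_regularMap e
  refine le_antisymm ?_ fun x hx => ?_
  · rintro _ ⟨c, rfl⟩
    exact regularHom_mem_ker e c
  · exact ⟨w.lin ⟨x, hx⟩, LinearMap.congr_fun (congrArg Hom.lin hw) ⟨x, hx⟩⟩

/-- A monomorphism of comodules is not immediately an injective map. Factoring `regularMap` through
`M □ N` as `v` and using the lift `w` of the inclusion, monicity gives `v ≫ w = 𝟙`, and this makes
`v` injective. -/
theorem injective_regularHom : Function.Injective (regularHom e).lin := by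
  obtain ⟨w, hw⟩ := exists_comp_regularMap e
  obtain ⟨v, hv⟩ := exists_lift (HBicomod.cotensorInclRight _ _)
    (HBicomod.incl_injective _ _) (regularMap e) fun c =>
      (HBicomod.range_incl _ _).ge (regularHom_mem_ker e c)
  have := mono_regularMap e
  have h : v ≫ w = 𝟙 _ := by rw [← cancel_mono (regularMap e), Category.assoc, hw, hv,
    Category.id_comp]
  have hv' : (HBicomod.incl (imageRegular e) (imageRegular e.symm)).lin ∘ₗ v.lin =
    (regularHom e).lin := congrArg Hom.lin hv
  rw [← hv']
  exact (HBicomod.incl_injective _ _).comp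
    (Function.LeftInverse.injective (LinearMap.congr_fun (congrArg Hom.lin h)))

/-- The isomorphism `M □ N ≅ C` for the images `M` of `C` and `N` of `D`. -/
noncomputable def cotensorImageIso : HBicomod.cotensor (imageRegular e) (imageRegular e.symm) ≅
    HBicomod.regular k H C :=
  HBicomod.isoOfRange (HBicomod.incl _ _) (regularHom e) (HBicomod.incl_injective _ _)
    (injective_regularHom e) ((HBicomod.range_incl _ _).trans (range_regularHom e).symm)

theorem exists_cotensor_iso_regular
    (h : LeftModuleEquivalent (HMod k H) (HRComod k H C) (HRComod k H D)) :
    ∃ (M : HBicomod k H C D) (N : HBicomod k H D C),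
      Nonempty (M.cotensor N ≅ HBicomod.regular k H C) ∧
      Nonempty (N.cotensor M ≅ HBicomod.regular k H D) := by
  obtain ⟨e⟩ := h.exists_equivalence
  -- Inverting `e` twice gives `e` back by definition, so the second isomorphism is the first one
  -- for `e.symm`.
  exact ⟨imageRegular e, imageRegular e.symm, ⟨cotensorImageIso e⟩, ⟨cotensorImageIso e.symm⟩⟩

end HRComod

end EqMT

namespace EqMT

open Functor MonoidalLeftAction MonoidalOpposite

attribute [local instance] monoidalOppositeLeftAction

variable {k H C D : Type u} [Field k] [Ring H] [Bialgebra k H]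
  [AddCommGroup C] [Module k C] [Coalgebra k C] [Module H C] [IsScalarTower k H C]
  [AddCommGroup D] [Module k D] [Coalgebra k D] [Module H D] [IsScalarTower k H D]

/-! ### From an equivalence of left comodules in `H`-modules to bicomodules -/

namespace HBicomod

/-- The right coaction as a morphism of left comodules. -/
def rcoactLeft [ModuleCoalgebra k H D] (M : HBicomod k H C D) :
    M.left ⟶ mop (regular k H D).toHMod ⊙ₗ M.left :=
  homLeft (rcoactHom M)

/-- The left coaction as a morphism of left comodules. -/
def lcoactLeft [ModuleCoalgebra k H C] (M : HBicomod k H C D) :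
    M.left ⟶ mop M.toHMod ⊙ₗ (regular k H C).left :=
  homLeft (lcoactHom M)

/-- The inclusion `M □ N ⟶ M ⊗ N` as a morphism of left comodules. -/
noncomputable def cotensorInclLeft (M : HBicomod k H C D) (N : HBicomod k H D C) :
    (cotensor M N).left ⟶ mop N.toHMod ⊙ₗ M.left :=
  homLeft (incl M N)

end HBicomod

namespace HLComod

variable [ModuleCoalgebra k H C]

/-- The bicomodule given by a right coaction in the category of left comodules. -/
def bicomod (P : HLComod k H D) (l : P ⟶ mop (HBicomod.regular k H C).toHMod ⊙ₗ P)
    (h : l ≫ _ ⊴ₗ l ≫ (αₗ _ _ P).inv = l ≫ (HBicomod.comulHMod k H C).mop ⊵ₗ P)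
    (h' : l ≫ (HBicomod.counitHMod k H C).mop ⊵ₗ P ≫ (λₗ P).hom = 𝟙 P) : HBicomod k H D C where
  carrier := P.carrier
  act := P.act
  lcoact := P.coact
  rcoact := l.lin
  lcoassoc := P.coassoc
  lcounit := P.counit
  rcoassoc := congrArg Hom.lin h
  rcounit := congrArg Hom.lin h'
  bicomod := l.comm
  lequivariant := P.equivariant
  requivariant := l.comm_act

variable (k H C) in
theorem regular_coassoc : (HBicomod.regular k H C).rcoactLeft ≫
    _ ⊴ₗ (HBicomod.regular k H C).rcoactLeft ≫ (αₗ _ _ _).inv =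
      (HBicomod.regular k H C).rcoactLeft ≫ (HBicomod.comulHMod k H C).mop ⊵ₗ _ := by
  refine hom_ext fun (c : C) => ?_
  exact Coalgebra.coassoc_apply (R := k) c

variable (k H C) in
theorem regular_counit : (HBicomod.regular k H C).rcoactLeft ≫
    (HBicomod.counitHMod k H C).mop ⊵ₗ (HBicomod.regular k H C).left ≫ (λₗ _).hom = 𝟙 _ := by
  refine hom_ext fun (c : C) => ?_
  exact LinearMap.congr_fun (HBicomod.regular k H C).rcounit c

/-- Now `C □ M = M` for the left coaction, with `C` on the side of the source category because `e`
will produce a bicomodule with the sides exchanged. -/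
theorem exists_lift_lcoactLeft (M : HBicomod k H C D) {W : HLComod k H C}
    (z : W ⟶ mop M.toHMod ⊙ₗ (HBicomod.regular k H C).left)
    (hz : z ≫ M.lcoactHMod.mop ⊵ₗ _ =
      z ≫ mop M.toHMod ⊴ₗ (HBicomod.regular k H C).rcoactLeft ≫ (αₗ _ _ _).inv) :
    ∃ w : W ⟶ M.left, w ≫ M.lcoactLeft = z := by
  refine exists_lift M.lcoactLeft M.lcoact_injective z fun x => ?_
  refine (ker_coactionDiff_comul_left M.lcoassoc).le (LinearMap.mem_ker.2 (sub_eq_zero.2 ?_))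
  exact (LinearEquiv.eq_symm_apply (assoc k C C M.carrier)).2
    (LinearMap.congr_fun (congrArg Hom.lin hz) x).symm

theorem lcoactLeft_equalizes (M : HBicomod k H C D) :
    M.lcoactLeft ≫ M.lcoactHMod.mop ⊵ₗ (HBicomod.regular k H C).left =
      M.lcoactLeft ≫ mop M.toHMod ⊴ₗ (HBicomod.regular k H C).rcoactLeft ≫ (αₗ _ _ _).inv :=
  hom_ext fun x => (LinearMap.congr_fun M.lcoassoc x).symm

variable [ModuleCoalgebra k H D]
  (e : LeftModuleEquivalence (HMod k H)ᴹᵒᵖ (HLComod k H C) (HLComod k H D))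

/-- The image of the bicomodule `C` under an equivalence of module categories. -/
noncomputable def imageRegular : HBicomod k H D C :=
  bicomod (e.F.obj (HBicomod.regular k H C).left)
    (e.coactMap (HBicomod.regular k H C).rcoactLeft)
    (e.coactMap_coassoc (regular_coassoc k H C)) (e.coactMap_counit (regular_counit k H C))

/-- The morphism `C ⟶ N ⊗ M` of left comodules for the images `M` of `C` and `N` of `D`. -/
noncomputable def regularMap : (HBicomod.regular k H C).left ⟶
    mop (imageRegular e).toHMod ⊙ₗ (imageRegular e.symm).left :=
  e.transpose (A := (HBicomod.regular k H C).left) (B := (HBicomod.regular k H D).left)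
    (X := mop (imageRegular e).toHMod) (imageRegular e).lcoactLeft

theorem regularMap_rcoact : regularMap e ≫ (imageRegular e).rcoactHMod.mop ⊵ₗ _ =
    (HBicomod.regular k H C).rcoactLeft ≫
      _ ⊴ₗ regularMap e ≫ (αₗ _ _ (imageRegular e.symm).left).inv :=
  e.transpose_whisker (X := mop (imageRegular e).toHMod) (u := (imageRegular e).rcoactHMod.mop)
    (hom_ext fun x => (LinearMap.congr_fun (imageRegular e).bicomod x).symm)

/-- The morphism `C ⟶ N ⊗ M` of bicomodules for the images `M` of `C` and `N` of `D`. -/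
noncomputable def regularHom : HBicomod.regular k H C ⟶
    HBicomod.ext (imageRegular e.symm) (imageRegular e) where
  lin := (regularMap e).lin
  comm_act := (regularMap e).comm_act
  lcomm := (regularMap e).comm
  rcomm := LinearMap.ext fun x =>
    (LinearEquiv.symm_apply_eq (assoc k (imageRegular e.symm).carrier (imageRegular e).carrier C)).2
      (LinearMap.congr_fun (congrArg Hom.lin (regularMap_rcoact e)) x)

theorem regularMap_equalizes : regularMap e ≫ (imageRegular e).lcoactHMod.mop ⊵ₗ _ =
    regularMap e ≫ mop (imageRegular e).toHMod ⊴ₗ (imageRegular e.symm).rcoactLeft ≫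
      (αₗ _ _ _).inv :=
  e.transpose_equalizes (lcoactLeft_equalizes (imageRegular e))

theorem mono_regularMap : Mono (regularMap e) :=
  e.mono_transpose (mono_of_injective (imageRegular e).lcoactLeft
    (imageRegular e).lcoact_injective)

theorem regularHom_mem_ker (c : C) : (regularHom e).lin c ∈
    LinearMap.ker (HBicomod.cotensorDiff (imageRegular e.symm) (imageRegular e)) := by
  have h := LinearMap.congr_fun (congrArg Hom.lin (regularMap_equalizes e)) c
  exact sub_eq_zero.2 ((LinearEquiv.eq_symm_apply
    (assoc k (imageRegular e.symm).carrier D (imageRegular e).carrier)).2 h.symm)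

theorem exists_comp_regularMap : ∃ w : (HBicomod.cotensor (imageRegular e.symm)
    (imageRegular e)).left ⟶ (HBicomod.regular k H C).left,
    w ≫ regularMap e = HBicomod.cotensorInclLeft _ _ := by
  refine e.exists_lift_transpose (fun W z => exists_lift_lcoactLeft (imageRegular e) z)
    (HBicomod.cotensorInclLeft (imageRegular e.symm) (imageRegular e))
    (hom_ext fun x => ?_)
  exact ((LinearEquiv.eq_symm_apply
    (assoc k (imageRegular e.symm).carrier D (imageRegular e).carrier)).1 (sub_eq_zero.1 x.2)).symm

theorem range_regularHom : LinearMap.range (regularHom e).lin =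
    LinearMap.ker (HBicomod.cotensorDiff (imageRegular e.symm) (imageRegular e)) := by
  obtain ⟨w, hw⟩ := exists_comp_regularMap e
  refine le_antisymm ?_ fun x hx => ?_
  · rintro _ ⟨c, rfl⟩
    exact regularHom_mem_ker e c
  · exact ⟨w.lin ⟨x, hx⟩, LinearMap.congr_fun (congrArg Hom.lin hw) ⟨x, hx⟩⟩

theorem injective_regularHom : Function.Injective (regularHom e).lin := by
  obtain ⟨w, hw⟩ := exists_comp_regularMap e
  obtain ⟨v, hv⟩ := exists_lift (HBicomod.cotensorInclLeft _ _)
    (HBicomod.incl_injective _ _) (regularMap e) fun c =>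
      (HBicomod.range_incl _ _).ge (regularHom_mem_ker e c)
  have := mono_regularMap e
  have h : v ≫ w = 𝟙 _ := by rw [← cancel_mono (regularMap e), Category.assoc, hw, hv,
    Category.id_comp]
  have hv' : (HBicomod.incl (imageRegular e.symm) (imageRegular e)).lin ∘ₗ v.lin =
    (regularHom e).lin := congrArg Hom.lin hv
  rw [← hv']
  exact (HBicomod.incl_injective _ _).comp
    (Function.LeftInverse.injective (LinearMap.congr_fun (congrArg Hom.lin h)))

/-- The isomorphism `N □ M ≅ C` for the images `M` of `C` and `N` of `D`. -/
noncomputable def cotensorImageIso : HBicomod.cotensor (imageRegular e.symm) (imageRegular e) ≅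
    HBicomod.regular k H C :=
  HBicomod.isoOfRange (HBicomod.incl _ _) (regularHom e) (HBicomod.incl_injective _ _)
    (injective_regularHom e) ((HBicomod.range_incl _ _).trans (range_regularHom e).symm)

theorem exists_cotensor_iso_regular
    (h : RightModuleEquivalent (HMod k H) (HLComod k H C) (HLComod k H D)) :
    ∃ (M : HBicomod k H C D) (N : HBicomod k H D C),
      Nonempty (M.cotensor N ≅ HBicomod.regular k H C) ∧
      Nonempty (N.cotensor M ≅ HBicomod.regular k H D) := by
  obtain ⟨e⟩ := h.exists_equivalence
  -- The image of `C` is a left `D`-comodule with right `C`-coaction, so it plays the role of `N`.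
  exact ⟨imageRegular e.symm, imageRegular e, ⟨cotensorImageIso e⟩, ⟨cotensorImageIso e.symm⟩⟩

end HLComod

end EqMT

namespace EqMT

/-! ### Diagonal actions expressed by the exchange map `h ⊗ v ↦ h₍₁₎ v ⊗ h₍₂₎` -/

section SwapAct

variable {k H : Type u} [Field k] [Ring H] [Bialgebra k H]
  {V W : Type u} [AddCommGroup V] [Module k V] [AddCommGroup W] [Module k W]

theorem diagAct_eq (φ : H →ₐ[k] Module.End k V) (ψ : H →ₐ[k] Module.End k W) (h : H)
    (t : V ⊗[k] W) : diagAct φ ψ h t = TensorProduct.map (actMap φ) (actMap ψ)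
      (tensorTensorTensorComm k H H V W (comul (R := k) h ⊗ₜ t)) := by
  refine indOn t (by simp) (fun v w => ?_)
    (fun _ _ hx hy => by simp only [tmul_add, map_add, hx, hy])
  rw [diagAct_tmul]
  generalize comul (R := k) h = s
  refine indOn s (by simp) (fun a b => ?_)
    (fun _ _ hx hy => by simp only [add_tmul, map_add, hx, hy])
  simp

/-- The map `h ⊗ v ↦ h₍₁₎ v ⊗ h₍₂₎`. -/
def swapAct (φ : H →ₐ[k] Module.End k V) : H ⊗[k] V →ₗ[k] V ⊗[k] H :=
  (actMap φ).rTensor H ∘ₗ (TensorProduct.rightComm k H H V).toLinearMap ∘ₗ comul.rTensor V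

/-- The diagonal action is performed in two moves: `h₍₁₎` acts on `V` while `h₍₂₎` passes over, then
`h₍₂₎` acts on `W`. In this form it can be written with morphisms of comodules, the first move by
`swapActHom`. -/
theorem swapAct_diagAct (φ : H →ₐ[k] Module.End k V) (ψ : H →ₐ[k] Module.End k W) (h : H)
    (t : V ⊗[k] W) : (actMap ψ).lTensor V (assoc k V H W ((swapAct φ).rTensor W
      ((assoc k H V W).symm (h ⊗ₜ t)))) = diagAct φ ψ h t := by
  refine indOn t (by simp) (fun v w => ?_)
    (fun _ _ hx hy => by simp only [tmul_add, map_add, hx, hy])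
  rw [diagAct_tmul]
  simp only [TensorProduct.assoc_symm_tmul, LinearMap.rTensor_tmul, swapAct, LinearMap.comp_apply]
  generalize comul (R := k) h = s
  refine indOn s (by simp) (fun a b => ?_)
    (fun _ _ hx hy => by simp only [add_tmul, map_add, hx, hy])
  simp

/-- Both sides are `h₍₁₎ v ⊗ h₍₂₎ ⊗ h₍₃₎`. This is colinearity of the exchange map when `V` is a
trivial comodule and `H` the regular one. -/
theorem swapAct_comul (φ : H →ₐ[k] Module.End k V) (h : H) (v : V) :
    (assoc k V H H).symm (comul.lTensor V (swapAct φ (h ⊗ₜ v))) =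
      (swapAct φ).rTensor H (TensorProduct.rightComm k H H V (comul (R := k) h ⊗ₜ v)) := by
  have h1 : ∀ s : H ⊗[k] H, (assoc k V H H).symm (comul.lTensor V ((actMap φ).rTensor H
      (TensorProduct.rightComm k H H V (s ⊗ₜ v)))) =
      ((actMap φ).rTensor H ∘ₗ (TensorProduct.rightComm k H H V).toLinearMap ∘ₗ
        (TensorProduct.mk k (H ⊗[k] H) V).flip v).rTensor H
        ((assoc k H H H).symm (comul.lTensor H s)) := by
    intro s
    refine indOn s (by simp) (fun a b => ?_)
      (fun _ _ hx hy => by simp only [add_tmul, map_add, hx, hy])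
    simp only [TensorProduct.rightComm_tmul, LinearMap.rTensor_tmul, LinearMap.lTensor_tmul]
    generalize comul (R := k) b = t
    refine indOn t (by simp) (fun a b => ?_)
      (fun _ _ hx hy => by simp only [tmul_add, map_add, hx, hy])
    simp
  have h2 : ∀ s : H ⊗[k] H, (swapAct φ).rTensor H (TensorProduct.rightComm k H H V (s ⊗ₜ v)) =
      ((actMap φ).rTensor H ∘ₗ (TensorProduct.rightComm k H H V).toLinearMap ∘ₗ
        (TensorProduct.mk k (H ⊗[k] H) V).flip v).rTensor H (comul.rTensor H s) := by
    intro s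
    refine indOn s (by simp) (fun a b => ?_)
      (fun _ _ hx hy => by simp only [add_tmul, map_add, hx, hy])
    simp [swapAct]
  rw [h2, ← Coalgebra.coassoc_symm_apply, ← h1]
  simp [swapAct]

theorem rightComm_eq_mulCoact (t : H ⊗[k] H) (v : V) :
    TensorProduct.rightComm k H H V (t ⊗ₜ v) = mulCoact k H H H V (t ⊗ₜ (v ⊗ₜ 1)) := by
  refine indOn t (by simp) (fun m c => ?_)
    (fun _ _ hx hy => by simp only [add_tmul, map_add, hx, hy])
  simp

variable {C : Type u} [AddCommGroup C] [Module k C] [Module H C] [IsScalarTower k H C]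

theorem mulCoact_one (v : V) (t : W ⊗[k] C) :
    mulCoact k H C V W ((v ⊗ₜ 1) ⊗ₜ t) = (assoc k V W C).symm (v ⊗ₜ t) := by
  refine indOn t (by simp) (fun m c => ?_)
    (fun _ _ hx hy => by simp only [tmul_add, map_add, hx, hy])
  simp

/-- Hence equivariance of a coaction on `V` is the same as colinearity of `H ⊗ V → V` for the
regular comodule `H`. -/
theorem rTensor_mulCoact_comul (φ : H →ₐ[k] Module.End k V) (h : H) (t : V ⊗[k] C) :
    (actMap φ).rTensor C (mulCoact k H C H V (comul (R := k) h ⊗ₜ t)) =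
      diagAct φ (Algebra.lsmul k k C) h t := by
  rw [diagAct_eq]
  generalize comul (R := k) h = s
  refine indOn s (by simp) (fun a b => ?_)
    (fun _ _ hx hy => by simp only [add_tmul, map_add, hx, hy])
  refine indOn t (by simp) (fun m c => ?_)
    (fun _ _ hx hy => by simp only [tmul_add, map_add, hx, hy])
  simp

/-- The action of `H` given by a unital and associative map `H ⊗ V → V`. -/
def actOfMul (f : H ⊗[k] V →ₗ[k] V) (hmul : ∀ h h' v, f (h ⊗ₜ f (h' ⊗ₜ v)) = f ((h * h') ⊗ₜ v))
    (hone : ∀ v, f (1 ⊗ₜ v) = v) : H →ₐ[k] Module.End k V :=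
  AlgHom.ofLinearMap (TensorProduct.curry f) (LinearMap.ext hone)
    fun h h' => LinearMap.ext fun v => (hmul h h' v).symm

theorem actMap_actOfMul (f : H ⊗[k] V →ₗ[k] V)
    (hmul : ∀ h h' v, f (h ⊗ₜ f (h' ⊗ₜ v)) = f ((h * h') ⊗ₜ v)) (hone : ∀ v, f (1 ⊗ₜ v) = v) :
    actMap (actOfMul f hmul hone) = f :=
  TensorProduct.ext' fun _ _ => rfl

section ActOfMul

variable {f : H ⊗[k] V →ₗ[k] V} {hmul : ∀ h h' v, f (h ⊗ₜ f (h' ⊗ₜ v)) = f ((h * h') ⊗ₜ v)}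
  {hone : ∀ v, f (1 ⊗ₜ v) = v}

/-- The passage back: an identity between composites of transported morphisms becomes equivariance
for the diagonal action. -/
theorem actOfMul_lequivariant {l : V →ₗ[k] C ⊗[k] V}
    (hl : ∀ h v, l (f (h ⊗ₜ v)) = f.lTensor C (assoc k C H V
      ((swapAct (Algebra.lsmul k k C)).rTensor V ((assoc k H C V).symm (h ⊗ₜ l v))))) (h : H) :
    l ∘ₗ actOfMul f hmul hone h =
      diagAct (Algebra.lsmul k k C) (actOfMul f hmul hone) h ∘ₗ l :=
  LinearMap.ext fun v => by
    rw [LinearMap.comp_apply, LinearMap.comp_apply, ← swapAct_diagAct, actMap_actOfMul]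
    exact hl h v

theorem actOfMul_requivariant {r : V →ₗ[k] V ⊗[k] C}
    (hr : ∀ h v, r (f (h ⊗ₜ v)) =
      f.rTensor C (mulCoact k H C H V (comul (R := k) h ⊗ₜ r v))) (h : H) :
    r ∘ₗ actOfMul f hmul hone h =
      diagAct (actOfMul f hmul hone) (Algebra.lsmul k k C) h ∘ₗ r :=
  LinearMap.ext fun v => by
    rw [LinearMap.comp_apply, LinearMap.comp_apply, ← rTensor_mulCoact_comul, actMap_actOfMul]
    exact hr h v

end ActOfMul

end SwapAct

/-! ### Trivial and regular right comodules -/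

namespace RComod

open Functor MonoidalLeftAction

section Trivial

variable {k H C : Type u} [Field k] [Ring H] [Bialgebra k H]
  [AddCommGroup C] [Module k C] [Coalgebra k C] [Module H C] [IsScalarTower k H C]
  (V W : Type u) [AddCommGroup V] [Module k V] [AddCommGroup W] [Module k W]

variable (k C) in
/-- The coalgebra `C` as a right comodule over itself. -/
def regular : RComod k C where
  carrier := C
  coact := comul
  coassoc := Coalgebra.coassoc
  counit := by
    refine LinearMap.ext fun c => ?_
    simp

variable (k H) in
/-- The trivial comodule on a vector space. -/
def triv : RComod k H where
  carrier := V
  coact := (TensorProduct.mk k V H).flip 1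
  coassoc := by
    ext v
    simp [Algebra.TensorProduct.one_def]
  counit := by
    ext v
    simp

variable [ModuleCoalgebra k H C]

/-- Since `1` acts as the identity, a trivial comodule contributes nothing to the coaction: trivial
comodules act like bare vector spaces. -/
theorem coact_tens_triv (Y : RComod k C) : (tens (triv k H V) Y).coact =
    (assoc k V Y.carrier C).symm.toLinearMap ∘ₗ Y.coact.lTensor V :=
  TensorProduct.ext' fun v y => mulCoact_one v (Y.coact y)

theorem coact_tens_triv_triv : (tens (triv k H V) (triv k H W)).coact =
    (TensorProduct.mk k (V ⊗[k] W) H).flip 1 := by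
  rw [coact_tens_triv]
  exact TensorProduct.ext' fun v w => rfl

variable {V W} in
/-- A linear map `V → W ⊗ W'` as a morphism of trivial comodules. -/
def trivHom {W' : Type u} [AddCommGroup W'] [Module k W'] (f : V →ₗ[k] W ⊗[k] W') :
    triv k H V ⟶ triv k H W ⊗ triv k H W' where
  lin := f
  comm := (congrArg (· ∘ₗ f) (coact_tens_triv_triv W W')).trans (LinearMap.ext fun _ => rfl)

variable {V} in
/-- A linear form as a morphism of trivial comodules. -/
def trivForm (f : V →ₗ[k] k) : triv k H V ⟶ 𝟙_ (RComod k H) where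
  lin := f
  comm := LinearMap.ext fun v => by
    change f v • ((1 : k) ⊗ₜ[k] (1 : H)) = f v ⊗ₜ 1
    simp [TensorProduct.smul_tmul']

variable {V} in
/-- The morphism `H ⊗ V ⟶ V ⊗ H`, `h ⊗ v ↦ h₍₁₎ v ⊗ h₍₂₎`. -/
def swapActHom (φ : H →ₐ[k] Module.End k V) :
    regular k H ⊗ triv k H V ⟶ triv k H V ⊗ regular k H where
  lin := (swapAct φ : H ⊗[k] V →ₗ[k] V ⊗[k] H)
  comm := by
    refine (congrArg (· ∘ₗ swapAct φ) (coact_tens_triv V (regular k H))).trans ?_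
    refine TensorProduct.ext' fun h v => (swapAct_comul φ h v).trans (congrArg _ ?_)
    exact rightComm_eq_mulCoact _ v

/-- The action of `H` as a morphism of comodules. -/
def actHom (P : HRComod k H C) : regular k H ⊙ₗ P.toRComod ⟶ P.toRComod where
  lin := (actMap P.act : H ⊗[k] P.carrier →ₗ[k] P.carrier)
  comm := TensorProduct.ext' fun h x => (LinearMap.congr_fun (P.equivariant h) x).trans
    (rTensor_mulCoact_comul P.act h (P.coact x)).symm

variable (k H) in
/-- The unit of `H` as a morphism of comodules. -/
def oneHom : 𝟙_ (RComod k H) ⟶ regular k H where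
  lin := (Algebra.linearMap k H : k →ₗ[k] H)
  comm := LinearMap.ext_ring (by
    change comul (R := k) (A := H) (algebraMap k H 1) =
      (Algebra.linearMap k H).rTensor H ((1 : k) • ((1 : k) ⊗ₜ[k] (1 : H)))
    simp [Algebra.TensorProduct.one_def])

variable (k H) in
/-- The multiplication of `H` as a morphism of comodules. -/
def mulHom : regular k H ⊗ regular k H ⟶ regular k H :=
  actHom (HBicomod.regular k H H).right

end Trivial

end RComod

end EqMT

namespace EqMT

open Functor MonoidalLeftAction

variable {k H C D : Type u} [Field k] [Ring H] [Bialgebra k H]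
  [AddCommGroup C] [Module k C] [Coalgebra k C] [Module H C] [IsScalarTower k H C]
  [AddCommGroup D] [Module k D] [Coalgebra k D] [Module H D] [IsScalarTower k H D]

/-! ### From an equivalence of right comodules over right `H`-comodules to bicomodules -/

namespace HBicomod

/-- The left coaction as a morphism of trivial right comodules. -/
def lcoactTriv (M : HBicomod k H C D) : RComod.triv k H M.carrier ⟶
    RComod.triv k H C ⊗ RComod.triv k H M.carrier :=
  RComod.trivHom M.lcoact

/-- The right coaction as a morphism of trivial right comodules. -/
def rcoactTriv (M : HBicomod k H C D) : RComod.triv k H M.carrier ⟶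
    RComod.triv k H M.carrier ⊗ RComod.triv k H D :=
  RComod.trivHom M.rcoact

/-- The left coaction as a morphism of right comodules. -/
def lcoactRComod [ModuleCoalgebra k H D] (M : HBicomod k H C D) :
    M.right.toRComod ⟶ RComod.triv k H C ⊙ₗ M.right.toRComod where
  lin := M.lcoact
  comm := (congrArg (· ∘ₗ M.lcoact) (RComod.coact_tens_triv C M.right.toRComod)).trans
    (LinearMap.ext fun x => (LinearEquiv.symm_apply_eq (assoc k C M.carrier D)).2
      (LinearMap.congr_fun M.bicomod x).symm)

/-- The right coaction as a morphism of right comodules. -/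
def rcoactRComod [ModuleCoalgebra k H D] (M : HBicomod k H C D) :
    M.right.toRComod ⟶ RComod.triv k H M.carrier ⊙ₗ RComod.regular k D where
  lin := M.rcoact
  comm := (congrArg (· ∘ₗ M.rcoact) (RComod.coact_tens_triv M.carrier (RComod.regular k D))).trans
    (LinearMap.ext fun x => (LinearEquiv.symm_apply_eq (assoc k M.carrier D D)).2
      (LinearMap.congr_fun M.rcoassoc x).symm)

/-- The inclusion `M □ N ⟶ M ⊗ N` as a morphism of right comodules. -/
noncomputable def cotensorInclRComod [ModuleCoalgebra k H C] (M : HBicomod k H C D)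
    (N : HBicomod k H D C) :
    (cotensor M N).right.toRComod ⟶ RComod.triv k H M.carrier ⊙ₗ N.right.toRComod where
  lin := (incl M N).lin
  comm := (congrArg (· ∘ₗ (incl M N).lin) (RComod.coact_tens_triv M.carrier N.right.toRComod)).trans
    (incl M N).rcomm

end HBicomod

namespace RComod

/-- The bicomodule given by a left coaction and an action of `H` in the category of right
comodules. -/
def bicomod [ModuleCoalgebra k H D] (P : RComod k D) (l : P ⟶ triv k H C ⊙ₗ P)
    (a : regular k H ⊙ₗ P ⟶ P)
    (h : l ≫ _ ⊴ₗ l ≫ (αₗ _ _ P).inv = l ≫ trivHom (comul (R := k) (A := C)) ⊵ₗ P)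
    (h' : l ≫ trivForm (CoalgebraStruct.counit (R := k) (A := C)) ⊵ₗ P ≫ (λₗ P).hom = 𝟙 P)
    (hmul : (αₗ _ _ P).hom ≫ regular k H ⊴ₗ a ≫ a = mulHom k H ⊵ₗ P ≫ a)
    (hone : (λₗ P).inv ≫ oneHom k H ⊵ₗ P ≫ a = 𝟙 P)
    (hla : a ≫ l = regular k H ⊴ₗ l ≫ (αₗ _ _ P).inv ≫ swapActHom (Algebra.lsmul k k C) ⊵ₗ P ≫
      (αₗ _ _ P).hom ≫ triv k H C ⊴ₗ a) : HBicomod k H C D where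
  carrier := P.carrier
  act := actOfMul (a.lin : H ⊗[k] P.carrier →ₗ[k] P.carrier)
    (fun (h : H) (h' : H) x =>
      LinearMap.congr_fun (congrArg Hom.lin hmul) ((h ⊗ₜ[k] h') ⊗ₜ[k] x))
    (fun x => by
      have h := LinearMap.congr_fun (congrArg Hom.lin hone) x
      change a.lin ((algebraMap k H 1) ⊗ₜ[k] x) = x at h
      rwa [map_one] at h)
  lcoact := l.lin
  rcoact := P.coact
  lcoassoc := LinearMap.ext fun x =>
    ((LinearEquiv.symm_apply_eq (assoc k C C P.carrier)).1
      (LinearMap.congr_fun (congrArg Hom.lin h) x)).symm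
  lcounit := congrArg Hom.lin h'
  rcoassoc := P.coassoc
  rcounit := P.counit
  bicomod := LinearMap.ext fun x => by
    have h := LinearMap.congr_fun (l.comm.symm.trans
      (congrArg (· ∘ₗ l.lin) (coact_tens_triv C P))) x
    exact (LinearEquiv.eq_symm_apply (assoc k C P.carrier D)).1 h
  -- The two equivariance conditions have different origins. The left one is the transported
  -- exchange identity, the right one is colinearity of the action morphism itself.
  lequivariant := actOfMul_lequivariant (C := C) 
    (l := show P.carrier →ₗ[k] C ⊗[k] P.carrier from l.lin) fun (h : H) x =>
    LinearMap.congr_fun (congrArg Hom.lin hla) (h ⊗ₜ[k] x)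
  requivariant := actOfMul_requivariant fun (h : H) x => LinearMap.congr_fun a.comm (h ⊗ₜ[k] x)

variable [ModuleCoalgebra k H C]

variable (k H C) in
/-- The comultiplication as a left coaction on the right comodule `C`. -/
def comulHom : regular k C ⟶ triv k H C ⊙ₗ regular k C :=
  (HBicomod.regular k H C).lcoactRComod

variable (k H C) in
theorem comulHom_coassoc : comulHom k H C ≫ _ ⊴ₗ comulHom k H C ≫ (αₗ _ _ _).inv =
    comulHom k H C ≫ trivHom (comul (R := k) (A := C)) ⊵ₗ _ := by
  refine hom_ext fun (c : C) => ?_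
  exact Coalgebra.coassoc_symm_apply (R := k) c

variable (k H C) in
theorem comulHom_counit : comulHom k H C ≫
    trivForm (CoalgebraStruct.counit (R := k) (A := C)) ⊵ₗ _ ≫ (λₗ _).hom = 𝟙 _ := by
  refine hom_ext fun (c : C) => ?_
  exact LinearMap.congr_fun (HBicomod.regular k H C).lcounit c

variable (k H C) in
/-- The action of `H` on `C` as a morphism of right comodules. -/
def smulHom : regular k H ⊙ₗ regular k C ⟶ regular k C :=
  actHom (HBicomod.regular k H C).right

variable (k H C) in
theorem smulHom_mul : (αₗ _ _ _).hom ≫ regular k H ⊴ₗ smulHom k H C ≫ smulHom k H C =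
    mulHom k H ⊵ₗ regular k C ≫ smulHom k H C :=
  Hom.ext (ext_threefold fun (h : H) (h' : H) (c : C) => (mul_smul h h' c).symm)

variable (k H C) in
theorem smulHom_one :
    (λₗ _).inv ≫ oneHom k H ⊵ₗ regular k C ≫ smulHom k H C = 𝟙 _ := by
  refine hom_ext fun (c : C) => ?_
  change algebraMap k H 1 • c = c
  simp

-- The module coalgebra condition `Δ(h c) = h₍₁₎ c₍₁₎ ⊗ h₍₂₎ c₍₂₎` as an identity of morphisms in
-- the module category, ready for `actionMap_coactMap`.
variable (k H C) in
theorem smulHom_comulHom : smulHom k H C ≫ comulHom k H C =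
    regular k H ⊴ₗ comulHom k H C ≫ (αₗ _ _ (regular k C)).inv ≫
      swapActHom (Algebra.lsmul k k C) ⊵ₗ regular k C ≫ (αₗ _ _ (regular k C)).hom ≫
        triv k H C ⊴ₗ smulHom k H C :=
  Hom.ext (TensorProduct.ext' fun (h : H) (c : C) =>
    (LinearMap.congr_fun ((HBicomod.regular k H C).lequivariant h) c).trans
      (swapAct_diagAct (Algebra.lsmul k k C) (Algebra.lsmul k k C) h
        (comul (R := k) (A := C) c)).symm)

/-- Right equivariance of `M`, with its bare vector space as trivial comodule. Transposed, it yields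
`H`-linearity of `C ⟶ M ⊗ N`. -/
theorem actHom_rcoact (M : HBicomod k H D C) : actHom M.right ≫ M.rcoactRComod =
    regular k H ⊴ₗ M.rcoactRComod ≫ (αₗ _ _ (regular k C)).inv ≫
      swapActHom M.act ⊵ₗ regular k C ≫ (αₗ _ _ (regular k C)).hom ≫
        triv k H M.carrier ⊴ₗ smulHom k H C :=
  Hom.ext (TensorProduct.ext' fun (h : H) (x : M.carrier) =>
    (LinearMap.congr_fun (M.requivariant h) x).trans
      (swapAct_diagAct M.act (Algebra.lsmul k k C) h (M.rcoact x)).symm)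

theorem lcoact_rcoact (M : HBicomod k H D C) :
    M.rcoactRComod ≫ M.lcoactTriv ⊵ₗ regular k C =
      M.lcoactRComod ≫ triv k H D ⊴ₗ M.rcoactRComod ≫ (αₗ _ _ (regular k C)).inv :=
  hom_ext fun x => ((LinearEquiv.symm_apply_eq (assoc k D _ C)).2
    (LinearMap.congr_fun M.bicomod x).symm).symm

/-- Again `M □ D = M` up to names. The object acting is now the trivial comodule on `M`, since the
remaining structure of `M` is not seen by `H`-comodules. -/
theorem exists_lift_rcoact (M : HBicomod k H D C) {W : RComod k C}
    (z : W ⟶ triv k H M.carrier ⊙ₗ regular k C)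
    (hz : z ≫ M.rcoactTriv ⊵ₗ _ =
      z ≫ triv k H M.carrier ⊴ₗ comulHom k H C ≫ (αₗ _ _ _).inv) :
    ∃ w : W ⟶ M.right.toRComod, w ≫ M.rcoactRComod = z := by
  refine exists_lift M.rcoactRComod M.rcoact_injective z fun x => ?_
  refine (ker_coactionDiff_comul M.rcoassoc).le (LinearMap.mem_ker.2 (sub_eq_zero.2 ?_))
  exact LinearMap.congr_fun (congrArg Hom.lin hz) x

theorem rcoact_equalizes (M : HBicomod k H D C) :
    M.rcoactRComod ≫ M.rcoactTriv ⊵ₗ regular k C =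
      M.rcoactRComod ≫ triv k H M.carrier ⊴ₗ comulHom k H C ≫ (αₗ _ _ _).inv :=
  hom_ext fun x => (LinearEquiv.eq_symm_apply (assoc k M.carrier C C)).2
    (LinearMap.congr_fun M.rcoassoc x)

variable [ModuleCoalgebra k H D]
  (e : LeftModuleEquivalence (RComod k H) (RComod k C) (RComod k D))

/-- The image of the bicomodule `C` under an equivalence of module categories. -/
noncomputable def imageRegular : HBicomod k H C D :=
  bicomod (e.F.obj (regular k C)) (e.coactMap (comulHom k H C))
    (e.actionMap (smulHom k H C))
    (e.coactMap_coassoc (comulHom_coassoc k H C)) (e.coactMap_counit (comulHom_counit k H C))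
    (e.actionMap_mul (smulHom_mul k H C)) (e.actionMap_one (smulHom_one k H C))
    (e.actionMap_coactMap (smulHom_comulHom k H C))

theorem actHom_imageRegular : actHom (imageRegular e).right =
    e.actionMap (smulHom k H C) :=
  Hom.ext (TensorProduct.ext' fun (_ : H) (_ : (e.F.obj (regular k C)).carrier) => rfl)

/-- The morphism `C ⟶ M ⊗ N` of right comodules for the images `M` of `C` and `N` of `D`. -/
noncomputable def regularMap : regular k C ⟶
    triv k H (imageRegular e).carrier ⊙ₗ (imageRegular e.symm).right.toRComod :=
  e.transpose (A := regular k C) (B := regular k D)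
    (X := triv k H (imageRegular e).carrier) ((imageRegular e).rcoactRComod)

theorem regularMap_lcoact : regularMap e ≫ (imageRegular e).lcoactTriv ⊵ₗ _ =
    comulHom k H C ≫ _ ⊴ₗ regularMap e ≫ (αₗ _ _ (imageRegular e.symm).right.toRComod).inv :=
  e.transpose_whisker (X := triv k H (imageRegular e).carrier) (u := (imageRegular e).lcoactTriv)
    (lcoact_rcoact (imageRegular e))

/-- In `H`-modules linearity was part of being a morphism; here it has to be transported separately.
-/
theorem actHom_regularMap : smulHom k H C ≫ regularMap e =
    regular k H ⊴ₗ regularMap e ≫ (αₗ _ _ (imageRegular e.symm).right.toRComod).inv ≫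
      swapActHom (imageRegular e).act ⊵ₗ (imageRegular e.symm).right.toRComod ≫
      (αₗ _ _ (imageRegular e.symm).right.toRComod).hom ≫
        triv k H (imageRegular e).carrier ⊴ₗ actHom (imageRegular e.symm).right := by
  have h := actHom_rcoact (imageRegular e)
  rw [actHom_imageRegular] at h
  rw [actHom_imageRegular]
  exact e.action_transpose (X := triv k H (imageRegular e).carrier) h

/-- The morphism `C ⟶ M ⊗ N` of bicomodules for the images `M` of `C` and `N` of `D`. -/
noncomputable def regularHom : HBicomod.regular k H C ⟶
    HBicomod.ext (imageRegular e) (imageRegular e.symm) where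
  lin := (regularMap e).lin
  comm_act h := LinearMap.ext fun (c : C) => by
    have h1 := LinearMap.congr_fun (congrArg Hom.lin (actHom_regularMap e))
      ((show H from h) ⊗ₜ[k] c)
    refine h1.trans ?_
    exact swapAct_diagAct (imageRegular e).act (imageRegular e.symm).act h ((regularMap e).lin c)
  lcomm := LinearMap.ext fun x =>
    (LinearEquiv.eq_symm_apply (assoc k C (imageRegular e).carrier (imageRegular e.symm).carrier)).1
      (LinearMap.congr_fun (congrArg Hom.lin (regularMap_lcoact e)) x)
  rcomm := (congrArg (· ∘ₗ (regularMap e).lin)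
    (coact_tens_triv (imageRegular e).carrier (imageRegular e.symm).right.toRComod)).symm.trans
      (regularMap e).comm

theorem regularMap_equalizes : regularMap e ≫ (imageRegular e).rcoactTriv ⊵ₗ _ =
    regularMap e ≫ triv k H (imageRegular e).carrier ⊴ₗ (imageRegular e.symm).lcoactRComod ≫
      (αₗ _ _ _).inv :=
  e.transpose_equalizes (rcoact_equalizes (imageRegular e))

theorem mono_regularMap : Mono (regularMap e) :=
  e.mono_transpose (mono_of_injective (imageRegular e).rcoactRComod
    (imageRegular e).rcoact_injective)

theorem regularHom_mem_ker (c : C) : (regularHom e).lin c ∈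
    LinearMap.ker (HBicomod.cotensorDiff (imageRegular e) (imageRegular e.symm)) := by
  have h := LinearMap.congr_fun (congrArg Hom.lin (regularMap_equalizes e)) c
  exact sub_eq_zero.2 h

theorem exists_comp_regularMap : ∃ w : (HBicomod.cotensor (imageRegular e)
    (imageRegular e.symm)).right.toRComod ⟶ regular k C,
    w ≫ regularMap e = HBicomod.cotensorInclRComod _ _ := by
  refine e.exists_lift_transpose (fun W z => exists_lift_rcoact (imageRegular e) z)
    (HBicomod.cotensorInclRComod (imageRegular e) (imageRegular e.symm))
    (hom_ext fun x => ?_)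
  exact sub_eq_zero.1 x.2

theorem range_regularHom : LinearMap.range (regularHom e).lin =
    LinearMap.ker (HBicomod.cotensorDiff (imageRegular e) (imageRegular e.symm)) := by
  obtain ⟨w, hw⟩ := exists_comp_regularMap e
  refine le_antisymm ?_ fun x hx => ?_
  · rintro _ ⟨c, rfl⟩
    exact regularHom_mem_ker e c
  · exact ⟨w.lin ⟨x, hx⟩, LinearMap.congr_fun (congrArg Hom.lin hw) ⟨x, hx⟩⟩

theorem injective_regularHom : Function.Injective (regularHom e).lin := by
  obtain ⟨w, hw⟩ := exists_comp_regularMap e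
  obtain ⟨v, hv⟩ := exists_lift (HBicomod.cotensorInclRComod _ _)
    (HBicomod.incl_injective _ _) (regularMap e) fun c =>
      (HBicomod.range_incl _ _).ge (regularHom_mem_ker e c)
  have := mono_regularMap e
  have h : v ≫ w = 𝟙 _ := by rw [← cancel_mono (regularMap e), Category.assoc, hw, hv,
    Category.id_comp]
  have hv' : (HBicomod.incl (imageRegular e) (imageRegular e.symm)).lin ∘ₗ v.lin =
    (regularHom e).lin := congrArg Hom.lin hv
  rw [← hv']
  exact (HBicomod.incl_injective _ _).comp
    (Function.LeftInverse.injective (LinearMap.congr_fun (congrArg Hom.lin h)))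

/-- The isomorphism `M □ N ≅ C` for the images `M` of `C` and `N` of `D`. -/
noncomputable def cotensorImageIso : HBicomod.cotensor (imageRegular e) (imageRegular e.symm) ≅
    HBicomod.regular k H C :=
  HBicomod.isoOfRange (HBicomod.incl _ _) (regularHom e) (HBicomod.incl_injective _ _)
    (injective_regularHom e) ((HBicomod.range_incl _ _).trans (range_regularHom e).symm)

theorem exists_cotensor_iso_regular
    (h : LeftModuleEquivalent (RComod k H) (RComod k C) (RComod k D)) :
    ∃ (M : HBicomod k H C D) (N : HBicomod k H D C),
      Nonempty (M.cotensor N ≅ HBicomod.regular k H C) ∧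
      Nonempty (N.cotensor M ≅ HBicomod.regular k H D) := by
  obtain ⟨e⟩ := h.exists_equivalence
  exact ⟨imageRegular e, imageRegular e.symm, ⟨cotensorImageIso e⟩, ⟨cotensorImageIso e.symm⟩⟩

end RComod

end EqMT

namespace EqMT

/-! ### Reversing the order of tensor factors -/

section Reverse

variable {k : Type u} [Field k] {A A' B B' D : Type u} [AddCommGroup A] [Module k A]
  [AddCommGroup A'] [Module k A'] [AddCommGroup B] [Module k B] [AddCommGroup B'] [Module k B']
  [AddCommGroup D] [Module k D]

variable (k A B D) in
/-- The isomorphism `(a ⊗ d) ⊗ b ↦ (b ⊗ d) ⊗ a`. -/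
def reverse : (A ⊗[k] D) ⊗[k] B ≃ₗ[k] (B ⊗[k] D) ⊗[k] A :=
  ((TensorProduct.comm k (A ⊗[k] D) B).trans
    (TensorProduct.congr (LinearEquiv.refl k B) (TensorProduct.comm k A D))).trans
      (assoc k B D A).symm

/-- With `reverse_lTensor` this translates between the two orders of the factors, as needed when a
right coaction is written as one by an object acting from the left. -/
theorem reverse_rTensor (f : A →ₗ[k] D ⊗[k] A') (t : A ⊗[k] B) :
    reverse k A' B D (((TensorProduct.comm k D A').toLinearMap ∘ₗ f).rTensor B t) =
      (assoc k B D A').symm (f.lTensor B (TensorProduct.comm k A B t)) := by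
  refine indOn t (by simp) (fun a b => ?_) (fun _ _ hx hy => by simp only [map_add, hx, hy])
  simp only [LinearMap.rTensor_tmul, LinearMap.comp_apply, TensorProduct.comm_tmul,
    LinearMap.lTensor_tmul, LinearEquiv.coe_coe]
  generalize f a = s
  refine indOn s (by simp) (fun d a => ?_)
    (fun _ _ hx hy => by simp only [add_tmul, tmul_add, map_add, hx, hy])
  simp [reverse]

theorem reverse_lTensor (g : B →ₗ[k] B' ⊗[k] D) (t : A ⊗[k] B) :
    reverse k A B' D ((assoc k A D B').symm
      (((TensorProduct.comm k B' D).toLinearMap ∘ₗ g).lTensor A t)) =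
        g.rTensor A (TensorProduct.comm k A B t) := by
  refine indOn t (by simp) (fun a b => ?_) (fun _ _ hx hy => by simp only [map_add, hx, hy])
  simp only [LinearMap.rTensor_tmul, LinearMap.comp_apply, TensorProduct.comm_tmul,
    LinearMap.lTensor_tmul, LinearEquiv.coe_coe]
  generalize g b = s
  refine indOn s (by simp) (fun d a => ?_)
    (fun _ _ hx hy => by simp only [add_tmul, tmul_add, map_add, hx, hy])
  simp [reverse]

theorem leftComm_lTensor_comm (f : A →ₗ[k] B ⊗[k] A') (t : A ⊗[k] D) :
    TensorProduct.leftComm k D B A' (f.lTensor D (TensorProduct.comm k A D t)) =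
      (TensorProduct.comm k A' D).toLinearMap.lTensor B (assoc k B A' D (f.rTensor D t)) := by
  refine indOn t (by simp) (fun a d => ?_) (fun _ _ hx hy => by simp only [map_add, hx, hy])
  simp only [LinearMap.rTensor_tmul, TensorProduct.comm_tmul, LinearMap.lTensor_tmul]
  generalize f a = s
  refine indOn s (by simp) (fun d a => ?_)
    (fun _ _ hx hy => by simp only [add_tmul, tmul_add, map_add, hx, hy])
  simp

end Reverse

/-! ### The exchange map `h ⊗ v ↦ h₍₂₎ v ⊗ h₍₁₎` for left comodules -/

section SwapAct

variable {k H : Type u} [Field k] [Ring H] [Bialgebra k H]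
  {V W : Type u} [AddCommGroup V] [Module k V] [AddCommGroup W] [Module k W]

/-- The map `h ⊗ v ↦ h₍₂₎ v ⊗ h₍₁₎`. -/
def swapActL (φ : H →ₐ[k] Module.End k V) : H ⊗[k] V →ₗ[k] V ⊗[k] H :=
  (TensorProduct.comm k H V).toLinearMap ∘ₗ (actMap φ).lTensor H ∘ₗ
    (assoc k H H V).toLinearMap ∘ₗ comul.rTensor V

/-- The acting space `V` is now the right-hand factor of the bicomodule, so it receives `h₍₂₎`, and
the diagonal action appears after a flip. -/
theorem swapActL_diagAct (φ : H →ₐ[k] Module.End k V) (ψ : H →ₐ[k] Module.End k W) (h : H)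
    (t : W ⊗[k] V) : (actMap ψ).lTensor V (assoc k V H W ((swapActL φ).rTensor W
      ((assoc k H V W).symm (h ⊗ₜ TensorProduct.comm k W V t)))) =
        TensorProduct.comm k W V (diagAct ψ φ h t) := by
  refine indOn t (by simp) (fun v w => ?_)
    (fun _ _ hx hy => by simp only [tmul_add, map_add, hx, hy])
  rw [diagAct_tmul]
  simp only [TensorProduct.comm_tmul, TensorProduct.assoc_symm_tmul, LinearMap.rTensor_tmul,
    swapActL, LinearMap.comp_apply]
  generalize comul (R := k) h = s
  refine indOn s (by simp) (fun a b => ?_)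
    (fun _ _ hx hy => by simp only [add_tmul, map_add, hx, hy])
  simp

/-- Coassociativity again: `h₍₁₎ ⊗ h₍₃₎ v ⊗ h₍₂₎` on both sides, which is left colinearity of this
exchange map. -/
theorem swapActL_comul (φ : H →ₐ[k] Module.End k V) (h : H) (v : V) :
    TensorProduct.leftComm k V H H (comul.lTensor V (swapActL φ (h ⊗ₜ v))) =
      (swapActL φ).lTensor H (assoc k H H V (comul (R := k) h ⊗ₜ v)) := by
  have h1 : ∀ s : H ⊗[k] H, TensorProduct.leftComm k V H H (comul.lTensor V
      (TensorProduct.comm k H V ((actMap φ).lTensor H (assoc k H H V (s ⊗ₜ v))))) =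
      ((TensorProduct.comm k H V).toLinearMap ∘ₗ (actMap φ).lTensor H ∘ₗ
        (assoc k H H V).toLinearMap ∘ₗ (TensorProduct.mk k (H ⊗[k] H) V).flip v).lTensor H
          (assoc k H H H (comul.rTensor H s)) := by
    intro s
    refine indOn s (by simp) (fun a b => ?_)
      (fun _ _ hx hy => by simp only [add_tmul, map_add, hx, hy])
    simp only [TensorProduct.assoc_tmul, LinearMap.rTensor_tmul, LinearMap.lTensor_tmul,
      TensorProduct.comm_tmul]
    generalize comul (R := k) a = t
    refine indOn t (by simp) (fun a b => ?_)
      (fun _ _ hx hy => by simp only [add_tmul, tmul_add, map_add, hx, hy])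
    simp
  have h2 : ∀ s : H ⊗[k] H, (swapActL φ).lTensor H (assoc k H H V (s ⊗ₜ v)) =
      ((TensorProduct.comm k H V).toLinearMap ∘ₗ (actMap φ).lTensor H ∘ₗ
        (assoc k H H V).toLinearMap ∘ₗ (TensorProduct.mk k (H ⊗[k] H) V).flip v).lTensor H
          (comul.lTensor H s) := by
    intro s
    refine indOn s (by simp) (fun a b => ?_)
      (fun _ _ hx hy => by simp only [add_tmul, map_add, hx, hy])
    simp [swapActL]
  rw [h2, ← Coalgebra.coassoc_apply, ← h1]
  simp [swapActL]

theorem assoc_eq_mulCoactL (t : H ⊗[k] H) (v : V) :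
    assoc k H H V (t ⊗ₜ v) = mulCoactL k H H H V (t ⊗ₜ (1 ⊗ₜ v)) := by
  refine indOn t (by simp) (fun m c => ?_)
    (fun _ _ hx hy => by simp only [add_tmul, map_add, hx, hy])
  simp

variable {C : Type u} [AddCommGroup C] [Module k C] [Module H C] [IsScalarTower k H C]

theorem mulCoactL_one (v : V) (t : C ⊗[k] W) :
    mulCoactL k H C V W ((1 ⊗ₜ v) ⊗ₜ t) = TensorProduct.leftComm k V C W (v ⊗ₜ t) := by
  refine indOn t (by simp) (fun m c => ?_)
    (fun _ _ hx hy => by simp only [tmul_add, map_add, hx, hy])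
  simp

theorem lTensor_mulCoactL_comul (φ : H →ₐ[k] Module.End k V) (h : H) (t : C ⊗[k] V) :
    (actMap φ).lTensor C (mulCoactL k H C H V (comul (R := k) h ⊗ₜ t)) =
      diagAct (Algebra.lsmul k k C) φ h t := by
  rw [diagAct_eq]
  generalize comul (R := k) h = s
  refine indOn s (by simp) (fun a b => ?_)
    (fun _ _ hx hy => by simp only [add_tmul, map_add, hx, hy])
  refine indOn t (by simp) (fun m c => ?_)
    (fun _ _ hx hy => by simp only [tmul_add, map_add, hx, hy])
  simp

section ActOfMul

variable {f : H ⊗[k] V →ₗ[k] V} {hmul : ∀ h h' v, f (h ⊗ₜ f (h' ⊗ₜ v)) = f ((h * h') ⊗ₜ v)}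
  {hone : ∀ v, f (1 ⊗ₜ v) = v}

theorem actOfMul_comm_equivariant {l : V →ₗ[k] C ⊗[k] V}
    (hl : ∀ h v, l (f (h ⊗ₜ v)) = f.lTensor C (assoc k C H V
      ((swapActL (Algebra.lsmul k k C)).rTensor V ((assoc k H C V).symm (h ⊗ₜ l v))))) (h : H) :
    ((TensorProduct.comm k C V).toLinearMap ∘ₗ l) ∘ₗ actOfMul f hmul hone h =
      diagAct (actOfMul f hmul hone) (Algebra.lsmul k k C) h ∘ₗ
        (TensorProduct.comm k C V).toLinearMap ∘ₗ l :=
  LinearMap.ext fun v => by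
    have h1 := swapActL_diagAct (Algebra.lsmul k k C) (actOfMul f hmul hone) h
      (TensorProduct.comm k C V (l v))
    rw [TensorProduct.comm_comm, actMap_actOfMul, ← hl] at h1
    exact (congrArg (TensorProduct.comm k C V) h1).trans (TensorProduct.comm_comm _ _ _ _)

theorem actOfMul_lequivariant_of_mulCoactL {l : V →ₗ[k] C ⊗[k] V}
    (hl : ∀ h v, l (f (h ⊗ₜ v)) =
      f.lTensor C (mulCoactL k H C H V (comul (R := k) h ⊗ₜ l v))) (h : H) :
    l ∘ₗ actOfMul f hmul hone h =
      diagAct (Algebra.lsmul k k C) (actOfMul f hmul hone) h ∘ₗ l :=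
  LinearMap.ext fun v => by
    rw [LinearMap.comp_apply, LinearMap.comp_apply, ← lTensor_mulCoactL_comul, actMap_actOfMul]
    exact hl h v

end ActOfMul

end SwapAct

/-! ### Trivial and regular left comodules -/

namespace LComod

open Functor MonoidalLeftAction

section Trivial

variable {k H C : Type u} [Field k] [Ring H] [Bialgebra k H]
  [AddCommGroup C] [Module k C] [Coalgebra k C] [Module H C] [IsScalarTower k H C]
  (V W : Type u) [AddCommGroup V] [Module k V] [AddCommGroup W] [Module k W]

variable (k C) in
/-- The coalgebra `C` as a left comodule over itself. -/
def regular : LComod k C where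
  carrier := C
  coact := comul
  coassoc := Coalgebra.coassoc
  counit := by
    refine LinearMap.ext fun c => ?_
    simp

variable (k H) in
/-- The trivial comodule on a vector space. -/
def triv : LComod k H where
  carrier := V
  coact := TensorProduct.mk k H V 1
  coassoc := by
    ext v
    simp [Algebra.TensorProduct.one_def]
  counit := by
    ext v
    simp

variable [ModuleCoalgebra k H C]

theorem coact_tens_triv (Y : LComod k C) : (tens (triv k H V) Y).coact =
    (TensorProduct.leftComm k V C Y.carrier).toLinearMap ∘ₗ Y.coact.lTensor V :=
  TensorProduct.ext' fun v y => mulCoactL_one v (Y.coact y)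

theorem coact_tens_triv_triv : (tens (triv k H V) (triv k H W)).coact =
    TensorProduct.mk k H (V ⊗[k] W) 1 := by
  rw [coact_tens_triv]
  exact TensorProduct.ext' fun v w => rfl

variable {V W} in
/-- A linear map `V → W ⊗ W'` as a morphism of trivial comodules. -/
def trivHom {W' : Type u} [AddCommGroup W'] [Module k W'] (f : V →ₗ[k] W ⊗[k] W') :
    triv k H V ⟶ triv k H W ⊗ triv k H W' where
  lin := f
  comm := (congrArg (· ∘ₗ f) (coact_tens_triv_triv W W')).trans (LinearMap.ext fun _ => rfl)

variable {V} in
/-- A linear form as a morphism of trivial comodules. -/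
def trivForm (f : V →ₗ[k] k) : triv k H V ⟶ 𝟙_ (LComod k H) where
  lin := f
  comm := LinearMap.ext fun v => by
    change f v • ((1 : H) ⊗ₜ[k] (1 : k)) = 1 ⊗ₜ f v
    rw [← TensorProduct.tmul_smul, smul_eq_mul, mul_one]

variable {V} in
/-- The morphism `H ⊗ V ⟶ V ⊗ H`, `h ⊗ v ↦ h₍₂₎ v ⊗ h₍₁₎`. -/
def swapActHom (φ : H →ₐ[k] Module.End k V) :
    regular k H ⊗ triv k H V ⟶ triv k H V ⊗ regular k H where
  lin := (swapActL φ : H ⊗[k] V →ₗ[k] V ⊗[k] H)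
  comm := by
    refine (congrArg (· ∘ₗ swapActL φ) (coact_tens_triv V (regular k H))).trans ?_
    refine TensorProduct.ext' fun h v => (swapActL_comul φ h v).trans (congrArg _ ?_)
    exact assoc_eq_mulCoactL _ v

/-- The action of `H` as a morphism of comodules. -/
def actHom (P : HLComod k H C) : regular k H ⊙ₗ P.toLComod ⟶ P.toLComod where
  lin := (actMap P.act : H ⊗[k] P.carrier →ₗ[k] P.carrier)
  comm := TensorProduct.ext' fun h x => (LinearMap.congr_fun (P.equivariant h) x).trans
    (lTensor_mulCoactL_comul P.act h (P.coact x)).symm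

variable (k H) in
/-- The unit of `H` as a morphism of comodules. -/
def oneHom : 𝟙_ (LComod k H) ⟶ regular k H where
  lin := (Algebra.linearMap k H : k →ₗ[k] H)
  comm := LinearMap.ext_ring (by
    change comul (R := k) (A := H) (algebraMap k H 1) =
      (Algebra.linearMap k H).lTensor H ((1 : k) • ((1 : H) ⊗ₜ[k] (1 : k)))
    simp [Algebra.TensorProduct.one_def])

variable (k H) in
/-- The multiplication of `H` as a morphism of comodules. -/
def mulHom : regular k H ⊗ regular k H ⟶ regular k H :=
  actHom (HBicomod.regular k H H).left

end Trivial

end LComod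

end EqMT

namespace EqMT

/-! ### From an equivalence of left comodules over left `H`-comodules to bicomodules -/

section Comm

variable {k : Type u} [Field k] {C D U V W : Type u} [AddCommGroup C] [Module k C]
  [AddCommGroup D] [Module k D] [AddCommGroup U] [Module k U] [AddCommGroup V] [Module k V]
  [AddCommGroup W] [Module k W]

theorem lid_rTensor_comm (g : C →ₗ[k] k) (t : V ⊗[k] C) :
    lid k V (g.rTensor V (TensorProduct.comm k V C t)) = rid k V (g.lTensor V t) := by
  refine indOn t (by simp) (fun c v => ?_) (fun _ _ hx hy => by simp only [map_add, hx, hy])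
  simp

theorem rid_lTensor_comm (g : C →ₗ[k] k) (t : C ⊗[k] V) :
    rid k V (g.lTensor V (TensorProduct.comm k C V t)) = lid k V (g.rTensor V t) := by
  rw [← lid_rTensor_comm, TensorProduct.comm_comm]

theorem comm_comp_comm (f : U →ₗ[k] V ⊗[k] W) : (TensorProduct.comm k W V).toLinearMap ∘ₗ
    (TensorProduct.comm k V W).toLinearMap ∘ₗ f = f :=
  LinearMap.ext fun _ => TensorProduct.comm_comm _ _ _ _

/-- The hypothesis is colinearity in the module category, where the trivial factor `V` comes first;
the conclusion is colinearity in the order used for bicomodules. -/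
theorem comm_lcolinear {f : U →ₗ[k] V ⊗[k] W} {σ : W →ₗ[k] D ⊗[k] W} {τ : U →ₗ[k] D ⊗[k] U}
    (h : ∀ x, TensorProduct.leftComm k V D W (σ.lTensor V (f x)) = f.lTensor D (τ x)) :
    (assoc k D W V).toLinearMap ∘ₗ σ.rTensor V ∘ₗ (TensorProduct.comm k V W).toLinearMap ∘ₗ f =
      ((TensorProduct.comm k V W).toLinearMap ∘ₗ f).lTensor D ∘ₗ τ :=
  LinearMap.ext fun x => by
    have h1 := leftComm_lTensor_comm σ (TensorProduct.comm k V W (f x))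
    rw [TensorProduct.comm_comm, h] at h1
    have h2 := congrArg ((TensorProduct.comm k V W).toLinearMap.lTensor D) h1
    rw [← LinearMap.lTensor_comp_apply, ← LinearMap.lTensor_comp_apply] at h2
    refine Eq.trans ?_ h2.symm
    have hc : (TensorProduct.comm k V W).toLinearMap ∘ₗ (TensorProduct.comm k W V).toLinearMap =
      LinearMap.id := LinearMap.ext fun x => TensorProduct.comm_comm _ _ _ _
    rw [hc, LinearMap.lTensor_id]
    rfl

theorem comm_rcolinear {f : U →ₗ[k] V ⊗[k] W} {ρ : V →ₗ[k] V ⊗[k] D} {τ : U →ₗ[k] U ⊗[k] D}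
    (h : ∀ x, ((TensorProduct.comm k V D).toLinearMap ∘ₗ ρ).rTensor W (f x) =
      (assoc k D V W).symm (f.lTensor D (TensorProduct.comm k U D (τ x)))) :
    (assoc k W V D).symm.toLinearMap ∘ₗ ρ.lTensor W ∘ₗ
      (TensorProduct.comm k V W).toLinearMap ∘ₗ f =
        ((TensorProduct.comm k V W).toLinearMap ∘ₗ f).rTensor D ∘ₗ τ :=
  LinearMap.ext fun x => by
    have h1 := reverse_rTensor ρ (f x)
    have h2 := reverse_lTensor ((TensorProduct.comm k V W).toLinearMap ∘ₗ f)
      (TensorProduct.comm k U D (τ x))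
    rw [comm_comp_comm, TensorProduct.comm_comm, ← h, h1] at h2
    exact h2

end Comm

open Functor MonoidalLeftAction

variable {k H C D : Type u} [Field k] [Ring H] [Bialgebra k H]
  [AddCommGroup C] [Module k C] [Coalgebra k C] [Module H C] [IsScalarTower k H C]
  [AddCommGroup D] [Module k D] [Coalgebra k D] [Module H D] [IsScalarTower k H D]

variable (k C) in
/-- The opposite comultiplication `c ↦ c₍₂₎ ⊗ c₍₁₎`. -/
def comulOp : C →ₗ[k] C ⊗[k] C :=
  (TensorProduct.comm k C C).toLinearMap ∘ₗ comul

/-- A left coaction by the trivial comodule on `C` that is coassociative for `comulOp` is, after a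
flip, a right coaction for the comultiplication itself. -/
theorem comm_coassoc {V : Type u} [AddCommGroup V] [Module k V] (l : V →ₗ[k] C ⊗[k] V)
    (h : ∀ x, (assoc k C C V).symm (l.lTensor C (l x)) = (comulOp k C).rTensor V (l x)) :
    (assoc k V C C).toLinearMap ∘ₗ ((TensorProduct.comm k C V).toLinearMap ∘ₗ l).rTensor C ∘ₗ
      (TensorProduct.comm k C V).toLinearMap ∘ₗ l =
        (comul (R := k) (A := C)).lTensor V ∘ₗ (TensorProduct.comm k C V).toLinearMap ∘ₗ l :=
  LinearMap.ext fun x => by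
    have h1 := reverse_lTensor ((TensorProduct.comm k C V).toLinearMap ∘ₗ l) (l x)
    have h2 := reverse_rTensor (comul (R := k) (A := C)) (l x)
    rw [comm_comp_comm, h] at h1
    exact (LinearEquiv.eq_symm_apply _).1 (h1.symm.trans h2)

namespace HBicomod

/-- The map `m ↦ m₍₀₎ ⊗ m₍₋₁₎`. -/
def lcoactOp (M : HBicomod k H D C) : M.carrier →ₗ[k] M.carrier ⊗[k] D :=
  (TensorProduct.comm k D M.carrier).toLinearMap ∘ₗ M.lcoact

/-- The map `m ↦ m₍₁₎ ⊗ m₍₀₎`. -/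
def rcoactOp (M : HBicomod k H D C) : M.carrier →ₗ[k] C ⊗[k] M.carrier :=
  (TensorProduct.comm k M.carrier C).toLinearMap ∘ₗ M.rcoact

theorem lcoactOp_coassoc (M : HBicomod k H D C) (x : M.carrier) :
    M.lcoactOp.rTensor D (M.lcoactOp x) =
      (assoc k M.carrier D D).symm ((comulOp k D).lTensor M.carrier (M.lcoactOp x)) := by
  refine (reverse k M.carrier D D).injective ?_
  refine (reverse_rTensor M.lcoact (M.lcoactOp x)).trans ?_
  refine Eq.trans ?_ (reverse_lTensor (comul (R := k) (A := D)) (M.lcoactOp x)).symm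
  simp only [lcoactOp, LinearMap.comp_apply, LinearEquiv.coe_coe, TensorProduct.comm_comm]
  exact (LinearEquiv.symm_apply_eq _).2 (LinearMap.congr_fun M.lcoassoc x).symm

/-- The bicomodule axiom read in reverse order of the three tensor factors. -/
theorem lcoactOp_rcoactOp (M : HBicomod k H D C) (x : M.carrier) :
    M.rcoactOp.rTensor D (M.lcoactOp x) =
      (assoc k C M.carrier D).symm (M.lcoactOp.lTensor C (M.rcoactOp x)) := by
  refine (reverse k C D M.carrier).injective ?_
  refine (reverse_rTensor M.rcoact (M.lcoactOp x)).trans ?_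
  refine Eq.trans ?_ (reverse_lTensor M.lcoact (M.rcoactOp x)).symm
  simp only [lcoactOp, rcoactOp, LinearMap.comp_apply, LinearEquiv.coe_coe,
    TensorProduct.comm_comm]
  exact (LinearEquiv.symm_apply_eq _).2 (LinearMap.congr_fun M.bicomod x).symm

/-- The left coaction as a morphism of trivial left comodules. -/
def lcoactLTriv (M : HBicomod k H D C) : LComod.triv k H M.carrier ⟶
    LComod.triv k H M.carrier ⊗ LComod.triv k H D :=
  LComod.trivHom M.lcoactOp

/-- The right coaction as a morphism of trivial left comodules. -/
def rcoactLTriv (M : HBicomod k H D C) : LComod.triv k H M.carrier ⟶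
    LComod.triv k H C ⊗ LComod.triv k H M.carrier :=
  LComod.trivHom M.rcoactOp

/-- The left coaction as a morphism of left comodules. -/
def lcoactLComod [ModuleCoalgebra k H D] (M : HBicomod k H D C) :
    M.left.toLComod ⟶ LComod.triv k H M.carrier ⊙ₗ LComod.regular k D where
  lin := M.lcoactOp
  comm := (congrArg (· ∘ₗ M.lcoactOp)
    (LComod.coact_tens_triv M.carrier (LComod.regular k D))).trans
      (LinearMap.ext fun x => (leftComm_lTensor_comm (comul (R := k) (A := D)) (M.lcoact x)).trans
        ((congrArg _ (LinearMap.congr_fun M.lcoassoc x)).trans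
          (LinearMap.lTensor_comp_apply _ _ _ _).symm))

/-- The right coaction as a morphism of left comodules. -/
def rcoactLComod [ModuleCoalgebra k H D] (M : HBicomod k H D C) :
    M.left.toLComod ⟶ LComod.triv k H C ⊙ₗ M.left.toLComod where
  lin := M.rcoactOp
  comm := (congrArg (· ∘ₗ M.rcoactOp) (LComod.coact_tens_triv C M.left.toLComod)).trans
    (LinearMap.ext fun x => (leftComm_lTensor_comm M.lcoact (M.rcoact x)).trans
        ((congrArg _ (LinearMap.congr_fun M.bicomod x)).trans
          (LinearMap.lTensor_comp_apply _ _ _ _).symm))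

/-- The inclusion `N □ M ⟶ N ⊗ M ≅ M ⊗ N` as a morphism of left comodules. -/
noncomputable def cotensorInclLComod [ModuleCoalgebra k H C] (N : HBicomod k H C D)
    (M : HBicomod k H D C) :
    (cotensor N M).left.toLComod ⟶ LComod.triv k H M.carrier ⊙ₗ N.left.toLComod where
  lin := (TensorProduct.comm k N.carrier M.carrier).toLinearMap ∘ₗ (incl N M).lin
  comm := (congrArg (· ∘ₗ (TensorProduct.comm k N.carrier M.carrier).toLinearMap ∘ₗ (incl N M).lin)
    (LComod.coact_tens_triv M.carrier N.left.toLComod)).trans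
      (LinearMap.ext fun x => (leftComm_lTensor_comm N.lcoact ((incl N M).lin x)).trans
        ((congrArg _ (LinearMap.congr_fun (incl N M).lcomm x)).trans
          (LinearMap.lTensor_comp_apply _ _ _ _).symm))

end HBicomod

namespace LComod

/-- The bicomodule given by a right coaction and an action of `H` in the category of left
comodules. -/
def bicomod [ModuleCoalgebra k H D] (P : LComod k D) (l : P ⟶ triv k H C ⊙ₗ P)
    (a : regular k H ⊙ₗ P ⟶ P)
    (h : l ≫ _ ⊴ₗ l ≫ (αₗ _ _ P).inv = l ≫ trivHom (comulOp k C) ⊵ₗ P)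
    (h' : l ≫ trivForm (CoalgebraStruct.counit (R := k) (A := C)) ⊵ₗ P ≫ (λₗ P).hom = 𝟙 P)
    (hmul : (αₗ _ _ P).hom ≫ regular k H ⊴ₗ a ≫ a = mulHom k H ⊵ₗ P ≫ a)
    (hone : (λₗ P).inv ≫ oneHom k H ⊵ₗ P ≫ a = 𝟙 P)
    (hla : a ≫ l = regular k H ⊴ₗ l ≫ (αₗ _ _ P).inv ≫ swapActHom (Algebra.lsmul k k C) ⊵ₗ P ≫
      (αₗ _ _ P).hom ≫ triv k H C ⊴ₗ a) : HBicomod k H D C where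
  carrier := P.carrier
  act := actOfMul (a.lin : H ⊗[k] P.carrier →ₗ[k] P.carrier)
    (fun (h : H) (h' : H) x =>
      LinearMap.congr_fun (congrArg Hom.lin hmul) ((h ⊗ₜ[k] h') ⊗ₜ[k] x))
    (fun x => by
      have h := LinearMap.congr_fun (congrArg Hom.lin hone) x
      change a.lin ((algebraMap k H 1) ⊗ₜ[k] x) = x at h
      rwa [map_one] at h)
  lcoact := P.coact
  rcoact := (TensorProduct.comm k C P.carrier).toLinearMap ∘ₗ
    (show P.carrier →ₗ[k] C ⊗[k] P.carrier from l.lin)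
  lcoassoc := P.coassoc
  lcounit := P.counit
  rcoassoc := comm_coassoc _ fun x => LinearMap.congr_fun (congrArg Hom.lin h) x
  rcounit := LinearMap.ext fun x =>
    (rid_lTensor_comm _ _).trans (LinearMap.congr_fun (congrArg Hom.lin h') x)
  bicomod := comm_lcolinear fun x => (LinearMap.congr_fun (l.comm.symm.trans
    (congrArg (· ∘ₗ l.lin) (coact_tens_triv C P))) x).symm
  lequivariant := actOfMul_lequivariant_of_mulCoactL fun (h : H) x =>
    LinearMap.congr_fun a.comm (h ⊗ₜ[k] x)
  requivariant := actOfMul_comm_equivariant (C := C)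
    (l := show P.carrier →ₗ[k] C ⊗[k] P.carrier from l.lin) fun (h : H) x =>
    LinearMap.congr_fun (congrArg Hom.lin hla) (h ⊗ₜ[k] x)

variable [ModuleCoalgebra k H C]

variable (k H C) in
/-- The comultiplication as a right coaction on the left comodule `C`. -/
def comulHom : regular k C ⟶ triv k H C ⊙ₗ regular k C :=
  (HBicomod.regular k H C).rcoactLComod

variable (k H C) in
theorem comulHom_coassoc : comulHom k H C ≫ _ ⊴ₗ comulHom k H C ≫ (αₗ _ _ _).inv =
    comulHom k H C ≫ trivHom (comulOp k C) ⊵ₗ _ :=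
  hom_ext fun (c : C) => ((HBicomod.regular k H C).lcoactOp_coassoc c).symm

variable (k H C) in
theorem comulHom_counit : comulHom k H C ≫
    trivForm (CoalgebraStruct.counit (R := k) (A := C)) ⊵ₗ _ ≫ (λₗ _).hom = 𝟙 _ := by
  refine hom_ext fun (c : C) => ?_
  exact (lid_rTensor_comm _ _).trans (LinearMap.congr_fun (HBicomod.regular k H C).rcounit c)

variable (k H C) in
/-- The action of `H` on `C` as a morphism of left comodules. -/
def smulHom : regular k H ⊙ₗ regular k C ⟶ regular k C :=
  actHom (HBicomod.regular k H C).left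

variable (k H C) in
theorem smulHom_mul : (αₗ _ _ _).hom ≫ regular k H ⊴ₗ smulHom k H C ≫ smulHom k H C =
    mulHom k H ⊵ₗ regular k C ≫ smulHom k H C :=
  Hom.ext (ext_threefold fun (h : H) (h' : H) (c : C) => (mul_smul h h' c).symm)

variable (k H C) in
theorem smulHom_one :
    (λₗ _).inv ≫ oneHom k H ⊵ₗ regular k C ≫ smulHom k H C = 𝟙 _ := by
  refine hom_ext fun (c : C) => ?_
  change algebraMap k H 1 • c = c
  simp

variable (k H C) in
theorem smulHom_comulHom : smulHom k H C ≫ comulHom k H C =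
    regular k H ⊴ₗ comulHom k H C ≫ (αₗ _ _ (regular k C)).inv ≫
      swapActHom (Algebra.lsmul k k C) ⊵ₗ regular k C ≫ (αₗ _ _ (regular k C)).hom ≫
        triv k H C ⊴ₗ smulHom k H C :=
  Hom.ext (TensorProduct.ext' fun (h : H) (c : C) => (congrArg (TensorProduct.comm k C C)
    (LinearMap.congr_fun ((HBicomod.regular k H C).requivariant h) c)).trans
      (swapActL_diagAct (Algebra.lsmul k k C) (Algebra.lsmul k k C) h
        (comul (R := k) (A := C) c)).symm)

theorem actHom_lcoact (M : HBicomod k H C D) : actHom M.left ≫ M.lcoactLComod =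
    regular k H ⊴ₗ M.lcoactLComod ≫ (αₗ _ _ (regular k C)).inv ≫
      swapActHom M.act ⊵ₗ regular k C ≫ (αₗ _ _ (regular k C)).hom ≫
        triv k H M.carrier ⊴ₗ smulHom k H C :=
  Hom.ext (TensorProduct.ext' fun (h : H) (x : M.carrier) =>
    (congrArg (TensorProduct.comm k C M.carrier) (LinearMap.congr_fun (M.lequivariant h) x)).trans
      (swapActL_diagAct M.act (Algebra.lsmul k k C) h (M.lcoact x)).symm)

theorem rcoact_lcoact (M : HBicomod k H C D) :
    M.lcoactLComod ≫ M.rcoactLTriv ⊵ₗ regular k C =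
      M.rcoactLComod ≫ triv k H D ⊴ₗ M.lcoactLComod ≫ (αₗ _ _ (regular k C)).inv :=
  hom_ext fun x => M.lcoactOp_rcoactOp x

theorem lcoactOp_injective (M : HBicomod k H C D) : Function.Injective M.lcoactOp :=
  (TensorProduct.comm k C M.carrier).injective.comp M.lcoact_injective

/-- Reversal turns the hypothesis into membership in the kernel for `Δ` and the left coaction, which
`ker_coactionDiff_comul_left` identifies with the range of the latter. -/
theorem mem_range_lcoactOp (M : HBicomod k H C D) {t : M.carrier ⊗[k] C}
    (ht : M.lcoactOp.rTensor C t =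
      (assoc k M.carrier C C).symm ((comulOp k C).lTensor M.carrier t)) :
    t ∈ LinearMap.range M.lcoactOp := by
  have h := congrArg (reverse k M.carrier C C) ht
  rw [HBicomod.lcoactOp, comulOp, reverse_rTensor, reverse_lTensor] at h
  obtain ⟨x, hx⟩ := (ker_coactionDiff_comul_left M.lcoassoc).le
    (LinearMap.mem_ker.2 (sub_eq_zero.2 h.symm))
  refine ⟨x, ?_⟩
  rw [HBicomod.lcoactOp, LinearMap.comp_apply, hx]
  exact TensorProduct.comm_comm _ _ _ _

theorem exists_lift_lcoact (M : HBicomod k H C D) {W : LComod k C}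
    (z : W ⟶ triv k H M.carrier ⊙ₗ regular k C)
    (hz : z ≫ M.lcoactLTriv ⊵ₗ _ =
      z ≫ triv k H M.carrier ⊴ₗ comulHom k H C ≫ (αₗ _ _ _).inv) :
    ∃ w : W ⟶ M.left.toLComod, w ≫ M.lcoactLComod = z :=
  exists_lift M.lcoactLComod (lcoactOp_injective M) z fun x =>
    mem_range_lcoactOp M (LinearMap.congr_fun (congrArg Hom.lin hz) x)

theorem lcoact_equalizes (M : HBicomod k H C D) :
    M.lcoactLComod ≫ M.lcoactLTriv ⊵ₗ regular k C =
      M.lcoactLComod ≫ triv k H M.carrier ⊴ₗ comulHom k H C ≫ (αₗ _ _ _).inv :=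
  hom_ext fun x => M.lcoactOp_coassoc x

variable [ModuleCoalgebra k H D]
  (e : LeftModuleEquivalence (LComod k H) (LComod k C) (LComod k D))

/-- The image of the bicomodule `C` under an equivalence of module categories. -/
noncomputable def imageRegular : HBicomod k H D C :=
  bicomod (e.F.obj (regular k C)) (e.coactMap (comulHom k H C)) (e.actionMap (smulHom k H C))
    (e.coactMap_coassoc (comulHom_coassoc k H C)) (e.coactMap_counit (comulHom_counit k H C))
    (e.actionMap_mul (smulHom_mul k H C)) (e.actionMap_one (smulHom_one k H C))
    (e.actionMap_coactMap (smulHom_comulHom k H C))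

theorem actHom_imageRegular : actHom (imageRegular e).left = e.actionMap (smulHom k H C) :=
  Hom.ext (TensorProduct.ext' fun (_ : H) (_ : (e.F.obj (regular k C)).carrier) => rfl)

/-- The right coaction was defined by flipping the transported one, and flipping it once more
restores it. Transported identities thus become statements about `rcoactLComod`. -/
theorem rcoactLComod_imageRegular :
    (imageRegular e).rcoactLComod = e.coactMap (comulHom k H C) :=
  hom_ext fun (x : (e.F.obj (regular k C)).carrier) =>
    let t : C ⊗[k] (e.F.obj (regular k C)).carrier := (e.coactMap (comulHom k H C)).lin x
    TensorProduct.comm_comm _ _ _ t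

/-- The morphism `C ⟶ M ⊗ N` of left comodules for the images `M` of `C` and `N` of `D`. -/
noncomputable def regularMap : regular k C ⟶
    triv k H (imageRegular e).carrier ⊙ₗ (imageRegular e.symm).left.toLComod :=
  e.transpose (A := regular k C) (B := regular k D)
    (X := triv k H (imageRegular e).carrier) ((imageRegular e).lcoactLComod)

theorem regularMap_rcoact : regularMap e ≫ (imageRegular e).rcoactLTriv ⊵ₗ _ =
    comulHom k H C ≫ _ ⊴ₗ regularMap e ≫ (αₗ _ _ (imageRegular e.symm).left.toLComod).inv := by
  have h := rcoact_lcoact (imageRegular e)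
  rw [rcoactLComod_imageRegular] at h
  exact e.transpose_whisker (X := triv k H (imageRegular e).carrier) h

theorem actHom_regularMap : smulHom k H C ≫ regularMap e =
    regular k H ⊴ₗ regularMap e ≫ (αₗ _ _ (imageRegular e.symm).left.toLComod).inv ≫
      swapActHom (imageRegular e).act ⊵ₗ (imageRegular e.symm).left.toLComod ≫
      (αₗ _ _ (imageRegular e.symm).left.toLComod).hom ≫
        triv k H (imageRegular e).carrier ⊴ₗ actHom (imageRegular e.symm).left := by
  have h := actHom_lcoact (imageRegular e)
  rw [actHom_imageRegular] at h
  rw [actHom_imageRegular]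
  exact e.action_transpose (X := triv k H (imageRegular e).carrier) h

theorem regularMap_equalizes : regularMap e ≫ (imageRegular e).lcoactLTriv ⊵ₗ _ =
    regularMap e ≫ triv k H (imageRegular e).carrier ⊴ₗ (imageRegular e.symm).rcoactLComod ≫
      (αₗ _ _ _).inv := by
  rw [rcoactLComod_imageRegular]
  exact e.transpose_equalizes (lcoact_equalizes (imageRegular e))

theorem mono_regularMap : Mono (regularMap e) :=
  e.mono_transpose (mono_of_injective (imageRegular e).lcoactLComod
    (lcoactOp_injective (imageRegular e)))

/-- The morphism `C ⟶ N ⊗ M` of bicomodules that corresponds to a map `C → M ⊗ N`. -/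
def homOfSwap (N : HBicomod k H C D) (M : HBicomod k H D C) (f : C →ₗ[k] M.carrier ⊗[k] N.carrier)
    (hact : ∀ (h : H) (c : C), f (h • c) = (actMap N.act).lTensor M.carrier (assoc k _ H _
      ((swapActL M.act).rTensor N.carrier ((assoc k H _ _).symm (h ⊗ₜ f c)))))
    (hl : ∀ c, TensorProduct.leftComm k M.carrier C N.carrier (N.lcoact.lTensor M.carrier (f c)) =
      f.lTensor C (comul (R := k) c))
    (hr : ∀ c, M.rcoactOp.rTensor N.carrier (f c) =
      (assoc k _ _ _).symm (f.lTensor C (comulOp k C c))) :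
    HBicomod.regular k H C ⟶ HBicomod.ext N M where
  lin := ((TensorProduct.comm k M.carrier N.carrier).toLinearMap ∘ₗ f :
    C →ₗ[k] N.carrier ⊗[k] M.carrier)
  comm_act h := LinearMap.ext fun (c : C) => by
    have h1 := swapActL_diagAct M.act N.act h
      (TensorProduct.comm k M.carrier N.carrier (f c))
    rw [TensorProduct.comm_comm, ← hact] at h1
    exact (congrArg (TensorProduct.comm k M.carrier N.carrier) h1).trans
      (TensorProduct.comm_comm _ _ _ _)
  lcomm := comm_lcolinear hl
  rcomm := comm_rcolinear hr

/-- The morphism `C ⟶ N ⊗ M` of bicomodules for the images `M` of `C` and `N` of `D`. -/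
noncomputable def regularHom : HBicomod.regular k H C ⟶
    HBicomod.ext (imageRegular e.symm) (imageRegular e) :=
  homOfSwap _ _ (regularMap e).lin
    (fun h c => LinearMap.congr_fun (congrArg Hom.lin (actHom_regularMap e)) (h ⊗ₜ[k] c))
    (fun c => LinearMap.congr_fun ((congrArg (· ∘ₗ (regularMap e).lin) (coact_tens_triv
      (imageRegular e).carrier (imageRegular e.symm).left.toLComod)).symm.trans
        (regularMap e).comm) c)
    (fun c => LinearMap.congr_fun (congrArg Hom.lin (regularMap_rcoact e)) c)

/-- Matches the equalizer condition on `M ⊗ N` in the module category with the cotensor condition on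
`N ⊗ M`; `reverse` exchanges the two sides of the equation. -/
theorem comm_mem_ker_cotensorDiff (N : HBicomod k H C D) (M : HBicomod k H D C)
    (t : M.carrier ⊗[k] N.carrier) : TensorProduct.comm k M.carrier N.carrier t ∈
      LinearMap.ker (HBicomod.cotensorDiff N M) ↔ M.lcoactOp.rTensor N.carrier t =
        (assoc k M.carrier D N.carrier).symm (N.rcoactOp.lTensor M.carrier t) := by
  rw [← (reverse k M.carrier N.carrier D).injective.eq_iff, HBicomod.lcoactOp, HBicomod.rcoactOp,
    reverse_rTensor, reverse_lTensor, LinearMap.mem_ker, eq_comm (a := (assoc k _ _ _).symm _)]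
  exact sub_eq_zero

theorem mem_ker_cotensorDiff (N : HBicomod k H C D) (M : HBicomod k H D C)
    (t : N.carrier ⊗[k] M.carrier) : t ∈ LinearMap.ker (HBicomod.cotensorDiff N M) ↔
      M.lcoactOp.rTensor N.carrier (TensorProduct.comm k N.carrier M.carrier t) =
        (assoc k M.carrier D N.carrier).symm
          (N.rcoactOp.lTensor M.carrier (TensorProduct.comm k N.carrier M.carrier t)) := by
  rw [← comm_mem_ker_cotensorDiff, TensorProduct.comm_comm]

theorem regularHom_mem_ker (c : C) : (regularHom e).lin c ∈
    LinearMap.ker (HBicomod.cotensorDiff (imageRegular e.symm) (imageRegular e)) :=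
  (comm_mem_ker_cotensorDiff _ _ _).2
    (LinearMap.congr_fun (congrArg Hom.lin (regularMap_equalizes e)) c)

theorem exists_comp_regularMap : ∃ w : (HBicomod.cotensor (imageRegular e.symm)
    (imageRegular e)).left.toLComod ⟶ regular k C,
    w ≫ regularMap e = HBicomod.cotensorInclLComod _ _ := by
  refine e.exists_lift_transpose (fun W z => exists_lift_lcoact (imageRegular e) z)
    (HBicomod.cotensorInclLComod (imageRegular e.symm) (imageRegular e))
    (hom_ext fun x => ?_)
  rw [← rcoactLComod_imageRegular]
  exact (mem_ker_cotensorDiff (imageRegular e.symm) (imageRegular e) _).1 x.2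

theorem range_regularHom : LinearMap.range (regularHom e).lin =
    LinearMap.ker (HBicomod.cotensorDiff (imageRegular e.symm) (imageRegular e)) := by
  obtain ⟨w, hw⟩ := exists_comp_regularMap e
  refine le_antisymm ?_ fun x hx => ?_
  · rintro _ ⟨c, rfl⟩
    exact regularHom_mem_ker e c
  · refine ⟨w.lin ⟨x, hx⟩, ?_⟩
    exact (congrArg (TensorProduct.comm k _ _)
      (LinearMap.congr_fun (congrArg Hom.lin hw) ⟨x, hx⟩)).trans (TensorProduct.comm_comm _ _ _ _)

theorem injective_regularHom : Function.Injective (regularHom e).lin := by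
  obtain ⟨w, hw⟩ := exists_comp_regularMap e
  have hi : Function.Injective (HBicomod.cotensorInclLComod (imageRegular e.symm)
      (imageRegular e)).lin :=
    (TensorProduct.comm k _ _).injective.comp (HBicomod.incl_injective _ _)
  obtain ⟨v, hv⟩ := exists_lift (HBicomod.cotensorInclLComod _ _) hi (regularMap e) fun c =>
    -- The preimage in `N □ M` is the flip of the value of `regularMap`, which is the value of
    -- `regularHom`.
    ⟨⟨_, regularHom_mem_ker e c⟩, TensorProduct.comm_comm _ _ _ _⟩
  have := mono_regularMap e
  have h : v ≫ w = 𝟙 _ := by rw [← cancel_mono (regularMap e), Category.assoc, hw, hv,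
    Category.id_comp]
  refine (TensorProduct.comm k _ _).injective.comp ?_
  rw [← hv]
  exact hi.comp (Function.LeftInverse.injective (LinearMap.congr_fun (congrArg Hom.lin h)))

/-- The isomorphism `N □ M ≅ C` for the images `M` of `C` and `N` of `D`. -/
noncomputable def cotensorImageIso : HBicomod.cotensor (imageRegular e.symm) (imageRegular e) ≅
    HBicomod.regular k H C :=
  HBicomod.isoOfRange (HBicomod.incl _ _) (regularHom e) (HBicomod.incl_injective _ _)
    (injective_regularHom e) ((HBicomod.range_incl _ _).trans (range_regularHom e).symm)

theorem exists_cotensor_iso_regular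
    (h : LeftModuleEquivalent (LComod k H) (LComod k C) (LComod k D)) :
    ∃ (M : HBicomod k H C D) (N : HBicomod k H D C),
      Nonempty (M.cotensor N ≅ HBicomod.regular k H C) ∧
      Nonempty (N.cotensor M ≅ HBicomod.regular k H D) := by
  obtain ⟨e⟩ := h.exists_equivalence
  exact ⟨imageRegular e.symm, imageRegular e, ⟨cotensorImageIso e⟩, ⟨cotensorImageIso e.symm⟩⟩

end LComod

end EqMT

theorem mainTheorem8 {k H C D : Type u} [Field k] [Ring H] [Bialgebra k H]
    [AddCommGroup C] [Module k C] [Coalgebra k C] [Module H C] [IsScalarTower k H C]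
    [EqMT.ModuleCoalgebra k H C]
    [AddCommGroup D] [Module k D] [Coalgebra k D] [Module H D] [IsScalarTower k H D]
    [EqMT.ModuleCoalgebra k H D] :
    List.TFAE [
      EqMT.LeftModuleEquivalent (EqMT.RComod k H) (EqMT.RComod k C) (EqMT.RComod k D),
      EqMT.LeftModuleEquivalent (EqMT.LComod k H) (EqMT.LComod k C) (EqMT.LComod k D),
      EqMT.LeftModuleEquivalent (EqMT.HMod k H) (EqMT.HRComod k H C) (EqMT.HRComod k H D),
      EqMT.RightModuleEquivalent (EqMT.HMod k H) (EqMT.HLComod k H C) (EqMT.HLComod k H D),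
      ∃ (M : EqMT.HBicomod k H C D) (N : EqMT.HBicomod k H D C),
        Nonempty (M.cotensor N ≅ EqMT.HBicomod.regular k H C) ∧
        Nonempty (N.cotensor M ≅ EqMT.HBicomod.regular k H D)] := by
  tfae_have 1 → 5 := EqMT.RComod.exists_cotensor_iso_regular
  tfae_have 5 → 1 := fun ⟨_, _, ⟨κ⟩, ⟨κ'⟩⟩ => EqMT.RComod.leftModuleEquivalent κ κ'
  tfae_have 2 → 5 := EqMT.LComod.exists_cotensor_iso_regular
  tfae_have 5 → 2 := fun ⟨_, _, ⟨κ⟩, ⟨κ'⟩⟩ => EqMT.LComod.leftModuleEquivalent κ κ'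
  tfae_have 3 → 5 := EqMT.HRComod.exists_cotensor_iso_regular
  tfae_have 5 → 3 := fun ⟨_, _, ⟨κ⟩, ⟨κ'⟩⟩ => EqMT.HRComod.leftModuleEquivalent κ κ'
  tfae_have 4 → 5 := EqMT.HLComod.exists_cotensor_iso_regular
  tfae_have 5 → 4 := fun ⟨_, _, ⟨κ⟩, ⟨κ'⟩⟩ => EqMT.HLComod.rightModuleEquivalent κ κ'
  tfae_finish
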